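/- **Setting.** Let $c\in\mathbb C\setminus\{0\}$ and $$g(x,y)=\frac{c}{x-y},\qquad f(x,y)=\frac{x-y+c}{x-y},\qquad h(x,y)=\frac{x-y+c}{c}.$$ Put $[1]=[2]=0$, $[3]=1$. Let $T_{ij}(u)$ ($1\le i,j\le 3$, $u\in D\subseteq\mathbb C$) be linear operators on a complex vector space $\mathcal H$ which are the entries of a monodromy matrix with $\mathfrak{gl}(2|1)$ symmetry, i.e. for all $u\ne v$ in $D$ and all $i,j,k,l$ $$T_{ij}(u)T_{kl}(v)-(-1)^{([i]+[j])([k]+[l])}T_{kl}(v)T_{ij}(u)=(-1)^{[i]([k]+[l])+[k][l]}g(u,v)\bigl(T_{kj}(v)T_{il}(u)-T_{kj}(u)T_{il}(v)\bigr).$$ Let $\Omega\in\mathcal H$ be a pseudovacuum, $T_{ii}(u)\Omega=\lambda_i(u)\Omega$ and $T_{ij}(u)\Omega=0$ for $i>j$, and let $\Omega^\dagger$ be a dual pseudovacuum, a linear functional on $\mathcal H$ with $\Omega^\dagger T_{ii}(u)=\lambda_i(u)\Omega^\dagger$ and $\Omega^\dagger T_{ij}(u)=0$ for $i<j$, with the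 same functions $\lambda_i$. **Notation.** For sets of variables, $g,f,h$ and $\lambda_2$ denote the products over the sets, e.g. $f(\bar u,\bar v)=\prod_{j,k}f(u_j,v_k)$, $\lambda_2(\bar v)=\prod_k\lambda_2(v_k)$; likewise $T_{ij}(\bar u)=\prod_k T_{ij}(u_k)$ when $[i]+[j]$ is even. For $\bar v=\{v_1,\dots,v_n\}$ and $j,k\in\{1,2\}$ put $$\mathbb T_{j3}(\bar v)=\frac{T_{j3}(v_1)\cdots T_{j3}(v_n)}{\prod_{n\ge\ell>m\ge1}h(v_\ell,v_m)},\qquad \mathbb T_{3k}(\bar v)=\frac{T_{3k}(v_1)\cdots T_{3k}(v_n)}{\prod_{n\ge\ell>m\ge1}h(v_m,v_\ell)} .$$ For $\#\bar x=\#\bar y=n$ the domain wall partition function is $$K(\bar x|\bar y)=\prod_{j<k}g(x_j,x_k)\prod_{j>k}g(y_j,y_k)\;h(\bar x,\bar y)\;\det_n\left(\frac{g(x_j,y_k)}{h(x_j,y_k)}\right),\qquad K(\emptyset|\emptyset)=1 .$$ All sums below run over all partitions $\bar u\Rightarrow\{\bar u_\alpha,\bar u_{\bar\alpha}\}$ and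 $\bar v\Rightarrow\{\bar v_\alpha,\bar v_{\bar\alpha}\}$ with $\#\bar u_\alpha=\#\bar v_\alpha$ (subsets keep the natural order). **Bethe vectors.** For $\bar u=\{u_1,\dots,u_a\}$, $\bar v=\{v_1,\dots,v_b\}$ in $D$ let $$X_{a,b}(\bar u,\bar v)=\sum g(\bar v_\alpha,\bar u_\alpha)f(\bar u_\alpha,\bar u_{\bar\alpha})g(\bar v_{\bar\alpha},\bar v_\alpha)h(\bar u_\alpha,\bar u_\alpha)\,\mathbb T_{13}(\bar u_\alpha)T_{12}(\bar u_{\bar\alpha})\mathbb T_{23}(\bar v_{\bar\alpha})T_{22}(\bar v_\alpha).$$ The Bethe vector is $\Phi_{a,b}(\bar u,\bar v)=X_{a,b}(\bar u,\bar v)\Omega$. Let $\psi$ be the linear map of the algebra generated by the $T_{ij}(u)$ with the above relations that is determined by $\psi(1)=1$, $\psi(T_{ij}(u))=(-1)^{[i][j]+[i]}T_{ji}(u)$ and $\psi(xy)=(-1)^{[x][y]}\psi(y)\psi(x)$ for homogeneous $x,y$, where $T_{ij}$ has parity $[i]+[j]$. The dual Bethe vector is $\Phi^\dagger_{a,b}(\bar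 u,\bar v)=\Omega^\dagger\,\psi\bigl(X_{a,b}(\bar u,\bar v)\bigr)$. **Claim.** Let $a,b\ge0$ and suppose that $u_1,\dots,u_a,v_1,\dots,v_b$ are pairwise distinct, and that $h(u_j,u_k)\ne0$ and $h(v_j,v_k)\neq 0$ for $j\ne k$, and $h(v_j,u_k)\ne0$ for all $j,k$. Then $$\Phi_{a,b}(\bar u,\bar v)=\sum g(\bar v_\alpha,\bar u_\alpha)f(\bar u_{\bar\alpha},\bar u_\alpha)g(\bar v_{\bar\alpha},\bar v_\alpha)f(\bar v_\alpha,\bar u_{\bar\alpha})h(\bar u_\alpha,\bar u_\alpha)\lambda_2(\bar v_\alpha)\;T_{12}(\bar u_{\bar\alpha})\,\mathbb T_{13}(\bar u_\alpha)\,\mathbb T_{23}(\bar v_{\bar\alpha})\,\Omega,$$ $$\Phi_{a,b}(\bar u,\bar v)=\sum K(\bar v_\alpha|\bar u_\alpha)f(\bar u_\alpha,\bar u_{\bar\alpha})g(\bar v_\alpha,\bar v_{\bar\alpha})f(\bar v_{\bar\alpha},\bar u_\alpha)\lambda_2(\bar u_\alpha)\;\mathbb T_{23}(\bar v_{\bar\alpha})\,\mathbb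 T_{13}(\bar v_\alpha)\,T_{12}(\bar u_{\bar\alpha})\,\Omega,$$ and, for the dual Bethe vectors, $$\Phi^\dagger_{a,b}(\bar u,\bar v)=(-1)^{b(b-1)/2}\sum g(\bar v_\alpha,\bar u_\alpha)f(\bar u_{\bar\alpha},\bar u_\alpha)g(\bar v_{\bar\alpha},\bar v_\alpha)f(\bar v_\alpha,\bar u_{\bar\alpha})h(\bar u_\alpha,\bar u_\alpha)\lambda_2(\bar v_\alpha)\;\Omega^\dagger\,\mathbb T_{32}(\bar v_{\bar\alpha})\,\mathbb T_{31}(\bar u_\alpha)\,T_{21}(\bar u_{\bar\alpha}),$$ $$\Phi^\dagger_{a,b}(\bar u,\bar v)=(-1)^{b(b-1)/2}\sum K(\bar v_\alpha|\bar u_\alpha)f(\bar u_\alpha,\bar u_{\bar\alpha})g(\bar v_\alpha,\bar v_{\bar\alpha})f(\bar v_{\bar\alpha},\bar u_\alpha)\lambda_2(\bar u_\alpha)\;\Omega^\dagger\,T_{21}(\bar u_{\bar\alpha})\,\mathbb T_{31}(\bar v_\alpha)\,\mathbb T_{32}(\bar v_{\bar\alpha}).$$ -/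

import Mathlib

namespace GL21

noncomputable section

/-! ### Scalar functions -/

/-- The rational function `g(x,y) = c / (x - y)`. -/
def g (c x y : ℂ) : ℂ := c / (x - y)

/-- The rational function `f(x,y) = (x - y + c) / (x - y)`. -/
def f (c x y : ℂ) : ℂ := (x - y + c) / (x - y)

/-- The rational function `h(x,y) = (x - y + c) / c`. -/
def h (c x y : ℂ) : ℂ := (x - y + c) / c

/-- The domain wall partition function `K(x|y)` of two sets of `n` variables, by its determinant
representation; for `n = 0` all products and the determinant are `1`. -/
def K (c : ℂ) {n : ℕ} (x y : Fin n → ℂ) : ℂ :=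
  (∏ j, ∏ k ∈ Finset.Ioi j, g c (x j) (x k)) * (∏ j, ∏ k ∈ Finset.Iio j, g c (y j) (y k)) *
    (∏ j, ∏ k, h c (x j) (y k)) *
    Matrix.det (Matrix.of fun j k : Fin n => g c (x j) (y k) / h c (x j) (y k))

/-! ### Monodromy matrices -/

/-- The parity of the basis vectors of `ℂ^{2|1}`: the indices `0, 1, 2` of `Fin 3` stand for
`1, 2, 3`, and only the last one is odd. -/
def par : Fin 3 → ℕ := ![0, 0, 1]

variable {D : Set ℂ} {A : Type*} [Ring A] [Algebra ℂ A]

/-- `T i j u` are the entries of a monodromy matrix with `gl(2|1)` symmetry, defined for the values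
of the spectral parameter in `D`: the graded commutator of `T_{ij}(u)` and `T_{kl}(v)` equals
`(-1)^{[i]([k]+[l])+[k][l]} g(u,v) (T_{kj}(v) T_{il}(u) - T_{kj}(u) T_{il}(v))`. -/
def IsMonodromy (c : ℂ) (T : Fin 3 → Fin 3 → D → A) : Prop :=
  ∀ (i j k l : Fin 3) (u v : D), u ≠ v →
    T i j u * T k l v - (-1 : ℂ) ^ ((par i + par j) * (par k + par l)) • (T k l v * T i j u) =
      ((-1 : ℂ) ^ (par i * (par k + par l) + par k * par l) * g c u v) •
        (T k j v * T i l u - T k j u * T i l v)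

/-- Product of the `t (x k)`, `k ∈ S`, in the natural order. -/
def opProd {n : ℕ} (t : D → A) (x : Fin n → D) (S : Finset (Fin n)) : A :=
  ((S.sort (· ≤ ·)).map fun k => t (x k)).prod

/-- Symmetrised product of the odd operators `T_{j3}` over the variables `x k`, `k ∈ S`. -/
def opProdCol (c : ℂ) {n : ℕ} (t : D → A) (x : Fin n → D) (S : Finset (Fin n)) : A :=
  (∏ l ∈ S, ∏ m ∈ S with m < l, h c (x l) (x m))⁻¹ • opProd t x S

/-- Symmetrised product of the odd operators `T_{3k}` over the variables `x k`, `k ∈ S`. -/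
def opProdRow (c : ℂ) {n : ℕ} (t : D → A) (x : Fin n → D) (S : Finset (Fin n)) : A :=
  (∏ l ∈ S, ∏ m ∈ S with m < l, h c (x m) (x l))⁻¹ • opProd t x S

/-- Product of a two-variable function over two subsets of variables. -/
def fprod {m n : ℕ} (φ : ℂ → ℂ → ℂ) (x : Fin m → D) (S : Finset (Fin m)) (y : Fin n → D)
    (R : Finset (Fin n)) : ℂ :=
  ∏ j ∈ S, ∏ k ∈ R, φ (x j) (y k)

/-- The pairs of partitions `ū ⇒ {ū_α, ū_ᾱ}`, `v̄ ⇒ {v̄_α, v̄_ᾱ}` with `#ū_α = #v̄_α`, given by the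
index sets of `ū_α` and `v̄_α`. The complementary subsets have the complementary index sets. -/
abbrev Part (a b : ℕ) : Type :=
  {p : Finset (Fin a) × Finset (Fin b) // p.2.card = p.1.card}

/-- Index set of `ū_α`. -/
abbrev Part.U {a b : ℕ} (p : Part a b) : Finset (Fin a) := p.1.1

/-- Index set of `v̄_α`. -/
abbrev Part.V {a b : ℕ} (p : Part a b) : Finset (Fin b) := p.1.2

/-- `K(v̄_α | ū_α)`. -/
def Kpart (c : ℂ) {a b : ℕ} (u : Fin a → D) (v : Fin b → D) (p : Part a b) : ℂ :=
  K c (fun j => (v (p.V.orderEmbOfFin p.2 j) : ℂ)) (fun j => (u (p.U.orderEmbOfFin rfl j) : ℂ))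

/-- The operator
`X_{a,b}(ū,v̄) = ∑ g(v̄_α,ū_α) f(ū_α,ū_ᾱ) g(v̄_ᾱ,v̄_α) h(ū_α,ū_α) 𝕋₁₃(ū_α) T₁₂(ū_ᾱ) 𝕋₂₃(v̄_ᾱ) T₂₂(v̄_α)`. -/
def X (c : ℂ) (T : Fin 3 → Fin 3 → D → A) {a b : ℕ} (u : Fin a → D) (v : Fin b → D) : A :=
  ∑ p : Part a b,
    (fprod (g c) v p.V u p.U * fprod (f c) u p.U u p.Uᶜ * fprod (g c) v p.Vᶜ v p.V *
        fprod (h c) u p.U u p.U) •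
      (opProdCol c (T 0 2) u p.U * opProd (T 0 1) u p.Uᶜ * opProdCol c (T 1 2) v p.Vᶜ *
        opProd (T 1 1) v p.V)

/-! ### The algebra of monodromy matrix entries and its antimorphism -/

/-- The defining relations of the algebra generated by the `T_{ij}(u)`, `u ∈ D`. -/
inductive RTTRel (c : ℂ) (D : Set ℂ) :
    FreeAlgebra ℂ (Fin 3 × Fin 3 × D) → FreeAlgebra ℂ (Fin 3 × Fin 3 × D) → Prop
  | comm (i j k l : Fin 3) (u v : D) (huv : u ≠ v) : RTTRel c D
      (FreeAlgebra.ι ℂ (i, j, u) * FreeAlgebra.ι ℂ (k, l, v) -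
        (-1 : ℂ) ^ ((par i + par j) * (par k + par l)) •
          (FreeAlgebra.ι ℂ (k, l, v) * FreeAlgebra.ι ℂ (i, j, u)))
      (((-1 : ℂ) ^ (par i * (par k + par l) + par k * par l) * g c u v) •
        (FreeAlgebra.ι ℂ (k, j, v) * FreeAlgebra.ι ℂ (i, l, u) -
          FreeAlgebra.ι ℂ (k, j, u) * FreeAlgebra.ι ℂ (i, l, v)))

/-- The algebra generated by the `T_{ij}(u)`, `u ∈ D`, subject to the commutation relations of
`IsMonodromy`. -/
abbrev RTTAlgebra (c : ℂ) (D : Set ℂ) : Type := RingQuot (RTTRel c D)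

/-- The generators `T_{ij}(u)` of the algebra. -/
def gen (c : ℂ) (D : Set ℂ) (i j : Fin 3) (u : D) : RTTAlgebra c D :=
  RingQuot.mkAlgHom ℂ (RTTRel c D) (FreeAlgebra.ι ℂ (i, j, u))

theorem isMonodromy_gen (c : ℂ) (D : Set ℂ) : IsMonodromy c (gen c D) := by
  intro i j k l u v huv
  have := RingQuot.mkAlgHom_rel ℂ (RTTRel.comm (c := c) i j k l u v huv)
  simp only [map_sub, map_mul, map_smul] at this
  exact this

/-- The representation of the algebra defined by a monodromy matrix. -/
def lift (c : ℂ) (T : Fin 3 → Fin 3 → D → A) (hT : IsMonodromy c T) : RTTAlgebra c D →ₐ[ℂ] A :=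
  RingQuot.liftAlgHom ℂ ⟨FreeAlgebra.lift ℂ fun x => T x.1 x.2.1 x.2.2, by
    rintro _ _ ⟨i, j, k, l, u, v, huv⟩
    simpa only [map_sub, map_mul, map_smul, FreeAlgebra.lift_ι_apply] using hT i j k l u v huv⟩

@[simp] theorem lift_gen (c : ℂ) (T : Fin 3 → Fin 3 → D → A) (hT : IsMonodromy c T)
    (i j : Fin 3) (u : D) : lift c T hT (gen c D i j u) = T i j u := by
  simp [lift, gen]

theorem g_swap (c x y : ℂ) : g c x y = -g c y x := by
  rw [g, g, ← neg_sub y x, div_neg]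

/-- The second form of the commutation relations. -/
theorem IsMonodromy.swap {c : ℂ} {T : Fin 3 → Fin 3 → D → A} (hT : IsMonodromy c T)
    (i j k l : Fin 3) (u v : D) (huv : u ≠ v) :
    T i j u * T k l v - (-1 : ℂ) ^ ((par i + par j) * (par k + par l)) • (T k l v * T i j u) =
      ((-1 : ℂ) ^ (par l * (par i + par j) + par i * par j) * g c u v) •
        (T i l u * T k j v - T i l v * T k j u) := by
  have H := congrArg (fun z => -(-1 : ℂ) ^ ((par i + par j) * (par k + par l)) • z)
    (hT k l i j v u huv.symm)
  have e1 : (-1 : ℂ) ^ ((par i + par j) * (par k + par l)) *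
      (-1 : ℂ) ^ ((par k + par l) * (par i + par j)) = 1 := by
    rw [mul_comm (par k + par l), ← mul_pow]; norm_num
  have e2 : (-1 : ℂ) ^ ((par i + par j) * (par k + par l)) *
      (-1 : ℂ) ^ (par k * (par i + par j) + par i * par j) =
      (-1 : ℂ) ^ (par l * (par i + par j) + par i * par j) := by
    rw [← pow_add, show (par i + par j) * (par k + par l) +
      (par k * (par i + par j) + par i * par j) =
      2 * (par k * (par i + par j)) + (par l * (par i + par j) + par i * par j) by ring, pow_add,
      pow_mul]
    norm_num
  simp only [smul_sub, smul_smul, neg_mul, e1, ← mul_assoc, e2, neg_smul, one_smul] at H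
  rw [g_swap c v u] at H
  simp only [mul_neg, neg_smul, neg_neg] at H
  rw [smul_sub, ← H]
  abel

/-- The parity automorphism `T_{ij}(u) ↦ (-1)^{[i]+[j]} T_{ij}(u)`: it is `1` on the even part of
the algebra and `-1` on its odd part. -/
def parityAut (c : ℂ) (D : Set ℂ) : RTTAlgebra c D →ₐ[ℂ] RTTAlgebra c D :=
  lift c (fun i j u => (-1 : ℂ) ^ (par i + par j) • gen c D i j u) (by
    intro i j k l u v huv
    have H := congrArg (fun z => (-1 : ℂ) ^ (par i + par j + (par k + par l)) • z)
      (isMonodromy_gen c D i j k l u v huv)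
    simp only [smul_sub, smul_smul, smul_mul_smul_comm, ← pow_add] at H ⊢
    convert H using 3 <;> ring)

/-- The factors of the ordinary antimorphism behind `psi`. -/
def kap (i j : Fin 3) : ℂ :=
  Complex.I ^ ((par i + par j) ^ 2) * (-1) ^ (par i * par j + par i)

/-- The ordinary antimorphism `T_{ij}(u) ↦ ε (-1)^{[i][j]+[i]} T_{ji}(u)`, where `ε` is `1` or the
imaginary unit when `T_{ij}` is even or odd. -/
def antiHom (c : ℂ) (D : Set ℂ) : RTTAlgebra c D →ₐ[ℂ] (RTTAlgebra c D)ᵐᵒᵖ :=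
  lift c (fun i j u => MulOpposite.op (kap i j • gen c D j i u)) (by
    intro i j k l u v huv
    apply MulOpposite.unop_injective
    have H := congrArg (fun z => (kap i j * kap k l) • z)
      ((isMonodromy_gen c D).swap l k j i v u huv.symm)
    have e : kap i j * kap k l * (-1 : ℂ) ^ (par i * (par l + par k) + par l * par k) =
        (-1 : ℂ) ^ (par i * (par k + par l) + par k * par l) * (kap k j * kap i l) := by
      simp only [kap]
      fin_cases i <;> fin_cases j <;> fin_cases k <;> fin_cases l <;> norm_num [par]
    have e2 : (par l + par k) * (par j + par i) = (par i + par j) * (par k + par l) := by ring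
    rw [e2] at H
    simp only [smul_sub, smul_smul, smul_mul_smul_comm, MulOpposite.unop_sub,
      MulOpposite.unop_smul, MulOpposite.unop_mul, MulOpposite.unop_op] at H ⊢
    rw [← mul_assoc (kap i j * kap k l), e, g_swap c v u] at H
    convert H using 1
    · rw [mul_comm (kap k l), mul_comm ((-1 : ℂ) ^ _)]
    · rw [mul_comm (kap i l)]
      simp only [mul_neg, neg_smul]
      rw [mul_right_comm, sub_neg_eq_add, neg_add_eq_sub])

/-- The antimorphism `ψ` of the algebra. It is characterised by `psi_gen`, `psi_one` and
`psi_mul`. -/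
def psi (c : ℂ) (D : Set ℂ) : RTTAlgebra c D →ₗ[ℂ] RTTAlgebra c D :=
  (MulOpposite.opLinearEquiv ℂ).symm.toLinearMap ∘ₗ (antiHom c D).toLinearMap ∘ₗ
    ((1 / 2 : ℂ) • (LinearMap.id + (parityAut c D).toLinearMap) -
      (Complex.I / 2) • (LinearMap.id - (parityAut c D).toLinearMap))

theorem psi_of_parity (c : ℂ) (D : Set ℂ) {p : ℕ} (hp : p < 2) {x : RTTAlgebra c D}
    (hx : parityAut c D x = (-1 : ℂ) ^ p • x) :
    psi c D x = (-Complex.I) ^ p • (antiHom c D x).unop := by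
  have h0 : psi c D x = (antiHom c D ((1 / 2 : ℂ) • (x + parityAut c D x) -
      (Complex.I / 2) • (x - parityAut c D x))).unop := rfl
  rw [h0, hx]
  interval_cases p
  · rw [pow_zero, pow_zero, one_smul, one_smul, sub_self, smul_zero, sub_zero, ← two_smul ℂ x,
      smul_smul]
    norm_num
  · rw [pow_one, pow_one, neg_one_smul ℂ x, add_neg_cancel, smul_zero, zero_sub, sub_neg_eq_add,
      ← two_smul ℂ x, smul_smul, ← neg_smul, map_smul, MulOpposite.unop_smul]
    congr 1
    ring

theorem parityAut_gen (c : ℂ) (D : Set ℂ) (i j : Fin 3) (u : D) :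
    parityAut c D (gen c D i j u) = (-1 : ℂ) ^ (par i + par j) • gen c D i j u :=
  lift_gen c _ _ i j u

/-- `ψ(T_{ij}(u)) = (-1)^{[i][j]+[i]} T_{ji}(u)`. -/
theorem psi_gen (c : ℂ) (D : Set ℂ) (i j : Fin 3) (u : D) :
    psi c D (gen c D i j u) = (-1 : ℂ) ^ (par i * par j + par i) • gen c D j i u := by
  have hx : parityAut c D (gen c D i j u) =
      (-1 : ℂ) ^ ((par i + par j) % 2) • gen c D i j u := by
    rw [parityAut_gen, neg_one_pow_eq_pow_mod_two]
  rw [psi_of_parity c D (Nat.mod_lt _ two_pos) hx, show antiHom c D (gen c D i j u) =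
      MulOpposite.op (kap i j • gen c D j i u) from lift_gen c _ _ i j u, MulOpposite.unop_op,
    smul_smul]
  congr 1
  fin_cases i <;> fin_cases j <;> simp [par, kap]

theorem psi_one (c : ℂ) (D : Set ℂ) : psi c D 1 = 1 := by
  rw [psi_of_parity c D (p := 0) two_pos (by simp)]
  simp

/-- `ψ(x y) = (-1)^{[x][y]} ψ(y) ψ(x)` for `x`, `y` of parities `p`, `q`. -/
theorem psi_mul (c : ℂ) (D : Set ℂ) {p q : ℕ} (hp : p < 2) (hq : q < 2) {x y : RTTAlgebra c D}
    (hx : parityAut c D x = (-1 : ℂ) ^ p • x) (hy : parityAut c D y = (-1 : ℂ) ^ q • y) :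
    psi c D (x * y) = (-1 : ℂ) ^ (p * q) • (psi c D y * psi c D x) := by
  have hxy : parityAut c D (x * y) = (-1 : ℂ) ^ ((p + q) % 2) • (x * y) := by
    rw [map_mul, hx, hy, smul_mul_smul_comm, ← pow_add, neg_one_pow_eq_pow_mod_two]
  rw [psi_of_parity c D (Nat.mod_lt _ two_pos) hxy, psi_of_parity c D hp hx,
    psi_of_parity c D hq hy, map_mul, MulOpposite.unop_mul, smul_mul_smul_comm, smul_smul]
  congr 1
  interval_cases p <;> interval_cases q <;> simp

/-! ### Pseudovacuum and Bethe vectors -/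

variable {H : Type*} [AddCommGroup H] [Module ℂ H]

/-- `Ω` is a pseudovacuum with vacuum eigenvalues `lam i`. -/
structure IsVacuum (T : Fin 3 → Fin 3 → D → Module.End ℂ H) (lam : Fin 3 → D → ℂ) (Ω : H) :
    Prop where
  diag : ∀ i u, T i i u Ω = lam i u • Ω
  lower : ∀ i j u, j < i → T i j u Ω = 0

/-- `Ω'` is a dual pseudovacuum with vacuum eigenvalues `lam i`; operators act on the dual space
from the right, by composition. -/
structure IsDualVacuum (T : Fin 3 → Fin 3 → D → Module.End ℂ H) (lam : Fin 3 → D → ℂ)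
    (Ω' : Module.Dual ℂ H) : Prop where
  diag : ∀ i u, Ω' ∘ₗ T i i u = lam i u • Ω'
  upper : ∀ i j u, i < j → Ω' ∘ₗ T i j u = 0

/-- The Bethe vector `Φ_{a,b}(ū,v̄) = X_{a,b}(ū,v̄) Ω`. -/
def bethe (c : ℂ) (T : Fin 3 → Fin 3 → D → Module.End ℂ H) (Ω : H) {a b : ℕ} (u : Fin a → D)
    (v : Fin b → D) : H :=
  X c T u v Ω

/-- The dual Bethe vector `Φ†_{a,b}(ū,v̄) = ψ(X_{a,b}(ū,v̄) Ω) = Ω† ψ(X_{a,b}(ū,v̄))`. -/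
def dualBethe (c : ℂ) (T : Fin 3 → Fin 3 → D → Module.End ℂ H) (hT : IsMonodromy c T)
    (Ω' : Module.Dual ℂ H) {a b : ℕ} (u : Fin a → D) (v : Fin b → D) : Module.Dual ℂ H :=
  Ω' ∘ₗ lift c T hT (psi c D (X c (gen c D) u v))

end

end GL21

/-!
The exchange relations make `T₁₂(ū)`, `T₂₂(v̄)` and the normalised products `𝕋ⱼ₃` symmetric in their
variables, so that `X` depends only on the finite sets `U` and `V` of its variables. It is
determined by its value `𝕋₂₃(V)` at `U = ∅` and by a recursion which adds a variable `u` to `U`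
by multiplying with `T₁₂(u)` or `T₁₃(u)` on the left. For a fixed `v̄_α`, the factor of `X` with
entries from the first row satisfies such a recursion by itself, and so does its expansion with
`T₁₂` to the left of `𝕋₁₃`; the comparison of coefficients is a Lagrange interpolation in the
variables. This is the first formula.

The expansion with `T₂₃` leftmost instead satisfies a mirror recursion, in which the new variable
enters on the right: `T₁₂(u)` stands on the right, and `T₁₃(v)`, with `v ∈ V`, on the left; the
recursion for `K` comes from a column operation in its determinant. Adding one variable on the left
commutes with adding another one on the right, whence `X` satisfies the mirror recursion as well, by
induction on `U`. This is the second formula.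

Transposed operators, rescaled by the factors `kap`, form a monodromy matrix on the dual space with
pseudovacuum `Ω†`. As `ψ` is, up to a power of `-i` given by the parity, the antimorphism behind
this transposition, dual Bethe vectors are multiples of Bethe vectors of the transposed monodromy
matrix. The powers of `i` combine to the sign `(-1)^{b(b-1)/2}`.
-/

namespace GL21

noncomputable section

section ScalarFunctions

variable {c x y z : ℂ}

theorem f_eq_one_add_g (c : ℂ) (hxy : x ≠ y) : f c x y = 1 + g c x y := by
  have := sub_ne_zero.2 hxy
  rw [f, g]
  field_simp

theorem f_eq_one_sub_g (c : ℂ) (hxy : x ≠ y) : f c x y = 1 - g c y x := by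
  rw [f_eq_one_add_g c hxy, g_swap, sub_eq_add_neg]

theorem f_eq_g_mul_h (hc : c ≠ 0) (x y : ℂ) : f c x y = g c x y * h c x y := by
  rw [f, g, h]
  field_simp

theorem g_ne_zero (hc : c ≠ 0) (hxy : x ≠ y) : g c x y ≠ 0 :=
  div_ne_zero hc (sub_ne_zero.2 hxy)

theorem h_self (hc : c ≠ 0) (x : ℂ) : h c x x = 1 := by
  rw [h, sub_self, zero_add, div_self hc]

theorem g_mul_g (c : ℂ) (hxy : x ≠ y) (hxz : x ≠ z) (hyz : y ≠ z) :
    g c x z * g c y z = g c x z * g c y x + g c y z * g c x y := by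
  have hxy' := sub_ne_zero.2 hxy
  have hyx' := sub_ne_zero.2 hxy.symm
  have hxz' := sub_ne_zero.2 hxz
  have hyz' := sub_ne_zero.2 hyz
  simp only [g]
  field_simp
  ring

end ScalarFunctions

variable {D : Set ℂ} {A : Type*} [Ring A] [Algebra ℂ A]

theorem coe_ne_coe {x y : D} (hxy : x ≠ y) : (x : ℂ) ≠ y := Subtype.coe_ne_coe.2 hxy

namespace IsMonodromy

variable {c : ℂ} {T : Fin 3 → Fin 3 → D → A} {i j k l : Fin 3} {x y : D}

theorem row_exchange (hT : IsMonodromy c T) (hi : par i = 0) (hxy : x ≠ y) :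
    T i j x * T i l y = (-1 : ℂ) ^ (par j * par l) •
      (f c y x • (T i l y * T i j x) + g c x y • (T i l x * T i j y)) := by
  have hswap := hT.swap i j i l x y hxy
  simp only [hi, zero_add, zero_mul, add_zero, mul_comm (par l)] at hswap
  rw [f_eq_one_sub_g c (coe_ne_coe hxy.symm), sub_eq_iff_eq_add.1 hswap]
  module

theorem col_exchange_even (hT : IsMonodromy c T) (hi : par i = 0) (hk : par k = 0)
    (hl : par l = 0) (hxy : x ≠ y) :
    T i l x * T k l y = f c x y • (T k l y * T i l x) + g c y x • (T k l x * T i l y) := by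
  have hcomm := hT i l k l x y hxy
  simp only [hi, hk, hl, add_zero, mul_zero, pow_zero, one_mul, one_smul] at hcomm
  rw [f_eq_one_add_g c (coe_ne_coe hxy), g_swap c y x, sub_eq_iff_eq_add.1 hcomm]
  module

theorem col_exchange_odd (hT : IsMonodromy c T) (hi : par i = 0) (hk : par k = 0)
    (hl : par l = 1) (hxy : x ≠ y) :
    T i l x * T k l y =
      -(f c y x • (T k l y * T i l x) + g c x y • (T k l x * T i l y)) := by
  have hcomm := hT i l k l x y hxy
  simp only [hi, hk, hl, zero_add, mul_one, pow_zero, pow_one, one_mul] at hcomm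
  rw [f_eq_one_sub_g c (coe_ne_coe hxy.symm), sub_eq_iff_eq_add.1 hcomm]
  module

theorem even_mul (hT : IsMonodromy c T) (hi : par i = 0) (hj : par j = 0) (hxy : x ≠ y) :
    T i j x * T k l y =
      T k l y * T i j x + g c x y • (T i l x * T k j y - T i l y * T k j x) := by
  have hswap := hT.swap i j k l x y hxy
  simp only [hi, hj, add_zero, zero_mul, mul_zero, pow_zero, one_mul, one_smul] at hswap
  rw [sub_eq_iff_eq_add.1 hswap, add_comm]

theorem even_comm (hT : IsMonodromy c T) (hij : par i = par j) (x y : D) :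
    T i j x * T i j y = T i j y * T i j x := by
  rcases eq_or_ne x y with rfl | hxy
  · rfl
  have hcomm := hT i j i j x y hxy
  have hcomm' := hT i j i j y x hxy.symm
  have hsign : (-1 : ℂ) ^ ((par i + par j) * (par i + par j)) = 1 := by
    rw [hij, ← two_mul, mul_assoc, pow_mul, neg_one_sq, one_pow]
  rw [hsign, one_smul] at hcomm hcomm'
  rw [g_swap c y x] at hcomm'
  have htwo : (2 : ℂ) • (T i j x * T i j y - T i j y * T i j x) = 0 := by
    linear_combination (norm := module) hcomm - hcomm'
  exact sub_eq_zero.1 ((smul_eq_zero_iff_right two_ne_zero).1 htwo)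

theorem odd_exchange_f (hT : IsMonodromy c T) (hi : par i = 0) (hj : par j = 1) (hxy : x ≠ y) :
    f c x y • (T i j x * T i j y) = -(f c y x • (T i j y * T i j x)) := by
  have hcol := hT.col_exchange_odd hi hi hj hxy
  rw [f_eq_one_add_g c (coe_ne_coe hxy)]
  linear_combination (norm := module) hcol

theorem odd_exchange (hT : IsMonodromy c T) (hc : c ≠ 0) (hi : par i = 0) (hj : par j = 1)
    (hxy : x ≠ y) : h c x y • (T i j x * T i j y) = h c y x • (T i j y * T i j x) := by
  have hf := hT.odd_exchange_f hi hj hxy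
  rw [f_eq_g_mul_h hc, f_eq_g_mul_h hc, g_swap c y x, mul_smul, mul_smul, neg_smul, neg_neg] at hf
  exact smul_right_injective A (g_ne_zero hc (coe_ne_coe hxy)) hf

end IsMonodromy

section SymmetrisedProducts

/-- The normalising factor of an ordered product: the product of `φ y x` over all pairs of list
entries for which `x` stands before `y`. -/
def pairProd (φ : ℂ → ℂ → ℂ) : List D → ℂ
  | [] => 1
  | x :: l => (l.map fun y : D => φ y x).prod * pairProd φ l

/-- The ordered product of the `t x`, `x ∈ l`, divided by its normalising factor. -/
def listProd (φ : ℂ → ℂ → ℂ) (t : D → A) (l : List D) : A :=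
  (pairProd φ l)⁻¹ • (l.map t).prod

/-- The symmetrised product of the `t x` over a finite set, which is `𝕋_{j3}` for `φ = h` and an
ordinary product for `φ = 1`. The order of the factors is an arbitrary one; it is irrelevant for
families with `ExchangeSymm φ t`. -/
def symProd (φ : ℂ → ℂ → ℂ) (t : D → A) (S : Finset D) : A := listProd φ t S.toList

/-- The exchange symmetry which makes the products of the `t x`, normalised by `φ`, independent of
the order of the factors. -/
def ExchangeSymm (φ : ℂ → ℂ → ℂ) (t : D → A) : Prop :=
  ∀ x y : D, x ≠ y → φ x y • (t x * t y) = φ y x • (t y * t x)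

/-- `φ` does not vanish at pairs of distinct elements of `S`. -/
def NonvanishingOn (φ : ℂ → ℂ → ℂ) (S : Finset D) : Prop :=
  ∀ x ∈ S, ∀ y ∈ S, x ≠ y → φ x y ≠ 0

variable {φ : ℂ → ℂ → ℂ} {t : D → A} {S R : Finset D} {x : D}

theorem NonvanishingOn.mono (hS : NonvanishingOn φ S) (hR : R ⊆ S) : NonvanishingOn φ R :=
  fun x hx y hy => hS x (hR hx) y (hR hy)

theorem NonvanishingOn.prod_ne_zero (hx : x ∉ S) (hS : NonvanishingOn φ (insert x S)) :
    ∏ y ∈ S, φ y x ≠ 0 :=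
  Finset.prod_ne_zero_iff.2 fun y hy => hS y (Finset.mem_insert_of_mem hy) x
    (Finset.mem_insert_self _ _) (ne_of_mem_of_not_mem hy hx)

theorem nonvanishingOn_one (S : Finset D) : NonvanishingOn 1 S := fun _ _ _ _ _ => one_ne_zero

theorem listProd_cons (φ : ℂ → ℂ → ℂ) (t : D → A) (x : D) (l : List D) :
    listProd φ t (x :: l) = (l.map fun y : D => φ y x).prod⁻¹ • (t x * listProd φ t l) := by
  rw [listProd, listProd, pairProd, List.map_cons, List.prod_cons, mul_smul_comm, smul_smul,
    mul_inv]

theorem ExchangeSymm.listProd_swap (ht : ExchangeSymm φ t) {x y : D} (hxy : x ≠ y)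
    (hφxy : φ x y ≠ 0) (hφyx : φ y x ≠ 0) (l : List D) :
    listProd φ t (y :: x :: l) = listProd φ t (x :: y :: l) := by
  have hswap : t y * t x = (φ x y * (φ y x)⁻¹) • (t x * t y) := by
    rw [mul_comm, mul_smul, ht x y hxy, inv_smul_smul₀ hφyx]
  simp only [listProd_cons, List.map_cons, List.prod_cons, mul_smul_comm, ← mul_assoc, hswap,
    smul_mul_assoc, smul_smul]
  congr 1
  field_simp

theorem ExchangeSymm.listProd_eq_of_perm (ht : ExchangeSymm φ t) {l l' : List D}
    (hl : l.Perm l') (hnodup : l.Nodup) (hφ : ∀ x ∈ l, ∀ y ∈ l, x ≠ y → φ x y ≠ 0) :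
    listProd φ t l = listProd φ t l' := by
  induction hl with
  | nil => rfl
  | cons x hp ih =>
    rw [listProd_cons, listProd_cons, ih (List.nodup_cons.1 hnodup).2
      (fun y hy z hz => hφ y (List.mem_cons_of_mem _ hy) z (List.mem_cons_of_mem _ hz)),
      (hp.map _).prod_eq]
  | swap x y l =>
    have hxy : x ≠ y := fun e => by simp [e] at hnodup
    exact ht.listProd_swap hxy (hφ x (by simp) y (by simp) hxy)
      (hφ y (by simp) x (by simp) hxy.symm) l
  | trans h₁ _ ih₁ ih₂ =>
    rw [ih₁ hnodup hφ, ih₂ (h₁.nodup_iff.1 hnodup) fun x hx y hy =>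
      hφ x (h₁.mem_iff.2 hx) y (h₁.mem_iff.2 hy)]

theorem ExchangeSymm.symProd_eq_listProd (ht : ExchangeSymm φ t) {l : List D}
    (hl : S.toList.Perm l) (hφ : NonvanishingOn φ S) : symProd φ t S = listProd φ t l :=
  ht.listProd_eq_of_perm hl S.nodup_toList fun x hx y hy =>
    hφ x (Finset.mem_toList.1 hx) y (Finset.mem_toList.1 hy)

@[simp] theorem symProd_empty (φ : ℂ → ℂ → ℂ) (t : D → A) : symProd φ t ∅ = 1 := by
  simp [symProd, listProd, pairProd]

theorem ExchangeSymm.symProd_insert (ht : ExchangeSymm φ t) (hx : x ∉ S)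
    (hφ : NonvanishingOn φ (insert x S)) :
    symProd φ t (insert x S) = (∏ y ∈ S, φ y x)⁻¹ • (t x * symProd φ t S) := by
  rw [ht.symProd_eq_listProd (Finset.toList_insert hx) hφ, listProd_cons, symProd,
    Finset.prod_map_toList]

theorem ExchangeSymm.mul_symProd (ht : ExchangeSymm φ t) (hx : x ∉ S)
    (hφ : NonvanishingOn φ (insert x S)) :
    t x * symProd φ t S = (∏ y ∈ S, φ y x) • symProd φ t (insert x S) := by
  rw [ht.symProd_insert hx hφ, smul_inv_smul₀ (hφ.prod_ne_zero hx)]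

theorem IsMonodromy.exchangeSymm_even {c : ℂ} {T : Fin 3 → Fin 3 → D → A} (hT : IsMonodromy c T)
    {i j : Fin 3} (hij : par i = par j) : ExchangeSymm 1 (T i j) := fun x y _ => by
  rw [hT.even_comm hij x y, Pi.one_apply, Pi.one_apply, Pi.one_apply, Pi.one_apply]

theorem IsMonodromy.exchangeSymm_odd {c : ℂ} {T : Fin 3 → Fin 3 → D → A} (hT : IsMonodromy c T)
    (hc : c ≠ 0) {i j : Fin 3} (hi : par i = 0) (hj : par j = 1) :
    ExchangeSymm (h c) (T i j) :=
  fun _ _ hxy => hT.odd_exchange hc hi hj hxy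

theorem ExchangeSymm.commute (ht : ExchangeSymm 1 t) {x y : D} (hxy : x ≠ y) :
    t x * t y = t y * t x := by
  simpa only [Pi.one_apply, one_smul] using ht x y hxy

theorem ExchangeSymm.symProd_one_insert (ht : ExchangeSymm 1 t) (hx : x ∉ S) :
    symProd 1 t (insert x S) = t x * symProd 1 t S := by
  simp [ht.symProd_insert hx (nonvanishingOn_one _)]

theorem ExchangeSymm.symProd_one_insert_right (ht : ExchangeSymm 1 t) (hx : x ∉ S) :
    symProd 1 t (insert x S) = symProd 1 t S * t x := by
  rw [ht.symProd_one_insert hx]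
  induction S using Finset.induction_on with
  | empty => simp
  | insert w S hw ih =>
    rw [Finset.mem_insert, not_or] at hx
    rw [ht.symProd_one_insert hw, ← mul_assoc, ht.commute hx.1, mul_assoc, ih hx.2, mul_assoc]

theorem ExchangeSymm.op (ht : ExchangeSymm 1 t) :
    ExchangeSymm 1 fun x => MulOpposite.op (t x) := fun x y hxy => by
  simp only [Pi.one_apply, one_smul, ← MulOpposite.op_mul, ht.commute hxy]

theorem ExchangeSymm.symProd_one_op (ht : ExchangeSymm 1 t) (S : Finset D) :
    symProd 1 (fun x => MulOpposite.op (t x)) S = MulOpposite.op (symProd 1 t S) := by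
  induction S using Finset.induction_on with
  | empty => simp
  | insert w S hw ih =>
    rw [ht.op.symProd_one_insert hw, ih, ← MulOpposite.op_mul, ht.symProd_one_insert_right hw]

end SymmetrisedProducts

section Reordering

variable {D : Set ℂ} {A : Type*} [Ring A] [Algebra ℂ A]

/-- A splitting `f = φ ψ` compatible with moving an operator through products normalised by `φ`.
The two instances are `f = 1 · f` for even and `f = h · g` for odd operators. -/
structure IsSplittingOfF (c : ℂ) (φ ψ : ℂ → ℂ → ℂ) : Prop where
  f_eq : ∀ x y, x ≠ y → f c x y = φ x y * ψ x y
  three_term : ∀ x w s, x ≠ w → x ≠ s → w ≠ s →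
    ψ w x * φ x w * g c x s + g c x w * g c w s = φ s w * (g c x s * ψ w s)

theorem isSplittingOfF_one_f (c : ℂ) : IsSplittingOfF c 1 (f c) where
  f_eq x y _ := by rw [Pi.one_apply, Pi.one_apply, one_mul]
  three_term x w s hxw hxs hws := by
    rw [Pi.one_apply, Pi.one_apply, Pi.one_apply, Pi.one_apply, f_eq_one_add_g c hxw.symm,
      f_eq_one_add_g c hws]
    linear_combination -g_mul_g c hxw hxs hws

theorem isSplittingOfF_h_g {c : ℂ} (hc : c ≠ 0) : IsSplittingOfF c (h c) (g c) where
  f_eq x y _ := by rw [f_eq_g_mul_h hc, mul_comm]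
  three_term x w s hxw hxs hws := by
    have hxwf := f_eq_g_mul_h hc x w
    have hswf := f_eq_g_mul_h hc s w
    rw [f_eq_one_sub_g c hxw, g_swap c x w] at hxwf
    rw [f_eq_one_sub_g c hws.symm, g_swap c s w] at hswf
    rw [g_swap c x w]
    linear_combination g c x s * (hxwf - hswf) - g_mul_g c hxw hxs hws - g c w s * g_swap c x w

variable {c ε : ℂ} {φ ψ : ℂ → ℂ → ℂ} {a b : D → A} {S : Finset D} {w x : D}

/-- The unwanted terms which arise when `a x` is moved to the right of `symProd φ b S`: the
argument of `a` has been exchanged with the one of some factor `b s`. -/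
def exchangeSum (c : ℂ) (φ ψ : ℂ → ℂ → ℂ) (a b : D → A) (x : D) (S : Finset D) : A :=
  ∑ s ∈ S, (g c x s * ∏ y ∈ S.erase s, ψ y s) • (b x * symProd φ b (S.erase s) * a s)

theorem IsSplittingOfF.smul_exchangeSum_insert (hφψ : IsSplittingOfF c φ ψ)
    (hb : ExchangeSymm φ b) (hS : NonvanishingOn φ (insert w S)) (hw : w ∉ S) (hxw : x ≠ w)
    (hx : x ∉ S) :
    (∏ y ∈ S, φ y w) • exchangeSum c φ ψ a b x (insert w S) =
      f c w x • (b w * exchangeSum c φ ψ a b x S) +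
        g c x w • (b x * exchangeSum c φ ψ a b w S) +
        (g c x w * ∏ y ∈ S, f c y w) • (b x * symProd φ b S * a w) := by
  have hterm : ∀ s ∈ S, (∏ y ∈ S, φ y w) • ((g c x s * ∏ y ∈ (insert w S).erase s, ψ y s) •
        (b x * symProd φ b ((insert w S).erase s) * a s)) =
      f c w x • (b w * ((g c x s * ∏ y ∈ S.erase s, ψ y s) •
          (b x * symProd φ b (S.erase s) * a s))) +
        g c x w • (b x * ((g c w s * ∏ y ∈ S.erase s, ψ y s) •
          (b w * symProd φ b (S.erase s) * a s))) := fun s hs => by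
    have hws : w ≠ s := (ne_of_mem_of_not_mem hs hw).symm
    have hxs : x ≠ s := (ne_of_mem_of_not_mem hs hx).symm
    have hw' : w ∉ S.erase s := fun hmem => hw (Finset.mem_of_mem_erase hmem)
    have hSs : NonvanishingOn φ (insert w (S.erase s)) :=
      hS.mono (Finset.insert_subset_insert _ (Finset.erase_subset _ _))
    have hswap : f c w x • (b w * b x) = (ψ w x * φ x w) • (b x * b w) := by
      rw [hφψ.f_eq _ _ (coe_ne_coe hxw.symm), mul_comm (φ w x), mul_smul, mul_smul,
        hb w x hxw.symm]
    have hswap' := congrArg (fun z => z * symProd φ b (S.erase s) * a s) hswap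
    simp only [smul_mul_assoc, mul_assoc] at hswap'
    rw [Finset.erase_insert_of_ne hws, Finset.prod_insert hw', hb.symProd_insert hw' hSs,
      ← Finset.mul_prod_erase S _ hs]
    simp only [mul_smul_comm, smul_mul_assoc, mul_assoc]
    rw [smul_comm (f c w x), hswap']
    have hne := hSs.prod_ne_zero hw'
    match_scalars
    field_simp
    linear_combination -(∏ y ∈ S.erase s, ψ y s) *
      hφψ.three_term x w s (coe_ne_coe hxw) (coe_ne_coe hxs) (coe_ne_coe hws)
  have hprod : ∏ y ∈ S, f c y w = (∏ y ∈ S, φ y w) * ∏ y ∈ S, ψ y w := by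
    rw [← Finset.prod_mul_distrib]
    exact Finset.prod_congr rfl fun y hy =>
      hφψ.f_eq _ _ (coe_ne_coe (ne_of_mem_of_not_mem hy hw))
  simp only [exchangeSum]
  rw [Finset.sum_insert hw, Finset.erase_insert hw, smul_add, Finset.smul_sum,
    Finset.sum_congr rfl hterm, Finset.sum_add_distrib, Finset.mul_sum, Finset.mul_sum,
    Finset.smul_sum, Finset.smul_sum, hprod]
  module

theorem IsSplittingOfF.mul_symProd_eq (hφψ : IsSplittingOfF c φ ψ) (hb : ExchangeSymm φ b)
    (hab : ∀ x y : D, x ≠ y → a x * b y = ε • (f c y x • (b y * a x) + g c x y • (b x * a y)))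
    (hS : NonvanishingOn φ S) (hx : x ∉ S) :
    a x * symProd φ b S = ε ^ S.card •
      ((∏ y ∈ S, f c y x) • (symProd φ b S * a x) + exchangeSum c φ ψ a b x S) := by
  induction S using Finset.induction_on generalizing x with
  | empty => simp [exchangeSum]
  | insert w S hw ih =>
    rw [Finset.mem_insert, not_or] at hx
    have hS' : NonvanishingOn φ S := hS.mono (Finset.subset_insert _ _)
    have hne := hS.prod_ne_zero hw
    refine smul_right_injective A hne (?_ : _ • _ = _ • _)
    have hsum := hφψ.smul_exchangeSum_insert (a := a) hb hS hw hx.1 hx.2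
    rw [← mul_smul_comm, smul_comm _ (ε ^ _), smul_add, hsum,
      smul_comm _ (∏ y ∈ insert w S, f c y x), ← smul_mul_assoc, ← hb.mul_symProd hw hS,
      ← mul_assoc, hab x w hx.1,
      smul_mul_assoc, add_mul, smul_mul_assoc, smul_mul_assoc, mul_assoc (b w), mul_assoc (b x),
      ih hS' hx.2, ih hS' hw, Finset.card_insert_of_notMem hw, Finset.prod_insert hw]
    simp only [mul_add, mul_smul_comm, ← mul_assoc]
    module

theorem mul_symProd_one (hb : ExchangeSymm 1 b)
    (hab : ∀ x y : D, x ≠ y → a x * b y = f c y x • (b y * a x) + g c x y • (b x * a y))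
    (hx : x ∉ S) :
    a x * symProd 1 b S = (∏ y ∈ S, f c y x) • (symProd 1 b S * a x) +
      ∑ s ∈ S, (g c x s * ∏ y ∈ S.erase s, f c y s) •
        (b x * symProd 1 b (S.erase s) * a s) := by
  simpa only [one_pow, one_smul, exchangeSum] using
    (isSplittingOfF_one_f c).mul_symProd_eq (ε := 1) hb
      (fun x y hxy => by rw [one_smul, hab x y hxy]) (nonvanishingOn_one S) hx

theorem mul_symProd_h (hc : c ≠ 0) (hb : ExchangeSymm (h c) b)
    (hab : ∀ x y : D, x ≠ y → a x * b y = ε • (f c y x • (b y * a x) + g c x y • (b x * a y)))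
    (hS : NonvanishingOn (h c) S) (hx : x ∉ S) :
    a x * symProd (h c) b S = ε ^ S.card • ((∏ y ∈ S, f c y x) • (symProd (h c) b S * a x) +
      ∑ s ∈ S, (g c x s * ∏ y ∈ S.erase s, g c y s) •
        (b x * symProd (h c) b (S.erase s) * a s)) :=
  (isSplittingOfF_h_g hc).mul_symProd_eq hb hab hS hx

/-- This is `mul_symProd_one` in the opposite algebra. -/
theorem symProd_one_mul (ha : ExchangeSymm 1 a)
    (hab : ∀ x y : D, x ≠ y → a x * b y = f c x y • (b y * a x) + g c y x • (b x * a y))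
    (hx : x ∉ S) :
    symProd 1 a S * b x = (∏ y ∈ S, f c y x) • (b x * symProd 1 a S) +
      ∑ s ∈ S, (g c x s * ∏ y ∈ S.erase s, f c y s) •
        (b s * a x * symProd 1 a (S.erase s)) := by
  apply MulOpposite.op_injective
  have hop := mul_symProd_one (c := c) (S := S) (x := x) (a := fun y => MulOpposite.op (b y))
    ha.op (fun y z hyz => by
      simp only [← MulOpposite.op_mul, hab z y hyz.symm, MulOpposite.op_add, MulOpposite.op_smul])
    hx
  have hcomm : ∀ s ∈ S, symProd 1 a (S.erase s) * a x = a x * symProd 1 a (S.erase s) :=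
    fun s _ => by
      have hx' : x ∉ S.erase s := fun hmem => hx (Finset.mem_of_mem_erase hmem)
      rw [← ha.symProd_one_insert hx', ha.symProd_one_insert_right hx']
  simp only [ha.symProd_one_op, ← MulOpposite.op_mul, ← MulOpposite.op_smul] at hop
  rw [MulOpposite.op_add, Finset.op_sum, hop]
  congr 1
  exact Finset.sum_congr rfl fun s hs => by rw [hcomm s hs, mul_assoc]

end Reordering

section PartialFractions

open Polynomial

variable {ι : Type*} {D : Set ℂ} {c : ℂ}

/-- Lagrange interpolation in terms of the function `g`. -/
theorem eval_mul_prod_g [DecidableEq ι] (c : ℂ) {s : Finset ι} {x : ι → ℂ}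
    (hx : Set.InjOn x s) {P : ℂ[X]} (hP : P.natDegree < s.card) {t : ℂ} (ht : ∀ i ∈ s, x i ≠ t) :
    P.eval t * ∏ i ∈ s, g c (x i) t =
      ∑ i ∈ s, P.eval (x i) * g c (x i) t * ∏ j ∈ s.erase i, g c (x j) (x i) := by
  have hdeg : P.degree < s.card := lt_of_le_of_lt degree_le_natDegree (Nat.cast_lt.2 hP)
  conv_lhs => rw [Lagrange.eq_interpolate hx hdeg]
  rw [Lagrange.interpolate_apply, eval_finsetSum, Finset.sum_mul]
  refine Finset.sum_congr rfl fun i hi => ?_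
  have hbasis : ∏ j ∈ s.erase i, g c (x j) (x i) =
      (∏ j ∈ s.erase i, eval t (Lagrange.basisDivisor (x i) (x j))) *
        ∏ j ∈ s.erase i, g c (x j) t := by
    rw [← Finset.prod_mul_distrib]
    refine Finset.prod_congr rfl fun j hj => ?_
    obtain ⟨hji, hj⟩ := Finset.mem_erase.1 hj
    have hjt : x j - t ≠ 0 := sub_ne_zero.2 (ht j hj)
    have hxji : x j ≠ x i := fun hxx => hji (hx hj hi hxx)
    have hji' : x j - x i ≠ 0 := sub_ne_zero.2 hxji
    have hij' : x i - x j ≠ 0 := sub_ne_zero.2 hxji.symm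
    simp only [Lagrange.basisDivisor, g, eval_mul, eval_C, eval_sub, eval_X]
    field_simp
    ring
  rw [eval_mul, eval_C, ← Finset.mul_prod_erase s _ hi, Lagrange.basis, eval_prod, hbasis]
  ring

theorem natDegree_prod_le_card {R : Type*} [CommSemiring R] {s : Finset ι} {p : ι → R[X]}
    (hp : ∀ i ∈ s, (p i).natDegree ≤ 1) : (∏ i ∈ s, p i).natDegree ≤ s.card :=
  (natDegree_prod_le _ _).trans
    ((Finset.sum_le_card_nsmul _ _ 1 hp).trans_eq (by rw [smul_eq_mul, mul_one]))

/-- The polynomial `h(X, a)`. -/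
def hPolyFst (c a : ℂ) : ℂ[X] := C c⁻¹ * (Polynomial.X - C (a - c))

/-- The polynomial `h(a, X)`. -/
def hPolySnd (c a : ℂ) : ℂ[X] := C c⁻¹ * (C (a + c) - Polynomial.X)

theorem eval_hPolyFst (c a t : ℂ) : (hPolyFst c a).eval t = h c t a := by
  simp only [hPolyFst, h, eval_mul, eval_C, eval_sub, eval_X]
  ring

theorem eval_hPolySnd (c a t : ℂ) : (hPolySnd c a).eval t = h c a t := by
  simp only [hPolySnd, h, eval_mul, eval_C, eval_sub, eval_X]
  ring

theorem natDegree_hPolyFst_le (c a : ℂ) : (hPolyFst c a).natDegree ≤ 1 := by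
  unfold hPolyFst; compute_degree

theorem natDegree_hPolySnd_le (c a : ℂ) : (hPolySnd c a).natDegree ≤ 1 := by
  unfold hPolySnd; compute_degree

theorem f_eq_neg_h_mul_g (hc : c ≠ 0) (x y : ℂ) : f c x y = -h c x y * g c y x := by
  rw [f_eq_g_mul_h hc, g_swap]
  ring

theorem prod_neg_h_mul_prod_g (hc : c ≠ 0) (S : Finset D) (x : ℂ) :
    (∏ s ∈ S, -h c x s) * ∏ s ∈ S, g c s x = ∏ s ∈ S, f c x s := by
  simp only [f_eq_neg_h_mul_g hc, Finset.prod_mul_distrib]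

theorem prod_h_mul_prod_g (hc : c ≠ 0) (S : Finset D) (x : ℂ) :
    (∏ s ∈ S, h c s x) * ∏ s ∈ S, g c s x = ∏ s ∈ S, f c s x := by
  rw [mul_comm]
  simp only [f_eq_g_mul_h hc, Finset.prod_mul_distrib]

theorem prod_neg_h_mul_prod_g_erase (hc : c ≠ 0) {S : Finset D} {x : D} (hx : x ∈ S) :
    (∏ s ∈ S, -h c x s) * ∏ s ∈ S.erase x, g c s x = -∏ s ∈ S.erase x, f c x s := by
  rw [← Finset.mul_prod_erase S _ hx, h_self hc, mul_assoc, prod_neg_h_mul_prod_g hc, neg_one_mul]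

theorem prod_h_mul_prod_g_erase (hc : c ≠ 0) {S : Finset D} {x : D} (hx : x ∈ S) :
    (∏ s ∈ S, h c s x) * ∏ s ∈ S.erase x, g c s x = ∏ s ∈ S.erase x, f c s x := by
  rw [← Finset.mul_prod_erase S _ hx, h_self hc, one_mul, prod_h_mul_prod_g hc]

variable {U V W : Finset D} {t x : D}

theorem eval_mul_prod_g_mul_prod_f (hc : c ≠ 0) (hUV : Disjoint U V) (htU : t ∉ U) (htV : t ∉ V)
    {Q : ℂ[X]} (hQ : Q.natDegree < V.card) :
    Q.eval (t : ℂ) * (∏ j ∈ V, g c j t) * ∏ s ∈ U, f c t s =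
      (∑ s ∈ U, g c t s * (Q.eval (s : ℂ) * (∏ j ∈ V, g c j s) * ∏ s' ∈ U.erase s, f c s s')) +
      ∑ j ∈ V, g c j t * (Q.eval (j : ℂ) * (∏ i ∈ V.erase j, g c i j) * ∏ s ∈ U, f c j s) := by
  have hdeg : ((∏ s ∈ U, -hPolyFst c (s : ℂ)) * Q).natDegree < (U ∪ V).card := by
    have hU := natDegree_prod_le_card (s := U) (p := fun s : D => -hPolyFst c (s : ℂ))
      fun s _ => (natDegree_neg _).trans_le (natDegree_hPolyFst_le c s)
    rw [Finset.card_union_of_disjoint hUV]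
    exact natDegree_mul_le.trans_lt (by omega)
  have hinterp := eval_mul_prod_g c Subtype.val_injective.injOn hdeg (t := t) fun i hi hit =>
    (Finset.mem_union.1 hi).elim (fun hiU => htU (Subtype.ext hit ▸ hiU))
      fun hiV => htV (Subtype.ext hit ▸ hiV)
  simp only [eval_mul, eval_prod, eval_neg, eval_hPolyFst] at hinterp
  rw [Finset.prod_union hUV, Finset.sum_union hUV] at hinterp
  rw [← prod_neg_h_mul_prod_g hc U t, show ∀ p q r s : ℂ, p * q * (r * s) = r * p * (s * q) from
    fun p q r s => by ring, hinterp]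
  congr 1
  · refine Finset.sum_congr rfl fun s hs => ?_
    have hsV : s ∉ V := Finset.disjoint_left.1 hUV hs
    rw [Finset.erase_union_distrib, Finset.erase_eq_of_notMem hsV,
      Finset.prod_union (hUV.mono_left (Finset.erase_subset _ _)), g_swap c s t]
    linear_combination -Q.eval (s : ℂ) * g c t s * (∏ j ∈ V, g c j s) *
      prod_neg_h_mul_prod_g_erase hc hs
  · refine Finset.sum_congr rfl fun j hj => ?_
    have hjU : j ∉ U := Finset.disjoint_right.1 hUV hj
    rw [Finset.erase_union_distrib, Finset.erase_eq_of_notMem hjU,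
      Finset.prod_union (hUV.mono_right (Finset.erase_subset _ _))]
    linear_combination Q.eval (j : ℂ) * g c j t * (∏ i ∈ V.erase j, g c i j) *
      prod_neg_h_mul_prod_g hc U j

theorem prod_h_mul_prod_g_mul_prod_f (hc : c ≠ 0) (hUV : Disjoint U V) (htU : t ∉ U)
    (htV : t ∉ V) (hWV : W.card < V.card) :
    (∏ a ∈ W, h c t a) * (∏ j ∈ V, g c j t) * ∏ s ∈ U, f c t s =
      (∑ s ∈ U, g c t s * ((∏ a ∈ W, h c s a) * (∏ j ∈ V, g c j s) *
        ∏ s' ∈ U.erase s, f c s s')) +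
      ∑ j ∈ V, g c j t * ((∏ a ∈ W, h c j a) * (∏ i ∈ V.erase j, g c i j) *
        ∏ s ∈ U, f c j s) := by
  have hQ := (natDegree_prod_le_card (s := W) fun i _ => natDegree_hPolyFst_le c i).trans_lt hWV
  simpa only [eval_prod, eval_hPolyFst] using eval_mul_prod_g_mul_prod_f hc hUV htU htV hQ

theorem prod_h_mul_prod_g_eq_sum (hc : c ≠ 0) (htV : t ∉ V) (hWV : W.card < V.card) :
    (∏ a ∈ W, h c t a) * ∏ j ∈ V, g c j t =
      ∑ j ∈ V, g c j t * ((∏ a ∈ W, h c j a) * ∏ i ∈ V.erase j, g c i j) := by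
  simpa only [Finset.prod_empty, Finset.sum_empty, zero_add, mul_one] using
    prod_h_mul_prod_g_mul_prod_f hc (Finset.disjoint_empty_left V) (Finset.notMem_empty t) htV hWV

theorem g_mul_prod_f_mul_prod_f (hc : c ≠ 0) (hUV : Disjoint U V) (htU : t ∉ U) (htV : t ∉ V)
    (hxU : x ∉ U) (hxV : x ∉ V) (hxt : x ≠ t) :
    g c x t * (∏ s ∈ U, f c t s) * ∏ z ∈ V, f c z t =
      g c x t * ((∏ s ∈ U, f c x s) * ∏ z ∈ V, f c z x) +
      (∑ s ∈ U, g c t s * ((∏ s' ∈ U.erase s, f c s s') * (∏ z ∈ V, f c z s) * g c x s)) +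
      ∑ z ∈ V, g c z t * ((∏ s ∈ U, f c z s) * (∏ z' ∈ V.erase z, f c z' z) * g c x z) := by
  have hQ : (∏ z ∈ V, hPolySnd c (z : ℂ)).natDegree < (insert x V).card := by
    rw [Finset.card_insert_of_notMem hxV, Nat.lt_succ_iff]
    exact natDegree_prod_le_card fun i _ => natDegree_hPolySnd_le c i
  have hinterp := eval_mul_prod_g_mul_prod_f hc (Finset.disjoint_insert_right.2 ⟨hxU, hUV⟩) htU
    (by simp only [Finset.mem_insert, not_or]; exact ⟨hxt.symm, htV⟩) hQ
  simp only [eval_prod, eval_hPolySnd, Finset.prod_insert hxV, Finset.sum_insert hxV,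
    Finset.erase_insert hxV] at hinterp
  have hV : ∀ z ∈ V, g c z t * ((∏ z' ∈ V, h c z' z) * (∏ i ∈ (insert x V).erase z, g c i z) *
      ∏ s ∈ U, f c z s) =
      g c z t * ((∏ s ∈ U, f c z s) * (∏ z' ∈ V.erase z, f c z' z) * g c x z) := fun z hz => by
    have hx' : x ∉ V.erase z := fun hmem => hxV (Finset.mem_of_mem_erase hmem)
    rw [Finset.erase_insert_of_ne (ne_of_mem_of_not_mem hz hxV).symm, Finset.prod_insert hx',
      ← prod_h_mul_prod_g_erase hc hz]
    ring
  have hU : ∀ s ∈ U, g c t s * ((∏ z ∈ V, h c z s) * (g c x s * ∏ z ∈ V, g c z s) *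
      ∏ s' ∈ U.erase s, f c s s') =
      g c t s * ((∏ s' ∈ U.erase s, f c s s') * (∏ z ∈ V, f c z s) * g c x s) := fun s _ => by
    rw [← prod_h_mul_prod_g hc V s]
    ring
  rw [Finset.sum_congr rfl hU, Finset.sum_congr rfl hV] at hinterp
  rw [← prod_h_mul_prod_g hc V t, ← prod_h_mul_prod_g hc V x]
  linear_combination hinterp

theorem g_add_right (c x y : ℂ) : g c x (y + c) = (-h c y x)⁻¹ := by
  rw [g_swap, g, h, ← inv_div, add_sub_right_comm, inv_neg]

theorem prod_g_mul_prod_h_add (hc : c ≠ 0) (htV : t ∉ V) :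
    (∏ v ∈ V, g c v t) * ∏ v ∈ V, h c v (t + c) = 1 := by
  rw [← Finset.prod_mul_distrib]
  refine Finset.prod_eq_one fun v hv => ?_
  have hvt : (v : ℂ) - t ≠ 0 := sub_ne_zero.2 (coe_ne_coe (ne_of_mem_of_not_mem hv htV))
  rw [g, h]
  field_simp
  ring

theorem prod_neg_h_mul_prod_g_comm (c : ℂ) (S : Finset D) (x y : ℂ) :
    (∏ s ∈ S, -h c x s) * ∏ s ∈ S, g c s y = (∏ s ∈ S, g c y s) * ∏ s ∈ S, h c x s := by
  simp only [← Finset.prod_mul_distrib]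
  exact Finset.prod_congr rfl fun s _ => by rw [g_swap c s]; ring

/-- This is the Lagrange interpolation of `∏ h(v, X)` with nodes `U ∪ {t}`, evaluated at `t + c`,
where `h(v, t + c) = 1 / g(v, t)`. -/
theorem prod_f_mul_prod_f_eq (hc : c ≠ 0) (hVU : V.card ≤ U.card) (htU : t ∉ U) (htV : t ∉ V)
    (ht : ∀ s ∈ U, h c t s ≠ 0) :
    (∏ s ∈ U, f c t s) * ∏ v ∈ V, f c v t =
      1 - (∏ v ∈ V, g c v t) * ∑ s ∈ U, g c s t * ((∏ s' ∈ U.erase s, g c s s') *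
        (∏ v ∈ V, h c v s) * ∏ s' ∈ U.erase s, h c t s') := by
  have hQ : (∏ v ∈ V, hPolySnd c (v : ℂ)).natDegree < (insert t U).card := by
    rw [Finset.card_insert_of_notMem htU, Nat.lt_succ_iff]
    exact (natDegree_prod_le_card (s := V) (p := fun v : D => hPolySnd c (v : ℂ))
      fun v _ => natDegree_hPolySnd_le c (v : ℂ)).trans hVU
  have hinterp := eval_mul_prod_g c Subtype.val_injective.injOn hQ (t := t + c) fun i hi hit => by
    rcases Finset.mem_insert.1 hi with rfl | hi
    · exact hc (left_eq_add.1 hit)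
    · exact ht i hi (by rw [h, hit, sub_add_cancel_left, neg_add_cancel, zero_div])
  have hU : ∏ s ∈ U, -h c t s ≠ 0 := Finset.prod_ne_zero_iff.2 fun s hs => neg_ne_zero.2 (ht s hs)
  have hterm : ∀ s ∈ U, (∏ v ∈ V, h c v s) * (-h c t s)⁻¹ *
      ∏ s' ∈ (insert t U).erase s, g c s' s = (∏ s ∈ U, -h c t s)⁻¹ *
        -(g c s t * ((∏ s' ∈ U.erase s, g c s s') * (∏ v ∈ V, h c v s) *
          ∏ s' ∈ U.erase s, h c t s')) := fun s hs => by
    rw [eq_inv_mul_iff_mul_eq₀ hU, Finset.erase_insert_of_ne (ne_of_mem_of_not_mem hs htU).symm,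
      Finset.prod_insert fun hmem => htU (Finset.mem_of_mem_erase hmem),
      ← Finset.mul_prod_erase U _ hs, g_swap c s t]
    have hhs := ht s hs
    field_simp
    linear_combination (∏ v ∈ V, h c v s) * g c t s * prod_neg_h_mul_prod_g_comm c (U.erase s) t s
  simp only [eval_prod, eval_hPolySnd, Finset.prod_insert htU, Finset.sum_insert htU,
    Finset.erase_insert htU, g_add_right, h_self hc, inv_neg_one] at hinterp
  rw [Finset.sum_congr rfl hterm, ← Finset.mul_sum, Finset.sum_neg_distrib,
    Finset.prod_inv_distrib] at hinterp
  rw [← prod_neg_h_mul_prod_g hc U t, ← prod_h_mul_prod_g hc V t]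
  generalize ∑ s ∈ U, g c s t * _ = interpSum at hinterp ⊢
  field_simp at hinterp
  linear_combination (∏ v ∈ V, g c v t) * hinterp + prod_g_mul_prod_h_add hc htV

end PartialFractions

theorem sum_powerset_sdiff {ι M : Type*} [DecidableEq ι] [AddCommMonoid M] (U : Finset ι)
    (F : ι → Finset ι → M) : ∑ α ∈ U.powerset, ∑ s ∈ U \ α, F s α =
      ∑ α ∈ U.powerset, ∑ s ∈ α, F s (α.erase s) := by
  rw [Finset.sum_sigma', Finset.sum_sigma']
  refine Finset.sum_bij' (fun p _ => ⟨insert p.2 p.1, p.2⟩) (fun p _ => ⟨p.1.erase p.2, p.2⟩)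
    ?_ ?_ ?_ ?_ ?_ <;> rintro ⟨α, s⟩ hp <;>
    simp only [Finset.mem_sigma, Finset.mem_powerset, Finset.mem_sdiff] at hp ⊢
  · exact ⟨Finset.insert_subset hp.2.1 hp.1, Finset.mem_insert_self _ _⟩
  · exact ⟨(Finset.erase_subset _ _).trans hp.1, hp.1 hp.2, Finset.notMem_erase _ _⟩
  · rw [Finset.erase_insert hp.2.2]
  · rw [Finset.insert_erase hp.2]
  · rw [Finset.erase_insert hp.2.2]

theorem sum_powerset_sdiff_insert {ι M : Type*} [DecidableEq ι] [AddCommMonoid M] (U : Finset ι)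
    (F : ι → Finset ι → M) : ∑ α ∈ U.powerset, ∑ s ∈ U \ α, F s (insert s α) =
      ∑ α ∈ U.powerset, ∑ s ∈ α, F s α := by
  rw [sum_powerset_sdiff U fun s α => F s (insert s α)]
  exact Finset.sum_congr rfl fun α _ => Finset.sum_congr rfl fun s hs => by
    rw [Finset.insert_erase hs]

section DoubleProducts

variable {D : Set ℂ} {c : ℂ}

/-- Product of a two-variable function over two finite sets. -/
def dprod (φ : ℂ → ℂ → ℂ) (S R : Finset D) : ℂ := ∏ x ∈ S, ∏ y ∈ R, φ x y

@[simp] theorem dprod_empty_left (φ : ℂ → ℂ → ℂ) (R : Finset D) : dprod φ ∅ R = 1 :=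
  Finset.prod_empty

@[simp] theorem dprod_empty_right (φ : ℂ → ℂ → ℂ) (S : Finset D) : dprod φ S ∅ = 1 := by
  simp [dprod]

theorem dprod_insert_left (φ : ℂ → ℂ → ℂ) {x : D} {S : Finset D} (hx : x ∉ S) (R : Finset D) :
    dprod φ (insert x S) R = (∏ y ∈ R, φ x y) * dprod φ S R := by
  rw [dprod, Finset.prod_insert hx, dprod]

theorem dprod_insert_right (φ : ℂ → ℂ → ℂ) (S : Finset D) {y : D} {R : Finset D} (hy : y ∉ R) :
    dprod φ S (insert y R) = (∏ x ∈ S, φ x y) * dprod φ S R := by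
  simp only [dprod, Finset.prod_insert hy, Finset.prod_mul_distrib]

end DoubleProducts

section FirstRow

variable {D : Set ℂ} {A : Type*} [Ring A] [Algebra ℂ A]

/-- `g(β,α) f(α,U∖α) h(α,α)`: the weight of `𝕋₁₃(α) T₁₂(U∖α)`. -/
def weightT13T12 (c : ℂ) (U β α : Finset D) : ℂ :=
  dprod (g c) β α * dprod (f c) α (U \ α) * dprod (h c) α α

/-- `g(β,α) f(U∖α,α) f(β,U∖α) h(α,α)`: the weight of `T₁₂(U∖α) 𝕋₁₃(α)`. -/
def weightT12T13 (c : ℂ) (U β α : Finset D) : ℂ :=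
  dprod (g c) β α * dprod (f c) (U \ α) α * dprod (f c) β (U \ α) * dprod (h c) α α

/-- `weightT13T12`, restricted to the pairs of subsets with `#α = #β`. -/
def coeffT13T12 (c : ℂ) (U β α : Finset D) : ℂ :=
  if β.card = α.card then weightT13T12 c U β α else 0

/-- `weightT12T13`, restricted to the pairs of subsets with `#α = #β`. -/
def coeffT12T13 (c : ℂ) (U β α : Finset D) : ℂ :=
  if β.card = α.card then weightT12T13 c U β α else 0

/-- For a fixed `β = v̄_α`, the first-row part of `X`, with `T₁₃` to the left of `T₁₂`. -/
def rowT13T12 (c : ℂ) (T : Fin 3 → Fin 3 → D → A) (U β : Finset D) : A :=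
  ∑ α ∈ U.powerset, coeffT13T12 c U β α •
    (symProd (h c) (T 0 2) α * symProd 1 (T 0 1) (U \ α))

/-- The analogue of `rowT13T12` with `T₁₂` to the left of `T₁₃`. -/
def rowT12T13 (c : ℂ) (T : Fin 3 → Fin 3 → D → A) (U β : Finset D) : A :=
  ∑ α ∈ U.powerset, coeffT12T13 c U β α •
    (symProd 1 (T 0 1) (U \ α) * symProd (h c) (T 0 2) α)

/-- The coefficient with which `u` is exchanged for `j ∈ V` when `u` is added to `U`, in the
recursions for `rowT13T12` and `X`. -/
def recCoeff (c : ℂ) (u : D) (U V : Finset D) (j : D) : ℂ :=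
  g c j u * (∏ i ∈ V.erase j, g c i j) * ∏ s ∈ U, f c j s

variable {c : ℂ} {U β α : Finset D} {u s j : D}

theorem card_erase_eq_iff (hj : j ∈ β) : (β.erase j).card = α.card ↔ β.card = α.card + 1 := by
  have := Finset.card_pos.2 ⟨j, hj⟩
  rw [Finset.card_erase_of_mem hj]
  omega

theorem coeffT13T12_insert_of_subset (hu : u ∉ U) (hα : α ⊆ U) :
    coeffT13T12 c (insert u U) β α = (∏ s ∈ α, f c s u) * coeffT13T12 c U β α := by
  rw [coeffT13T12, coeffT13T12, mul_ite, mul_zero]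
  refine ite_congr rfl (fun _ => ?_) fun _ => rfl
  rw [weightT13T12, weightT13T12, Finset.insert_sdiff_of_notMem _ fun hmem => hu (hα hmem),
    dprod_insert_right _ _ fun hmem => hu (Finset.mem_sdiff.1 hmem).1]
  ring

theorem weightT13T12_insert_insert (hc : c ≠ 0) (hu : u ∉ U) (hα : α ⊆ U) :
    weightT13T12 c (insert u U) β (insert u α) = (weightT13T12 c U β α * ∏ y ∈ α, h c y u) *
      ((∏ a ∈ α, h c u a) * (∏ j ∈ β, g c j u) * ∏ s ∈ U \ α, f c u s) := by
  have huα : u ∉ α := fun hmem => hu (hα hmem)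
  rw [weightT13T12, weightT13T12, Finset.insert_sdiff_insert, Finset.sdiff_insert_of_notMem hu]
  simp only [dprod_insert_left _ huα, dprod_insert_right _ _ huα, Finset.prod_insert huα,
    h_self hc]
  ring

theorem weightT13T12_insert_mul_prod_g (hc : c ≠ 0) (hs : s ∈ U \ α) :
    weightT13T12 c U β (insert s α) * ∏ y ∈ α, g c y s = weightT13T12 c U β α *
      ((∏ a ∈ α, h c s a) * (∏ j ∈ β, g c j s) * ∏ s' ∈ (U \ α).erase s, f c s s') := by
  have hsα : s ∉ α := (Finset.mem_sdiff.1 hs).2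
  have hse : s ∉ (U \ α).erase s := Finset.notMem_erase _ _
  rw [weightT13T12, weightT13T12, Finset.sdiff_insert, ← Finset.insert_erase hs,
    Finset.erase_insert hse]
  simp only [dprod_insert_left _ hsα, dprod_insert_right _ _ hsα, Finset.prod_insert hsα,
    dprod_insert_right _ _ hse, h_self hc, f_eq_g_mul_h hc, Finset.prod_mul_distrib]
  ring

theorem recCoeff_mul_weightT13T12_erase (hc : c ≠ 0) (hα : α ⊆ U) (hj : j ∈ β) :
    recCoeff c u U β j * weightT13T12 c U (β.erase j) α = weightT13T12 c U β α *
      (g c j u * ((∏ a ∈ α, h c j a) * (∏ i ∈ β.erase j, g c i j) * ∏ s ∈ U \ α, f c j s)) := by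
  have hje : j ∉ β.erase j := Finset.notMem_erase _ _
  rw [recCoeff, ← Finset.prod_sdiff hα, weightT13T12, weightT13T12]
  conv_rhs => rw [← Finset.insert_erase hj, Finset.erase_insert hje]
  simp only [dprod_insert_left _ hje, f_eq_g_mul_h hc, Finset.prod_mul_distrib]
  ring

theorem recCoeff_mul_weightT12T13_erase (hc : c ≠ 0) (hα : α ⊆ U) (hj : j ∈ β) :
    recCoeff c u U β j * weightT12T13 c U (β.erase j) α = weightT12T13 c U β α *
      (g c j u * ((∏ a ∈ α, h c j a) * ∏ i ∈ β.erase j, g c i j)) := by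
  have hje : j ∉ β.erase j := Finset.notMem_erase _ _
  rw [recCoeff, ← Finset.prod_sdiff hα, weightT12T13, weightT12T13]
  conv_rhs => rw [← Finset.insert_erase hj, Finset.erase_insert hje]
  simp only [dprod_insert_left _ hje, f_eq_g_mul_h hc, Finset.prod_mul_distrib]
  ring

theorem coeffT13T12_insert_insert (hc : c ≠ 0) (hu : u ∉ U) (huβ : u ∉ β) (hUβ : Disjoint U β)
    (hα : α ⊆ U) :
    coeffT13T12 c (insert u U) β (insert u α) =
      (∑ s ∈ U \ α, coeffT13T12 c U β (insert s α) * (g c u s * ∏ y ∈ α, g c y s) *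
        ∏ y ∈ α, h c y u) +
      ∑ j ∈ β, recCoeff c u U β j * coeffT13T12 c U (β.erase j) α * ∏ y ∈ α, h c y u := by
  have hcard_insert : ∀ s ∈ insert u U \ α, (insert s α).card = α.card + 1 := fun s hs =>
    Finset.card_insert_of_notMem (Finset.mem_sdiff.1 hs).2
  have hu' : u ∈ insert u U \ α :=
    Finset.mem_sdiff.2 ⟨Finset.mem_insert_self _ _, fun hmem => hu (hα hmem)⟩
  have hsub : U \ α ⊆ insert u U \ α := Finset.sdiff_subset_sdiff (Finset.subset_insert _ _) le_rfl
  by_cases hcard : β.card = α.card + 1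
  · rw [coeffT13T12, if_pos (by rw [hcard_insert u hu', hcard]),
      weightT13T12_insert_insert hc hu hα,
      prod_h_mul_prod_g_mul_prod_f hc (hUβ.mono_left Finset.sdiff_subset)
        (fun hmem => hu (Finset.mem_sdiff.1 hmem).1) huβ (by omega),
      mul_add, Finset.mul_sum, Finset.mul_sum]
    refine congrArg₂ (· + ·) (Finset.sum_congr rfl fun s hs => ?_)
      (Finset.sum_congr rfl fun j hj => ?_)
    · rw [coeffT13T12, if_pos (by rw [hcard_insert s (hsub hs), hcard])]
      linear_combination -g c u s * (∏ y ∈ α, h c y u) * weightT13T12_insert_mul_prod_g hc hs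
    · rw [coeffT13T12, if_pos ((card_erase_eq_iff hj).2 hcard)]
      linear_combination -(∏ y ∈ α, h c y u) * recCoeff_mul_weightT13T12_erase hc hα hj
  · rw [coeffT13T12, if_neg (by rwa [hcard_insert u hu']), Finset.sum_eq_zero fun s hs => ?_,
      Finset.sum_eq_zero fun j hj => ?_, add_zero]
    · rw [coeffT13T12, if_neg ((card_erase_eq_iff hj).not.2 hcard), mul_zero, zero_mul]
    · rw [coeffT13T12, if_neg (by rwa [hcard_insert s (hsub hs)]), zero_mul, zero_mul]

theorem coeffT12T13_insert_insert (hc : c ≠ 0) (hu : u ∉ U) (huβ : u ∉ β) (hα : α ⊆ U) :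
    coeffT12T13 c (insert u U) β (insert u α) =
      ∑ j ∈ β, recCoeff c u U β j * coeffT12T13 c U (β.erase j) α *
        ((∏ s ∈ U \ α, f c s u) * ∏ y ∈ α, h c y u) := by
  have huα : u ∉ α := fun hmem => hu (hα hmem)
  by_cases hcard : β.card = α.card + 1
  · have hweight : weightT12T13 c (insert u U) β (insert u α) = (weightT12T13 c U β α *
        (∏ s ∈ U \ α, f c s u) * ∏ y ∈ α, h c y u) * ((∏ a ∈ α, h c u a) * ∏ j ∈ β, g c j u) := by
      rw [weightT12T13, weightT12T13, Finset.insert_sdiff_insert, Finset.sdiff_insert_of_notMem hu]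
      simp only [dprod_insert_left _ huα, dprod_insert_right _ _ huα, Finset.prod_insert huα,
        h_self hc]
      ring
    rw [coeffT12T13, if_pos (by rw [Finset.card_insert_of_notMem huα, hcard]), hweight,
      prod_h_mul_prod_g_eq_sum hc huβ (by omega), Finset.mul_sum]
    refine Finset.sum_congr rfl fun j hj => ?_
    rw [coeffT12T13, if_pos ((card_erase_eq_iff hj).2 hcard)]
    linear_combination -((∏ s ∈ U \ α, f c s u) * ∏ y ∈ α, h c y u) *
      recCoeff_mul_weightT12T13_erase hc hα hj
  · rw [coeffT12T13, if_neg (by rwa [Finset.card_insert_of_notMem huα]),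
      Finset.sum_eq_zero fun j hj => ?_]
    rw [coeffT12T13, if_neg ((card_erase_eq_iff hj).not.2 hcard), mul_zero, zero_mul]

theorem weightT12T13_insert_of_notMem (hu : u ∉ U) (huα : u ∉ α) :
    weightT12T13 c (insert u U) β α =
      weightT12T13 c U β α * ((∏ s ∈ α, f c u s) * ∏ v ∈ β, f c v u) := by
  have huU : u ∉ U \ α := fun hmem => hu (Finset.mem_sdiff.1 hmem).1
  rw [weightT12T13, weightT12T13, Finset.insert_sdiff_of_notMem _ huα,
    dprod_insert_left _ huU, dprod_insert_right _ _ huU]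
  ring

theorem weightT12T13_mul_prod_g_mul_prod_h (hc : c ≠ 0) (hα : α ⊆ U) (hs : s ∈ α) :
    weightT12T13 c U β α * ((∏ s' ∈ α.erase s, g c s s') * ∏ v ∈ β, h c v s) =
      weightT12T13 c U β (α.erase s) *
        ((∏ y ∈ U \ α, f c y s) * ∏ y ∈ α.erase s, h c y s) := by
  have hse : s ∉ α.erase s := Finset.notMem_erase _ _
  have hsU : s ∉ U \ α := fun hmem => (Finset.mem_sdiff.1 hmem).2 hs
  rw [weightT12T13, weightT12T13, Finset.sdiff_erase (hα hs), dprod_insert_left _ hsU,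
    dprod_insert_right _ _ hsU]
  generalize U \ α = W
  conv_lhs => rw [← Finset.insert_erase hs, Finset.erase_insert hse]
  simp only [dprod_insert_left _ hse, dprod_insert_right _ _ hse, Finset.prod_insert hse,
    h_self hc, f_eq_g_mul_h hc, Finset.prod_mul_distrib]
  ring

theorem coeffT12T13_insert_of_subset (hc : c ≠ 0) (hu : u ∉ U) (huβ : u ∉ β) (hα : α ⊆ U)
    (hh : ∀ s ∈ U, h c u s ≠ 0) :
    coeffT12T13 c (insert u U) β α = coeffT12T13 c U β α +
      ∑ j ∈ β, ∑ s ∈ α, recCoeff c u U β j * coeffT12T13 c U (β.erase j) (α.erase s) *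
        (g c u s * (∏ y ∈ U \ α, f c y s) * ∏ y ∈ α.erase s, h c y s) := by
  have huα : u ∉ α := fun hmem => hu (hα hmem)
  by_cases hcard : β.card = α.card
  · rw [coeffT12T13, if_pos hcard, weightT12T13_insert_of_notMem hu huα,
      prod_f_mul_prod_f_eq hc hcard.le huα huβ fun s hs => hh s (hα hs), coeffT12T13,
      if_pos hcard, mul_sub, mul_one, sub_eq_add_neg, Finset.sum_comm, Finset.mul_sum,
      Finset.mul_sum, ← Finset.sum_neg_distrib]
    refine congrArg _ (Finset.sum_congr rfl fun s hs => ?_)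
    have hcard' : β.card = (α.erase s).card + 1 := by rw [Finset.card_erase_add_one hs, hcard]
    have hinterp := prod_h_mul_prod_g_eq_sum (W := α.erase s) hc huβ (by omega)
    calc -(weightT12T13 c U β α * ((∏ v ∈ β, g c v u) * (g c s u *
          ((∏ s' ∈ α.erase s, g c s s') * (∏ v ∈ β, h c v s) * ∏ s' ∈ α.erase s, h c u s'))))
      _ = weightT12T13 c U β (α.erase s) *
            (g c u s * (∏ y ∈ U \ α, f c y s) * ∏ y ∈ α.erase s, h c y s) *
            ((∏ s' ∈ α.erase s, h c u s') * ∏ v ∈ β, g c v u) := by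
        rw [g_swap c s u]
        linear_combination g c u s * ((∏ s' ∈ α.erase s, h c u s') * ∏ v ∈ β, g c v u) *
          weightT12T13_mul_prod_g_mul_prod_h hc hα hs
      _ = _ := by
        rw [hinterp, Finset.mul_sum]
        refine Finset.sum_congr rfl fun j hj => ?_
        rw [coeffT12T13, if_pos ((card_erase_eq_iff hj).2 hcard')]
        linear_combination -(g c u s * (∏ y ∈ U \ α, f c y s) * ∏ y ∈ α.erase s, h c y s) *
          recCoeff_mul_weightT12T13_erase hc ((Finset.erase_subset s α).trans hα) hj
  · rw [coeffT12T13, if_neg hcard, coeffT12T13, if_neg hcard, zero_add, eq_comm]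
    refine Finset.sum_eq_zero fun j hj => Finset.sum_eq_zero fun s hs => ?_
    rw [coeffT12T13, if_neg (by rwa [card_erase_eq_iff hj, Finset.card_erase_add_one hs]),
      mul_zero, zero_mul]

variable {T : Fin 3 → Fin 3 → D → A}

theorem T12_mul_T13_mul_T12 (hc : c ≠ 0) (hT : IsMonodromy c T)
    (hφ : NonvanishingOn (h c) (insert u U)) (hu : u ∉ U) (hα : α ⊆ U) :
    T 0 1 u * (symProd (h c) (T 0 2) α * symProd 1 (T 0 1) (U \ α)) =
      (∏ s ∈ α, f c s u) •
        (symProd (h c) (T 0 2) α * symProd 1 (T 0 1) (insert u (U \ α))) +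
      ∑ s ∈ α, ((g c u s * ∏ y ∈ α.erase s, g c y s) * ∏ y ∈ α.erase s, h c y u) •
        (symProd (h c) (T 0 2) (insert u (α.erase s)) *
          symProd 1 (T 0 1) (U \ α.erase s)) := by
  have h12 := hT.exchangeSymm_even (i := 0) (j := 1) rfl
  have h13 := hT.exchangeSymm_odd hc (i := 0) (j := 2) rfl rfl
  have huα : u ∉ α := fun hmem => hu (hα hmem)
  rw [← mul_assoc, mul_symProd_h hc (ε := 1) h13
    (fun x y hxy => by simpa [par] using hT.row_exchange (i := 0) (j := 1) (l := 2) rfl hxy)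
    (hφ.mono (hα.trans (Finset.subset_insert _ _))) huα, one_pow, one_smul, add_mul,
    smul_mul_assoc, mul_assoc,
    ← h12.symProd_one_insert fun hmem => hu (Finset.mem_sdiff.1 hmem).1, Finset.sum_mul]
  refine congrArg _ (Finset.sum_congr rfl fun s hs => ?_)
  have huαs : u ∉ α.erase s := fun hmem => huα (Finset.mem_of_mem_erase hmem)
  rw [h13.mul_symProd huαs (hφ.mono (Finset.insert_subset_insert _
    ((Finset.erase_subset _ _).trans hα))), smul_mul_assoc, smul_mul_assoc, smul_mul_assoc,
    mul_assoc, ← h12.symProd_one_insert fun hmem => (Finset.mem_sdiff.1 hmem).2 hs, smul_smul,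
    Finset.sdiff_erase (hα hs)]

theorem T12_mul_rowT13T12 (hc : c ≠ 0) (hT : IsMonodromy c T)
    (hφ : NonvanishingOn (h c) (insert u U)) (hu : u ∉ U) :
    T 0 1 u * rowT13T12 c T U β =
      (∑ α ∈ U.powerset, ((∏ s ∈ α, f c s u) * coeffT13T12 c U β α) •
        (symProd (h c) (T 0 2) α * symProd 1 (T 0 1) (insert u (U \ α)))) +
      ∑ α ∈ U.powerset, ∑ s ∈ U \ α, (coeffT13T12 c U β (insert s α) *
        (g c u s * ∏ y ∈ α, g c y s) * ∏ y ∈ α, h c y u) •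
        (symProd (h c) (T 0 2) (insert u α) * symProd 1 (T 0 1) (U \ α)) := by
  rw [sum_powerset_sdiff U fun s α => (coeffT13T12 c U β (insert s α) *
      (g c u s * ∏ y ∈ α, g c y s) * ∏ y ∈ α, h c y u) •
      (symProd (h c) (T 0 2) (insert u α) * symProd 1 (T 0 1) (U \ α)),
    rowT13T12, Finset.mul_sum, ← Finset.sum_add_distrib]
  refine Finset.sum_congr rfl fun α hα => ?_
  rw [mul_smul_comm, T12_mul_T13_mul_T12 hc hT hφ hu (Finset.mem_powerset.1 hα), smul_add,
    smul_smul, Finset.smul_sum, mul_comm]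
  refine congrArg _ (Finset.sum_congr rfl fun s hs => ?_)
  rw [smul_smul, Finset.insert_erase hs, mul_assoc (coeffT13T12 c U β α)]

theorem T13_mul_rowT13T12 (hc : c ≠ 0) (hT : IsMonodromy c T)
    (hφ : NonvanishingOn (h c) (insert u U)) (hu : u ∉ U) :
    T 0 2 u * rowT13T12 c T U β =
      ∑ α ∈ U.powerset, (coeffT13T12 c U β α * ∏ y ∈ α, h c y u) •
        (symProd (h c) (T 0 2) (insert u α) * symProd 1 (T 0 1) (U \ α)) := by
  rw [rowT13T12, Finset.mul_sum]
  refine Finset.sum_congr rfl fun α hα => ?_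
  rw [Finset.mem_powerset] at hα
  rw [mul_smul_comm, ← mul_assoc, (hT.exchangeSymm_odd hc rfl rfl).mul_symProd
    (fun hmem => hu (hα hmem)) (hφ.mono (Finset.insert_subset_insert _ hα)), smul_mul_assoc,
    smul_smul]

theorem rowT13T12_insert (hc : c ≠ 0) (hT : IsMonodromy c T)
    (hφ : NonvanishingOn (h c) (insert u U)) (hu : u ∉ U) (huβ : u ∉ β) (hUβ : Disjoint U β) :
    rowT13T12 c T (insert u U) β = T 0 1 u * rowT13T12 c T U β +
      ∑ j ∈ β, recCoeff c u U β j • (T 0 2 u * rowT13T12 c T U (β.erase j)) := by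
  simp only [T12_mul_rowT13T12 hc hT hφ hu, T13_mul_rowT13T12 hc hT hφ hu, Finset.smul_sum,
    smul_smul]
  rw [Finset.sum_comm (s := β), add_assoc, ← Finset.sum_add_distrib, rowT13T12,
    Finset.sum_powerset_insert hu]
  refine congrArg₂ (· + ·) (Finset.sum_congr rfl fun α hα => ?_)
    (Finset.sum_congr rfl fun α hα => ?_) <;> rw [Finset.mem_powerset] at hα
  · rw [coeffT13T12_insert_of_subset hu hα,
      Finset.insert_sdiff_of_notMem _ fun hmem => hu (hα hmem)]
  · rw [coeffT13T12_insert_insert hc hu huβ hUβ hα, Finset.insert_sdiff_insert,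
      Finset.sdiff_insert_of_notMem hu, add_smul, Finset.sum_smul, Finset.sum_smul]
    simp only [mul_assoc]

theorem T13_mul_T12_mul_T13 (hc : c ≠ 0) (hT : IsMonodromy c T)
    (hφ : NonvanishingOn (h c) (insert u U)) (hu : u ∉ U) (hα : α ⊆ U) :
    T 0 2 u * (symProd 1 (T 0 1) (U \ α) * symProd (h c) (T 0 2) α) =
      ((∏ s ∈ U \ α, f c s u) * ∏ y ∈ α, h c y u) •
        (symProd 1 (T 0 1) (U \ α) * symProd (h c) (T 0 2) (insert u α)) +
      ∑ s ∈ U \ α, (g c u s * (∏ y ∈ U \ insert s α, f c y s) * ∏ y ∈ α, h c y s) •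
        (symProd 1 (T 0 1) (insert u (U \ insert s α)) * symProd (h c) (T 0 2) (insert s α)) := by
  have h12 := hT.exchangeSymm_even (i := 0) (j := 1) rfl
  have h13 := hT.exchangeSymm_odd hc (i := 0) (j := 2) rfl rfl
  rw [← mul_assoc, mul_symProd_one h12
    (fun x y hxy => by simpa [par] using hT.row_exchange (i := 0) (j := 2) (l := 1) rfl hxy)
    (fun hmem => hu (Finset.mem_sdiff.1 hmem).1), add_mul, smul_mul_assoc, mul_assoc,
    h13.mul_symProd (fun hmem => hu (hα hmem)) (hφ.mono (Finset.insert_subset_insert _ hα)),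
    mul_smul_comm, smul_smul, Finset.sum_mul]
  refine congrArg _ (Finset.sum_congr rfl fun s hs => ?_)
  obtain ⟨hsU, hsα⟩ := Finset.mem_sdiff.1 hs
  rw [smul_mul_assoc, mul_assoc, h13.mul_symProd hsα (hφ.mono ((Finset.insert_subset hsU hα).trans
    (Finset.subset_insert _ _))), ← Finset.sdiff_insert, ← h12.symProd_one_insert
    (fun hmem => hu (Finset.mem_sdiff.1 hmem).1), mul_smul_comm, smul_smul]

theorem T13_mul_rowT12T13 (hc : c ≠ 0) (hT : IsMonodromy c T)
    (hφ : NonvanishingOn (h c) (insert u U)) (hu : u ∉ U) :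
    T 0 2 u * rowT12T13 c T U β =
      (∑ α ∈ U.powerset, (coeffT12T13 c U β α *
        ((∏ s ∈ U \ α, f c s u) * ∏ y ∈ α, h c y u)) •
        (symProd 1 (T 0 1) (U \ α) * symProd (h c) (T 0 2) (insert u α))) +
      ∑ α ∈ U.powerset, ∑ s ∈ α, (coeffT12T13 c U β (α.erase s) *
        (g c u s * (∏ y ∈ U \ α, f c y s) * ∏ y ∈ α.erase s, h c y s)) •
        (symProd 1 (T 0 1) (insert u (U \ α)) * symProd (h c) (T 0 2) α) := by
  rw [← sum_powerset_sdiff_insert U fun s α => (coeffT12T13 c U β (α.erase s) *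
      (g c u s * (∏ y ∈ U \ α, f c y s) * ∏ y ∈ α.erase s, h c y s)) •
      (symProd 1 (T 0 1) (insert u (U \ α)) * symProd (h c) (T 0 2) α),
    ← Finset.sum_add_distrib, rowT12T13, Finset.mul_sum]
  refine Finset.sum_congr rfl fun α hα => ?_
  rw [mul_smul_comm, T13_mul_T12_mul_T13 hc hT hφ hu (Finset.mem_powerset.1 hα), smul_add,
    smul_smul, Finset.smul_sum]
  refine congrArg _ (Finset.sum_congr rfl fun s hs => ?_)
  rw [smul_smul, Finset.erase_insert (Finset.mem_sdiff.1 hs).2]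

theorem rowT12T13_insert (hc : c ≠ 0) (hT : IsMonodromy c T)
    (hφ : NonvanishingOn (h c) (insert u U)) (hu : u ∉ U) (huβ : u ∉ β) :
    rowT12T13 c T (insert u U) β = T 0 1 u * rowT12T13 c T U β +
      ∑ j ∈ β, recCoeff c u U β j • (T 0 2 u * rowT12T13 c T U (β.erase j)) := by
  have hh : ∀ s ∈ U, h c u s ≠ 0 := fun s hs => hφ u (Finset.mem_insert_self _ _) s
    (Finset.mem_insert_of_mem hs) (ne_of_mem_of_not_mem hs hu).symm
  simp only [T13_mul_rowT12T13 hc hT hφ hu, Finset.smul_sum, smul_add, smul_smul,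
    Finset.sum_add_distrib]
  rw [Finset.sum_comm (s := β), Finset.sum_comm (s := β), add_comm (∑ α ∈ U.powerset, _),
    ← add_assoc, rowT12T13.eq_1 c T U, Finset.mul_sum, ← Finset.sum_add_distrib, rowT12T13,
    Finset.sum_powerset_insert hu]
  refine congrArg₂ (· + ·) (Finset.sum_congr rfl fun α hα => ?_)
    (Finset.sum_congr rfl fun α hα => ?_) <;> rw [Finset.mem_powerset] at hα
  · rw [coeffT12T13_insert_of_subset hc hu huβ hα hh,
      Finset.insert_sdiff_of_notMem _ fun hmem => hu (hα hmem), add_smul, mul_smul_comm,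
      ← mul_assoc, ← (hT.exchangeSymm_even (i := 0) (j := 1) rfl).symProd_one_insert
        fun hmem => hu (Finset.mem_sdiff.1 hmem).1]
    simp only [Finset.sum_smul, mul_assoc]
  · rw [coeffT12T13_insert_insert hc hu huβ hα, Finset.insert_sdiff_insert,
      Finset.sdiff_insert_of_notMem hu, Finset.sum_smul]
    simp only [mul_assoc]

theorem rowT13T12_eq_rowT12T13 (hc : c ≠ 0) (hT : IsMonodromy c T)
    (hφ : NonvanishingOn (h c) U) (hUβ : Disjoint U β) :
    rowT13T12 c T U β = rowT12T13 c T U β := by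
  induction U using Finset.induction_on generalizing β with
  | empty => simp [rowT13T12, rowT12T13, coeffT13T12, coeffT12T13, weightT13T12, weightT12T13]
  | insert u U hu ih =>
    obtain ⟨huβ, hUβ⟩ := Finset.disjoint_insert_left.1 hUβ
    have ih' : ∀ γ ⊆ β, rowT13T12 c T U γ = rowT12T13 c T U γ := fun γ hγ =>
      ih (hφ.mono (Finset.subset_insert _ _)) (hUβ.mono_right hγ)
    rw [rowT13T12_insert hc hT hφ hu huβ hUβ, rowT12T13_insert hc hT hφ hu huβ, ih' β subset_rfl]
    exact congrArg _ (Finset.sum_congr rfl fun j _ => by rw [ih' _ (Finset.erase_subset _ _)])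

end FirstRow

section DoubleErase

variable {ι M : Type*} [DecidableEq ι]

theorem sum_sum_erase_comm [AddCommMonoid M] (V : Finset ι) (F : ι → ι → M) :
    ∑ j ∈ V, ∑ k ∈ V.erase j, F j k = ∑ j ∈ V, ∑ k ∈ V.erase j, F k j := by
  refine Finset.sum_comm' fun j k => ?_
  simp only [Finset.mem_erase]
  tauto

theorem sum_sum_erase_congr [AddCommGroup M] [IsAddTorsionFree M] {V : Finset ι}
    {F G : ι → ι → M} (hFG : ∀ j ∈ V, ∀ k ∈ V, j ≠ k → F j k + F k j = G j k + G k j) :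
    ∑ j ∈ V, ∑ k ∈ V.erase j, F j k = ∑ j ∈ V, ∑ k ∈ V.erase j, G j k := by
  have htwo : ∀ F : ι → ι → M, 2 • ∑ j ∈ V, ∑ k ∈ V.erase j, F j k =
      ∑ j ∈ V, ∑ k ∈ V.erase j, (F j k + F k j) := fun F => by
    simp only [Finset.sum_add_distrib]
    rw [← sum_sum_erase_comm V F, two_nsmul]
  refine nsmul_right_injective two_ne_zero ?_
  simp only [htwo]
  refine Finset.sum_congr rfl fun j hj => Finset.sum_congr rfl fun k hk => ?_
  obtain ⟨hkj, hkV⟩ := Finset.mem_erase.1 hk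
  exact hFG j hj k hkV hkj.symm

theorem isAddTorsionFree_of_module_complex (M : Type*) [AddCommGroup M] [Module ℂ M] :
    IsAddTorsionFree M :=
  haveI : Module ℚ M := Module.compHom M (algebraMap ℚ ℂ)
  .of_module_rat M

end DoubleErase

section Recursions

variable {D : Set ℂ} {A : Type*} [Ring A] [Algebra ℂ A]

/-- The recursion for a family `X` of operators which adds the variable `z` to `U` on the left. -/
def recL (c : ℂ) (T : Fin 3 → Fin 3 → D → A) (U : Finset D) (X : Finset D → A) (z : D)
    (V : Finset D) : A :=
  T 0 1 z * X V + ∑ j ∈ V, recCoeff c z U V j • (T 0 2 z * X (V.erase j) * T 1 1 j)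

/-- The recursion for a family `X` of operators which adds the variable `z` to `U` on the right. -/
def recR (c : ℂ) (T : Fin 3 → Fin 3 → D → A) (U : Finset D) (X : Finset D → A) (z : D)
    (V : Finset D) : A :=
  X V * T 0 1 z + ∑ j ∈ V, recCoeff c z U V j • (T 0 2 j * X (V.erase j) * T 1 1 z)

/-- The factor of `recCoeff c z U V j` which involves neither the new variable `z` nor a second
element `k` of `V`. -/
def pairCoeff (c : ℂ) (U V : Finset D) (j k : D) : ℂ :=
  (∏ i ∈ (V.erase j).erase k, g c i j) * ∏ s ∈ U, f c j s

variable {c : ℂ} {T : Fin 3 → Fin 3 → D → A} {U V : Finset D} {X Y : Finset D → A}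
variable {z p j k : D}

theorem recL_congr (hXY : ∀ W ⊆ V, X W = Y W) : recL c T U X z V = recL c T U Y z V := by
  rw [recL, recL, hXY V subset_rfl]
  exact congrArg _ (Finset.sum_congr rfl fun j _ => by rw [hXY _ (Finset.erase_subset _ _)])

theorem recR_congr (hXY : ∀ W ⊆ V, X W = Y W) : recR c T U X z V = recR c T U Y z V := by
  rw [recR, recR, hXY V subset_rfl]
  exact congrArg _ (Finset.sum_congr rfl fun j _ => by rw [hXY _ (Finset.erase_subset _ _)])

theorem recCoeff_insert (hp : p ∉ U) :
    recCoeff c z (insert p U) V j = f c j p * recCoeff c z U V j := by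
  rw [recCoeff, recCoeff, Finset.prod_insert hp]
  ring

theorem recCoeff_eq_pairCoeff (hk : k ∈ V) (hjk : j ≠ k) :
    recCoeff c z U V j = g c j z * g c k j * pairCoeff c U V j k := by
  rw [recCoeff, pairCoeff,
    ← Finset.mul_prod_erase (V.erase j) _ (Finset.mem_erase.2 ⟨hjk.symm, hk⟩)]
  ring

theorem recCoeff_erase : recCoeff c z U (V.erase j) k = g c k z * pairCoeff c U V k j := by
  rw [recCoeff, pairCoeff, Finset.erase_right_comm]
  ring

theorem recL_recL (hp : p ∉ U) :
    recL c T (insert p U) (recL c T U X p) z V = T 0 1 z * T 0 1 p * X V +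
      (∑ j ∈ V, (recCoeff c p U V j • (T 0 1 z * T 0 2 p * (X (V.erase j) * T 1 1 j)) +
        (f c j p * recCoeff c z U V j) • (T 0 2 z * T 0 1 p * (X (V.erase j) * T 1 1 j)))) +
      ∑ j ∈ V, ∑ k ∈ V.erase j,
        (f c j p * recCoeff c z U V j * recCoeff c p U (V.erase j) k) •
          (T 0 2 z * T 0 2 p * (X ((V.erase j).erase k) * (T 1 1 k * T 1 1 j))) := by
  simp only [recL, recCoeff_insert hp, mul_add, add_mul, Finset.mul_sum, Finset.sum_mul,
    smul_add, Finset.smul_sum, Finset.sum_add_distrib, mul_smul_comm, smul_mul_assoc, smul_smul,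
    mul_assoc]
  abel

theorem recL_recR (hz : z ∉ U) :
    recL c T (insert z U) (recR c T U X z) p V = T 0 1 p * X V * T 0 1 z +
      (∑ k ∈ V, (recCoeff c z U V k • (T 0 1 p * T 0 2 k * (X (V.erase k) * T 1 1 z)) +
        (f c k z * recCoeff c p U V k) • (T 0 2 p * X (V.erase k) * (T 0 1 z * T 1 1 k)))) +
      ∑ k ∈ V, ∑ j ∈ V.erase k,
        (f c k z * recCoeff c p U V k * recCoeff c z U (V.erase k) j) •
          (T 0 2 p * T 0 2 j * (X ((V.erase k).erase j) * (T 1 1 z * T 1 1 k))) := by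
  simp only [recL, recR, recCoeff_insert hz, mul_add, add_mul, Finset.mul_sum,
    Finset.sum_mul, smul_add, Finset.smul_sum, Finset.sum_add_distrib, mul_smul_comm,
    smul_mul_assoc, smul_smul, mul_assoc]
  abel

theorem recR_recL (hp : p ∉ U) :
    recR c T (insert p U) (recL c T U X p) z V = T 0 1 p * X V * T 0 1 z +
      (∑ k ∈ V, ((f c k p * recCoeff c z U V k) • (T 0 2 k * T 0 1 p * (X (V.erase k) * T 1 1 z)) +
        recCoeff c p U V k • (T 0 2 p * X (V.erase k) * (T 1 1 k * T 0 1 z)))) +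
      ∑ k ∈ V, ∑ j ∈ V.erase k,
        (f c k p * recCoeff c z U V k * recCoeff c p U (V.erase k) j) •
          (T 0 2 k * T 0 2 p * (X ((V.erase k).erase j) * (T 1 1 j * T 1 1 z))) := by
  simp only [recL, recR, recCoeff_insert hp, mul_add, add_mul, Finset.mul_sum,
    Finset.sum_mul, smul_add, Finset.smul_sum, Finset.sum_add_distrib, mul_smul_comm,
    smul_mul_assoc, smul_smul, mul_assoc]
  abel

theorem T12_mul_T13_symm (hT : IsMonodromy c T) (hjz : j ≠ z) (hjp : j ≠ p) (hzp : z ≠ p) :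
    g c j p • (T 0 1 z * T 0 2 p) + (f c j p * g c j z) • (T 0 2 z * T 0 1 p) =
      g c j z • (T 0 1 p * T 0 2 z) + (f c j z * g c j p) • (T 0 2 p * T 0 1 z) := by
  have hex : ∀ {x y : D}, x ≠ y →
      T 0 1 x * T 0 2 y = f c y x • (T 0 2 y * T 0 1 x) + g c x y • (T 0 2 x * T 0 1 y) :=
    fun hxy => by simpa [par] using hT.row_exchange (i := 0) (j := 1) (l := 2) rfl hxy
  have hzp' := coe_ne_coe hzp
  have hjz' := coe_ne_coe hjz
  have hjp' := coe_ne_coe hjp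
  have hg_zp := g_mul_g c hjz' hjp' hzp'
  have hg_pz := g_mul_g c hjp' hjz' hzp'.symm
  rw [g_swap c z j] at hg_zp
  rw [g_swap c p j] at hg_pz
  rw [hex hzp, hex hzp.symm, f_eq_one_add_g c hzp', f_eq_one_add_g c hzp'.symm,
    f_eq_one_add_g c hjz', f_eq_one_add_g c hjp']
  match_scalars
  · linear_combination -hg_pz
  · linear_combination hg_zp

theorem f_mul_g_add_f_mul_g {x y s t : ℂ} (hc : c ≠ 0) (hxs : x ≠ s) (hxt : x ≠ t) (hys : y ≠ s)
    (hyt : y ≠ t) (hxy : x ≠ y) :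
    f c x t * g c x s * g c y x * g c y t + f c y t * g c y s * g c x y * g c x t =
      g c x s * g c x t * g c y s * g c y t * h c s t := by
  have hxs' := sub_ne_zero.2 hxs
  have hxt' := sub_ne_zero.2 hxt
  have hys' := sub_ne_zero.2 hys
  have hyt' := sub_ne_zero.2 hyt
  have hxy' := sub_ne_zero.2 hxy
  rw [g_swap c y x]
  simp only [f, g, h]
  field_simp
  ring

theorem recL_recL_comm (hc : c ≠ 0) (hT : IsMonodromy c T) (hz : z ∉ U) (hp : p ∉ U)
    (hzp : z ≠ p) (hzV : z ∉ V) (hpV : p ∉ V) :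
    recL c T (insert p U) (recL c T U X p) z V = recL c T (insert z U) (recL c T U X z) p V := by
  rw [recL_recL hp, recL_recL hz, hT.even_comm (i := 0) (j := 1) rfl z p]
  congr 1
  · refine congrArg _ (Finset.sum_congr rfl fun j hj => ?_)
    have hsymm := congrArg
      (fun Q => ((∏ i ∈ V.erase j, g c i j) * ∏ s ∈ U, f c j s) • (Q * (X (V.erase j) * T 1 1 j)))
      (T12_mul_T13_symm hT (ne_of_mem_of_not_mem hj hzV) (ne_of_mem_of_not_mem hj hpV) hzp)
    simp only [add_mul, smul_mul_assoc] at hsymm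
    simp only [recCoeff]
    linear_combination (norm := module) hsymm
  · have := isAddTorsionFree_of_module_complex A
    refine sum_sum_erase_congr fun j hj k hk hjk => ?_
    have hcoe : ∀ {i w : D}, i ∈ V → w ∉ V → (i : ℂ) ≠ w := fun hi hw =>
      coe_ne_coe (ne_of_mem_of_not_mem hi hw)
    have hscalar : ∀ s t : D, s ∉ V → t ∉ V →
        f c j t * recCoeff c s U V j * recCoeff c t U (V.erase j) k +
          f c k t * recCoeff c s U V k * recCoeff c t U (V.erase k) j =
        pairCoeff c U V j k * pairCoeff c U V k j *
          (g c j s * g c j t * g c k s * g c k t * h c s t) := fun s t hs ht => by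
      rw [recCoeff_eq_pairCoeff hk hjk, recCoeff_eq_pairCoeff hj hjk.symm, recCoeff_erase,
        recCoeff_erase]
      linear_combination pairCoeff c U V j k * pairCoeff c U V k j * f_mul_g_add_f_mul_g hc
        (hcoe hj hs) (hcoe hj ht) (hcoe hk hs) (hcoe hk ht) (coe_ne_coe hjk)
    rw [Finset.erase_right_comm (a := k) (b := j), hT.even_comm (i := 1) (j := 1) rfl j k,
      ← add_smul, ← add_smul, hscalar z p hzV hpV, hscalar p z hpV hzV]
    have hodd := congrArg (· * (X ((V.erase j).erase k) * (T 1 1 k * T 1 1 j)))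
      (hT.odd_exchange hc (i := 0) (j := 2) rfl rfl hzp)
    simp only [smul_mul_assoc] at hodd
    linear_combination (norm := module) (pairCoeff c U V j k * pairCoeff c U V k j *
      (g c j z * g c j p * g c k z * g c k p)) • hodd

theorem T12_mul_sub_mul_T12 (hX : recL c T U X k V = recR c T U X k V) :
    T 0 1 k * X V - X V * T 0 1 k = ∑ j ∈ V, recCoeff c k U V j •
      (T 0 2 j * X (V.erase j) * T 1 1 k - T 0 2 k * X (V.erase j) * T 1 1 j) := by
  rw [recL, recR] at hX
  simp only [smul_sub, Finset.sum_sub_distrib]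
  rw [sub_eq_sub_iff_add_eq_add, hX, add_comm]

theorem T12_mul_T13_mul_T22_eq (hT : IsMonodromy c T) (hkz : k ≠ z) (hkp : k ≠ p) (Q : A) :
    g c k z • (T 0 1 p * T 0 2 k * (Q * T 1 1 z)) +
        (f c k z * g c k p) • (T 0 2 p * Q * (T 0 1 z * T 1 1 k)) =
      (f c k p * g c k z) • (T 0 2 k * T 0 1 p * (Q * T 1 1 z)) +
        g c k p • (T 0 2 p * Q * (T 1 1 k * T 0 1 z)) +
        (g c k z * g c p k) • (T 0 2 p * (T 0 1 k * Q - Q * T 0 1 k) * T 1 1 z) := by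
  have hrow : T 0 1 p * T 0 2 k =
      f c k p • (T 0 2 k * T 0 1 p) + g c p k • (T 0 2 p * T 0 1 k) := by
    simpa [par] using hT.row_exchange (i := 0) (j := 1) (l := 2) rfl hkp.symm
  rw [hrow, hT.col_exchange_even (i := 1) (l := 1) (k := 0) rfl rfl rfl hkz, g_swap c p k,
    g_swap c z k]
  simp only [add_mul, mul_add, sub_mul, mul_sub, smul_mul_assoc, mul_smul_comm, mul_assoc]
  module

theorem f_mul_g_add_g_mul_g_sub {x y s t : ℂ} (hxs : x ≠ s) (hxt : x ≠ t) (hys : y ≠ s)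
    (hyt : y ≠ t) (hxy : x ≠ y) :
    f c y s * g c y t * g c x y * g c x s + g c y s * g c t y * g c x y * g c x y -
        g c x s * g c t x * g c y x * g c y x =
      -(f c t x * g c x s * g c y x * g c y t) := by
  have hxs' := sub_ne_zero.2 hxs
  have hxt' := sub_ne_zero.2 hxt
  have htx' := sub_ne_zero.2 hxt.symm
  have hys' := sub_ne_zero.2 hys
  have hyt' := sub_ne_zero.2 hyt
  have hxy' := sub_ne_zero.2 hxy
  rw [g_swap c t y, g_swap c t x, g_swap c y x]
  simp only [f, g]
  field_simp
  ring

theorem recL_recR_summand (hT : IsMonodromy c T) (hkz : k ≠ z) (hkp : k ≠ p)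
    (hX : recL c T U X k (V.erase k) = recR c T U X k (V.erase k)) :
    recCoeff c z U V k • (T 0 1 p * T 0 2 k * (X (V.erase k) * T 1 1 z)) +
        (f c k z * recCoeff c p U V k) • (T 0 2 p * X (V.erase k) * (T 0 1 z * T 1 1 k)) =
      ((f c k p * recCoeff c z U V k) • (T 0 2 k * T 0 1 p * (X (V.erase k) * T 1 1 z)) +
        recCoeff c p U V k • (T 0 2 p * X (V.erase k) * (T 1 1 k * T 0 1 z))) +
      ∑ j ∈ V.erase k, (recCoeff c z U V k * g c p k * recCoeff c k U (V.erase k) j) •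
        (T 0 2 p * T 0 2 j * (X ((V.erase k).erase j) * (T 1 1 k * T 1 1 z)) -
          T 0 2 p * T 0 2 k * (X ((V.erase k).erase j) * (T 1 1 j * T 1 1 z))) := by
  have hex := congrArg (((∏ i ∈ V.erase k, g c i k) * ∏ s ∈ U, f c k s) • ·)
    (T12_mul_T13_mul_T22_eq hT hkz hkp (X (V.erase k)))
  have hsum : (recCoeff c z U V k * g c p k) •
      (T 0 2 p * (T 0 1 k * X (V.erase k) - X (V.erase k) * T 0 1 k) * T 1 1 z) =
      ∑ j ∈ V.erase k, (recCoeff c z U V k * g c p k * recCoeff c k U (V.erase k) j) •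
        (T 0 2 p * T 0 2 j * (X ((V.erase k).erase j) * (T 1 1 k * T 1 1 z)) -
          T 0 2 p * T 0 2 k * (X ((V.erase k).erase j) * (T 1 1 j * T 1 1 z))) := by
    simp only [T12_mul_sub_mul_T12 hX, Finset.mul_sum, Finset.sum_mul, Finset.smul_sum,
      mul_smul_comm, smul_mul_assoc, smul_smul, mul_sub, sub_mul, mul_assoc]
  rw [← hsum]
  simp only [recCoeff]
  linear_combination (norm := module) hex

theorem recL_recR_eq_recR_recL (hT : IsMonodromy c T) (hz : z ∉ U) (hp : p ∉ U) (hzV : z ∉ V)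
    (hpV : p ∉ V) (hX : ∀ k ∈ V, recL c T U X k (V.erase k) = recR c T U X k (V.erase k)) :
    recL c T (insert z U) (recR c T U X z) p V = recR c T (insert p U) (recL c T U X p) z V := by
  have hne : ∀ {k w : D}, k ∈ V → w ∉ V → k ≠ w := fun hk hw => ne_of_mem_of_not_mem hk hw
  rw [recL_recR hz, recR_recL hp, Finset.sum_congr rfl fun k hk =>
    recL_recR_summand hT (hne hk hzV) (hne hk hpV) (hX k hk), Finset.sum_add_distrib,
    ← add_assoc, add_assoc, ← Finset.sum_add_distrib]
  refine congrArg _ ?_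
  simp only [← Finset.sum_add_distrib]
  have := isAddTorsionFree_of_module_complex A
  refine sum_sum_erase_congr fun j hj k hk hjk => ?_
  have hodd : ∀ l ∈ V, ∀ (a : ℂ) (Q : A), (f c l p * a) • (T 0 2 l * T 0 2 p * Q) =
      -((f c p l * a) • (T 0 2 p * T 0 2 l * Q)) := fun l hl a Q => by
    have hswap := congrArg (fun Q' => a • (Q' * Q))
      (hT.odd_exchange_f (i := 0) (j := 2) rfl rfl (hne hl hpV))
    simp only [smul_mul_assoc, neg_mul] at hswap
    linear_combination (norm := module) hswap
  have hcoe : ∀ {i w : D}, i ∈ V → w ∉ V → (i : ℂ) ≠ w := fun hi hw => coe_ne_coe (hne hi hw)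
  have hscalar_k := f_mul_g_add_g_mul_g_sub (c := c) (hcoe hj hzV) (hcoe hj hpV) (hcoe hk hzV)
    (hcoe hk hpV) (coe_ne_coe hjk)
  have hscalar_j := f_mul_g_add_g_mul_g_sub (c := c) (hcoe hk hzV) (hcoe hk hpV) (hcoe hj hzV)
    (hcoe hj hpV) (coe_ne_coe hjk.symm)
  simp only [mul_assoc (f c _ p), hodd j hj, hodd k hk, recCoeff_erase,
    recCoeff_eq_pairCoeff hk hjk, recCoeff_eq_pairCoeff hj hjk.symm]
  rw [Finset.erase_right_comm (a := k) (b := j), hT.even_comm (i := 1) (j := 1) rfl z j,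
    hT.even_comm (i := 1) (j := 1) rfl z k]
  match_scalars
  · linear_combination pairCoeff c U V j k * pairCoeff c U V k j * hscalar_j
  · linear_combination pairCoeff c U V j k * pairCoeff c U V k j * hscalar_k

end Recursions

section SecondRow

variable {D : Set ℂ} {A : Type*} [Ring A] [Algebra ℂ A]
variable {c : ℂ} {T : Fin 3 → Fin 3 → D → A} {V W : Finset D} {z w j : D}

theorem T22_mul_symProd_T23 (hc : c ≠ 0) (hT : IsMonodromy c T) (hφ : NonvanishingOn (h c) W)
    (hz : z ∉ W) :
    T 1 1 z * symProd (h c) (T 1 2) W =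
      (∏ y ∈ W, f c y z) • (symProd (h c) (T 1 2) W * T 1 1 z) +
      ∑ s ∈ W, (g c z s * ∏ y ∈ W.erase s, g c y s) •
        (T 1 2 z * symProd (h c) (T 1 2) (W.erase s) * T 1 1 s) := by
  simpa using mul_symProd_h hc (ε := 1) (hT.exchangeSymm_odd hc (i := 1) (j := 2) rfl rfl)
    (fun x y hxy => by simpa [par] using hT.row_exchange (i := 1) (j := 1) (l := 2) rfl hxy) hφ hz

theorem g_mul_g_add_f_mul_g {x y t : ℂ} (hxt : x ≠ t) (hxy : x ≠ y) (hyt : y ≠ t) :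
    g c x t * f c t y + g c t y * g c y x = g c x t * f c x y := by
  have hg := g_mul_g c hxy hxt hyt
  rw [f_eq_one_add_g c hxy, f_eq_one_add_g c hyt.symm, g_swap c t y]
  rw [g_swap c y x] at hg ⊢
  linear_combination -hg

theorem T23_mul_T13_mul_sub (hc : c ≠ 0) (hT : IsMonodromy c T) (hzw : z ≠ w) (hzj : z ≠ j)
    (hwj : w ≠ j) (Q : A) :
    g c j z • (T 1 2 w * (T 0 2 j * Q * T 1 1 z - T 0 2 z * Q * T 1 1 j)) +
        (g c z w * g c w j) • (T 0 2 z * T 1 2 w * Q * T 1 1 j) -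
        (g c z w * g c z j) • (T 0 2 w * T 1 2 z * Q * T 1 1 j) =
      (g c j z * g c w j * h c j w) •
        (T 0 2 j * T 1 2 w * Q * T 1 1 z - T 0 2 z * T 1 2 w * Q * T 1 1 j) -
      (g c j z * g c w j) • (T 0 2 w * (T 1 2 j * Q) * T 1 1 z) := by
  have hex : ∀ x, x ≠ w → T 1 2 w * T 0 2 x =
      -(f c x w • (T 0 2 x * T 1 2 w) + g c w x • (T 0 2 w * T 1 2 x)) :=
    fun x hx => hT.col_exchange_odd rfl rfl rfl hx.symm
  have hscalar := g_mul_g_add_f_mul_g (c := c) (coe_ne_coe hzj.symm) (coe_ne_coe hwj.symm)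
    (coe_ne_coe hzw.symm)
  have hf := f_eq_g_mul_h hc j w
  simp only [mul_sub, ← mul_assoc]
  rw [hex j hwj.symm, hex z hzw, g_swap c w z, g_swap c z j]
  rw [g_swap c j w] at hf
  simp only [neg_mul, add_mul, smul_mul_assoc]
  match_scalars
  · linear_combination -g c j z * hf
  · ring
  · linear_combination hscalar + g c j z * hf
  · ring

theorem sum_T13_mul_T23_mul_symProd (hc : c ≠ 0) (hT : IsMonodromy c T) (hzw : z ≠ w)
    (hzW : z ∉ W) (hw : w ∉ W) (hφ : NonvanishingOn (h c) W) :
    ∑ j ∈ W, (g c j z * g c w j * ∏ i ∈ W.erase j, g c i j) •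
        (T 0 2 w * (T 1 2 j * symProd (h c) (T 1 2) (W.erase j)) * T 1 1 z) =
      (g c w z * (∏ y ∈ W, f c y z) - g c w z * ∏ y ∈ W, f c y w) •
        (T 0 2 w * symProd (h c) (T 1 2) W * T 1 1 z) := by
  have hfrac := g_mul_prod_f_mul_prod_f hc (Finset.disjoint_empty_left W)
    (Finset.notMem_empty _) hzW (Finset.notMem_empty _) hw hzw.symm
  simp only [Finset.prod_empty, Finset.sum_empty, mul_one, one_mul, add_zero] at hfrac
  rw [hfrac, add_sub_cancel_left, Finset.sum_smul]
  refine Finset.sum_congr rfl fun j hj => ?_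
  rw [(hT.exchangeSymm_odd hc (i := 1) (j := 2) rfl rfl).mul_symProd (Finset.notMem_erase _ _)
    (by rwa [Finset.insert_erase hj]), Finset.insert_erase hj, mul_smul_comm, smul_mul_assoc,
    smul_smul, ← prod_h_mul_prod_g hc]
  congr 1
  ring

theorem T23_mul_sum_T13_mul_sub (hc : c ≠ 0) (hT : IsMonodromy c T) (hzw : z ≠ w)
    (hzW : z ∉ W) (hw : w ∉ W) (hφ : NonvanishingOn (h c) W) :
    T 1 2 w * (∑ j ∈ W, (g c j z * ∏ i ∈ W.erase j, g c i j) •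
        (T 0 2 j * symProd (h c) (T 1 2) (W.erase j) * T 1 1 z -
          T 0 2 z * symProd (h c) (T 1 2) (W.erase j) * T 1 1 j)) +
      g c z w • (T 0 2 z * (∑ s ∈ W, (g c w s * ∏ y ∈ W.erase s, g c y s) •
          (T 1 2 w * symProd (h c) (T 1 2) (W.erase s) * T 1 1 s)) -
        T 0 2 w * (∑ s ∈ W, (g c z s * ∏ y ∈ W.erase s, g c y s) •
          (T 1 2 z * symProd (h c) (T 1 2) (W.erase s) * T 1 1 s))) =
      ∑ j ∈ W, (g c j z * g c w j * h c j w * ∏ i ∈ W.erase j, g c i j) •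
        (T 0 2 j * T 1 2 w * symProd (h c) (T 1 2) (W.erase j) * T 1 1 z -
          T 0 2 z * T 1 2 w * symProd (h c) (T 1 2) (W.erase j) * T 1 1 j) -
      (g c w z * (∏ y ∈ W, f c y z) - g c w z * ∏ y ∈ W, f c y w) •
        (T 0 2 w * symProd (h c) (T 1 2) W * T 1 1 z) := by
  rw [← sum_T13_mul_T23_mul_symProd hc hT hzw hzW hw hφ]
  simp only [Finset.mul_sum, ← Finset.sum_sub_distrib, Finset.smul_sum, ← Finset.sum_add_distrib]
  refine Finset.sum_congr rfl fun j hj => ?_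
  have hterm := congrArg ((∏ i ∈ W.erase j, g c i j) • ·)
    (T23_mul_T13_mul_sub hc hT hzw (ne_of_mem_of_not_mem hj hzW).symm
      (ne_of_mem_of_not_mem hj hw).symm (symProd (h c) (T 1 2) (W.erase j)))
  simp only [mul_smul_comm, ← mul_assoc (T 0 2 _)] at hterm ⊢
  linear_combination (norm := module) hterm

theorem T12_mul_T23_mul_symProd_T23 (hc : c ≠ 0) (hT : IsMonodromy c T) (hzw : z ≠ w)
    (hzW : z ∉ W) (hw : w ∉ W) (hφ : NonvanishingOn (h c) W)
    (hW : T 0 1 z * symProd (h c) (T 1 2) W - symProd (h c) (T 1 2) W * T 0 1 z =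
      ∑ j ∈ W, (g c j z * ∏ i ∈ W.erase j, g c i j) •
        (T 0 2 j * symProd (h c) (T 1 2) (W.erase j) * T 1 1 z -
          T 0 2 z * symProd (h c) (T 1 2) (W.erase j) * T 1 1 j)) :
    T 0 1 z * (T 1 2 w * symProd (h c) (T 1 2) W) - T 1 2 w * symProd (h c) (T 1 2) W * T 0 1 z =
      (g c w z * ∏ y ∈ W, f c y w) • (T 0 2 w * symProd (h c) (T 1 2) W * T 1 1 z -
        T 0 2 z * symProd (h c) (T 1 2) W * T 1 1 w) +
      ∑ j ∈ W, (g c j z * g c w j * h c j w * ∏ i ∈ W.erase j, g c i j) •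
        (T 0 2 j * T 1 2 w * symProd (h c) (T 1 2) (W.erase j) * T 1 1 z -
          T 0 2 z * T 1 2 w * symProd (h c) (T 1 2) (W.erase j) * T 1 1 j) := by
  have hstep : T 0 1 z * (T 1 2 w * symProd (h c) (T 1 2) W) =
      T 1 2 w * (T 0 1 z * symProd (h c) (T 1 2) W) +
      g c z w • (T 0 2 z * (T 1 1 w * symProd (h c) (T 1 2) W) -
        T 0 2 w * (T 1 1 z * symProd (h c) (T 1 2) W)) := by
    rw [← mul_assoc, hT.even_mul (i := 0) (j := 1) rfl rfl hzw]
    simp only [add_mul, sub_mul, smul_mul_assoc, mul_assoc]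
  have hsum := T23_mul_sum_T13_mul_sub hc hT hzw hzW hw hφ
  rw [hstep, eq_add_of_sub_eq hW, T22_mul_symProd_T23 hc hT hφ hw,
    T22_mul_symProd_T23 hc hT hφ hzW]
  simp only [mul_add, mul_smul_comm, ← mul_assoc (T _ _ _) (symProd _ _ _)]
  rw [g_swap c w z] at hsum ⊢
  linear_combination (norm := module) hsum

theorem T12_mul_symProd_T23_sub (hc : c ≠ 0) (hT : IsMonodromy c T) (hzV : z ∉ V)
    (hφ : NonvanishingOn (h c) V) :
    T 0 1 z * symProd (h c) (T 1 2) V - symProd (h c) (T 1 2) V * T 0 1 z =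
      ∑ j ∈ V, (g c j z * ∏ i ∈ V.erase j, g c i j) •
        (T 0 2 j * symProd (h c) (T 1 2) (V.erase j) * T 1 1 z -
          T 0 2 z * symProd (h c) (T 1 2) (V.erase j) * T 1 1 j) := by
  induction V using Finset.induction_on with
  | empty => simp
  | insert w W hw ih =>
    obtain ⟨hzw, hzW⟩ : z ≠ w ∧ z ∉ W := by simpa using hzV
    have h23 := hT.exchangeSymm_odd hc (i := 1) (j := 2) rfl rfl
    have hprod := hφ.prod_ne_zero hw
    have herase : ∀ j ∈ W, (∏ y ∈ W, h c y w) • symProd (h c) (T 1 2) ((insert w W).erase j) =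
        h c j w • (T 1 2 w * symProd (h c) (T 1 2) (W.erase j)) := fun j hj => by
      rw [Finset.erase_insert_of_ne (ne_of_mem_of_not_mem hj hw).symm,
        h23.mul_symProd (fun hmem => hw (Finset.mem_of_mem_erase hmem))
          (hφ.mono (Finset.insert_subset_insert _ (Finset.erase_subset _ _))),
        ← Finset.mul_prod_erase W _ hj, smul_smul]
    have hstep := T12_mul_T23_mul_symProd_T23 hc hT hzw hzW hw
      (hφ.mono (Finset.subset_insert _ _)) (ih hzW (hφ.mono (Finset.subset_insert _ _)))
    rw [h23.mul_symProd hw hφ] at hstep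
    have hg : ∀ j ∈ W, ∏ i ∈ (insert w W).erase j, g c i j = g c w j * ∏ i ∈ W.erase j, g c i j :=
      fun j hj => by
        rw [Finset.erase_insert_of_ne (ne_of_mem_of_not_mem hj hw).symm,
          Finset.prod_insert fun hmem => hw (Finset.mem_of_mem_erase hmem)]
    refine smul_right_injective A hprod ?_
    simp only [mul_smul_comm, smul_mul_assoc, ← smul_sub] at hstep
    simp only [Finset.sum_insert hw, Finset.erase_insert hw, smul_add, Finset.smul_sum]
    rw [hstep, ← prod_h_mul_prod_g hc]
    refine congrArg₂ (· + ·) (by module) (Finset.sum_congr rfl fun j hj => ?_)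
    have hleft := congrArg (T 0 2 j * · * T 1 1 z) (herase j hj)
    have hright := congrArg (T 0 2 z * · * T 1 1 j) (herase j hj)
    simp only [mul_smul_comm, smul_mul_assoc, ← mul_assoc] at hleft hright
    rw [hg j hj]
    linear_combination (norm := module) -(g c j z * (g c w j * ∏ i ∈ W.erase j, g c i j)) •
      (hleft - hright)

theorem recL_symProd_eq_recR_symProd (hc : c ≠ 0) (hT : IsMonodromy c T) (hzV : z ∉ V)
    (hφ : NonvanishingOn (h c) V) :
    recL c T ∅ (symProd (h c) (T 1 2)) z V = recR c T ∅ (symProd (h c) (T 1 2)) z V := by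
  simpa [recL, recR, recCoeff, smul_sub, sub_eq_sub_iff_add_eq_add, add_comm] using
    T12_mul_symProd_T23_sub hc hT hzV hφ

end SecondRow

section BetheOperator

variable {D : Set ℂ} {A : Type*} [Ring A] [Algebra ℂ A]

/-- The operator `X(U, V)` for two finite sets of variables; `β` is `v̄_α`, and the sum over `ū_α`
is inside `rowT13T12`. -/
def xOp (c : ℂ) (T : Fin 3 → Fin 3 → D → A) (U V : Finset D) : A :=
  ∑ β ∈ V.powerset, dprod (g c) (V \ β) β •
    (rowT13T12 c T U β * symProd (h c) (T 1 2) (V \ β) * symProd 1 (T 1 1) β)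

variable {c : ℂ} {T : Fin 3 → Fin 3 → D → A} {U V β : Finset D} {u z j : D}

theorem rowT13T12_empty : rowT13T12 c T ∅ β = if β = ∅ then 1 else 0 := by
  simp [rowT13T12, coeffT13T12, weightT13T12, Finset.card_eq_zero]

theorem xOp_empty : xOp c T ∅ V = symProd (h c) (T 1 2) V := by
  simp [xOp, rowT13T12_empty]

theorem sum_sum_powerset_erase {ι M : Type*} [DecidableEq ι] [AddCommMonoid M] (V : Finset ι)
    (F : Finset ι → ι → M) :
    ∑ y ∈ V, ∑ β ∈ (V.erase y).powerset, F β y = ∑ β ∈ V.powerset, ∑ y ∈ V \ β, F β y := by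
  refine Finset.sum_comm' fun y β => ?_
  simp only [Finset.mem_powerset, Finset.mem_sdiff, Finset.subset_erase]
  tauto

theorem erase_sdiff_erase_of_mem {ι : Type*} [DecidableEq ι] (V : Finset ι) {β : Finset ι} {j : ι}
    (hj : j ∈ β) : V.erase j \ β.erase j = V \ β := by grind

theorem sum_recCoeff_T13_mul_xOp_mul_T22 :
    ∑ j ∈ V, recCoeff c u U V j • (T 0 2 u * xOp c T U (V.erase j) * T 1 1 j) =
      ∑ β ∈ V.powerset, ∑ j ∈ β, (recCoeff c u U V j * dprod (g c) (V \ β) (β.erase j)) •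
        (T 0 2 u * rowT13T12 c T U (β.erase j) * symProd (h c) (T 1 2) (V \ β) *
          (symProd 1 (T 1 1) (β.erase j) * T 1 1 j)) := by
  simp only [xOp, Finset.mul_sum, Finset.sum_mul, Finset.smul_sum]
  rw [sum_sum_powerset_erase, sum_powerset_sdiff V fun j β => recCoeff c u U V j • (T 0 2 u *
    (dprod (g c) (V.erase j \ β) β • (rowT13T12 c T U β * symProd (h c) (T 1 2) (V.erase j \ β) *
      symProd 1 (T 1 1) β)) * T 1 1 j)]
  refine Finset.sum_congr rfl fun β _ => Finset.sum_congr rfl fun j hj => ?_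
  rw [erase_sdiff_erase_of_mem V hj]
  simp only [mul_smul_comm, smul_mul_assoc, smul_smul, mul_assoc]

theorem recCoeff_mul_dprod_g (hβ : β ⊆ V) (hj : j ∈ β) :
    recCoeff c u U V j * dprod (g c) (V \ β) (β.erase j) =
      dprod (g c) (V \ β) β * recCoeff c u U β j := by
  have hV : ∏ i ∈ V.erase j, g c i j = (∏ i ∈ V \ β, g c i j) * ∏ i ∈ β.erase j, g c i j := by
    rw [← Finset.prod_sdiff (Finset.erase_subset_erase j hβ), erase_sdiff_erase_of_mem V hj]
  have hdprod : dprod (g c) (V \ β) β =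
      (∏ i ∈ V \ β, g c i j) * dprod (g c) (V \ β) (β.erase j) := by
    rw [← dprod_insert_right _ _ (Finset.notMem_erase j β), Finset.insert_erase hj]
  rw [recCoeff, recCoeff, hV, hdprod]
  ring

theorem xOp_insert (hc : c ≠ 0) (hT : IsMonodromy c T) (hu : u ∉ U) (huV : u ∉ V)
    (hUV : Disjoint U V) (hφ : NonvanishingOn (h c) (insert u U)) :
    xOp c T (insert u U) V = recL c T U (xOp c T U) u V := by
  rw [recL, sum_recCoeff_T13_mul_xOp_mul_T22, xOp, xOp, Finset.mul_sum, ← Finset.sum_add_distrib]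
  refine Finset.sum_congr rfl fun β hβ => ?_
  have hβV := Finset.mem_powerset.1 hβ
  rw [rowT13T12_insert hc hT hφ hu (fun huβ => huV (hβV huβ)) (hUV.mono_right hβV)]
  simp only [add_mul, smul_add, Finset.sum_mul, Finset.smul_sum]
  refine congrArg₂ (· + ·) (by simp only [mul_smul_comm, mul_assoc])
    (Finset.sum_congr rfl fun j hj => ?_)
  rw [recCoeff_mul_dprod_g hβV hj,
    ← (hT.exchangeSymm_even (i := 1) (j := 1) rfl).symProd_one_insert_right
      (Finset.notMem_erase j β), Finset.insert_erase hj]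
  simp only [smul_mul_assoc, smul_smul, mul_assoc]

theorem recL_xOp_eq_recR_xOp (hc : c ≠ 0) (hT : IsMonodromy c T) (hU : NonvanishingOn (h c) U)
    (hV : NonvanishingOn (h c) V) (hUV : Disjoint U V) (hzU : z ∉ U) (hzV : z ∉ V) :
    recL c T U (xOp c T U) z V = recR c T U (xOp c T U) z V := by
  induction U using Finset.induction_on generalizing V z with
  | empty =>
    rw [recL_congr fun W _ => xOp_empty, recR_congr fun W _ => xOp_empty]
    exact recL_symProd_eq_recR_symProd hc hT hzV hV
  | insert p U hp ih =>
    rw [Finset.mem_insert, not_or] at hzU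
    obtain ⟨hzp, hzU⟩ := hzU
    obtain ⟨hpV, hUV⟩ := Finset.disjoint_insert_left.1 hUV
    have hX : ∀ W ⊆ V, xOp c T (insert p U) W = recL c T U (xOp c T U) p W := fun W hW =>
      xOp_insert hc hT hp (fun hpW => hpV (hW hpW)) (hUV.mono_right hW) hU
    have hUφ := hU.mono (Finset.subset_insert p U)
    rw [recL_congr hX, recR_congr hX, recL_recL_comm hc hT hzU hp hzp hzV hpV,
      recL_congr fun W hW => ih hUφ (hV.mono hW) (hUV.mono_right hW) hzU fun hzW => hzV (hW hzW)]
    exact recL_recR_eq_recR_recL hT hzU hp hzV hpV fun k hk =>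
      ih hUφ (hV.mono (Finset.erase_subset _ _)) (hUV.mono_right (Finset.erase_subset _ _))
        (Finset.disjoint_right.1 hUV hk) (Finset.notMem_erase _ _)

end BetheOperator

section DomainWallPartitionFunction

/-- The product of the `g(x_j, x_k)` over all pairs `j < k`. -/
def gProd (c : ℂ) {n : ℕ} (x : Fin n → ℂ) : ℂ := ∏ j, ∏ k ∈ Finset.Ioi j, g c (x j) (x k)

/-- The matrix whose determinant enters the definition of `K`. -/
def gDivHMatrix (c : ℂ) {n : ℕ} (x y : Fin n → ℂ) : Matrix (Fin n) (Fin n) ℂ :=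
  Matrix.of fun j k => g c (x j) (y k) / h c (x j) (y k)

variable {c : ℂ} {n : ℕ}

theorem g_neg (c x y : ℂ) : g (-c) x y = g c y x := by
  rw [g, g, ← neg_sub y x, neg_div_neg_eq]

theorem K_eq_gProd (c : ℂ) (x y : Fin n → ℂ) :
    K c x y = gProd c x * gProd (-c) y * (∏ j, ∏ k, h c (x j) (y k)) * (gDivHMatrix c x y).det := by
  have hy : ∏ j, ∏ k ∈ Finset.Iio j, g c (y j) (y k) = gProd (-c) y := by
    simp only [gProd, g_neg]
    exact Finset.prod_comm' fun j k => by simp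
  rw [K, hy]
  rfl

theorem gProd_eq_div_det_vandermonde (c : ℂ) (x : Fin n → ℂ) :
    gProd c x = (∏ j : Fin n, ∏ _k ∈ Finset.Ioi j, -c) / (Matrix.vandermonde x).det := by
  simp only [gProd, Matrix.det_vandermonde, ← Finset.prod_div_distrib]
  refine Finset.prod_congr rfl fun j _ => Finset.prod_congr rfl fun k _ => ?_
  rw [g, ← neg_sub (x k), div_neg, neg_div]

theorem gProd_comp_perm (c : ℂ) (x : Fin n → ℂ) (σ : Equiv.Perm (Fin n)) :
    gProd c (x ∘ σ) = ((Equiv.Perm.sign σ : ℤ) : ℂ) * gProd c x := by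
  have hv : Matrix.vandermonde (x ∘ σ) = (Matrix.vandermonde x).submatrix σ id := rfl
  rw [gProd_eq_div_det_vandermonde, gProd_eq_div_det_vandermonde, hv, Matrix.det_permute]
  rcases Int.units_eq_one_or (Equiv.Perm.sign σ) with hσ | hσ <;> simp [hσ, div_neg]

theorem K_comp_perm_left (c : ℂ) (x y : Fin n → ℂ) (σ : Equiv.Perm (Fin n)) :
    K c (x ∘ σ) y = K c x y := by
  have hM : gDivHMatrix c (x ∘ σ) y = (gDivHMatrix c x y).submatrix σ id := rfl
  rw [K_eq_gProd, K_eq_gProd, gProd_comp_perm, hM, Matrix.det_permute]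
  simp only [Function.comp_apply, Equiv.prod_comp σ fun j => ∏ k, h c (x j) (y k)]
  rcases Int.units_eq_one_or (Equiv.Perm.sign σ) with hσ | hσ <;> simp [hσ]

theorem K_comp_perm_right (c : ℂ) (x y : Fin n → ℂ) (σ : Equiv.Perm (Fin n)) :
    K c x (y ∘ σ) = K c x y := by
  have hM : gDivHMatrix c x (y ∘ σ) = (gDivHMatrix c x y).submatrix id σ := rfl
  rw [K_eq_gProd, K_eq_gProd, gProd_comp_perm, hM, Matrix.det_permute']
  simp only [Function.comp_apply, fun j => Equiv.prod_comp σ fun k => h c (x j) (y k)]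
  rcases Int.units_eq_one_or (Equiv.Perm.sign σ) with hσ | hσ <;> simp [hσ]

theorem gProd_succ (c : ℂ) (x : Fin (n + 1) → ℂ) :
    gProd c x = (∏ i : Fin n, g c (x 0) (x i.succ)) * gProd c (x ∘ Fin.succ) := by
  simp [gProd, Fin.prod_univ_succ]

theorem gProd_eq_succAbove (c : ℂ) (x : Fin (n + 1) → ℂ) (j : Fin (n + 1)) :
    gProd c x = (-1) ^ (j : ℕ) * (∏ i, g c (x j) (x (j.succAbove i))) *
      gProd c (x ∘ j.succAbove) := by
  have hperm := gProd_comp_perm c x j.cycleRange.symm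
  have hsucc : (x ∘ j.cycleRange.symm) ∘ Fin.succ = x ∘ j.succAbove := by ext; simp
  rw [gProd_succ, hsucc, Equiv.Perm.sign_symm, Fin.sign_cycleRange] at hperm
  push_cast at hperm
  simp only [Function.comp_apply, Fin.cycleRange_symm_zero, Fin.cycleRange_symm_succ] at hperm
  rw [mul_assoc, hperm, ← mul_assoc, ← mul_pow, neg_one_mul, neg_neg, one_pow, one_mul]

theorem univ_erase_eq_map_succAboveEmb (j : Fin (n + 1)) :
    Finset.univ.erase j = Finset.univ.map j.succAboveEmb := by
  rw [Fin.univ_succAbove n j, Finset.erase_cons]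

/-- The weights do not depend on `j`: this evaluates a combination of columns of `gDivHMatrix`. -/
theorem sum_prod_h_mul_prod_g_mul_g_div_h {x Y : Fin (n + 1) → ℂ} (hY : Function.Injective Y)
    {j : Fin (n + 1)} (hxY : ∀ k, Y k ≠ x j) (hh : ∀ k, h c (x j) (Y k) ≠ 0) :
    ∑ k, (∏ i, h c (x i) (Y k)) * (∏ l ∈ Finset.univ.erase k, g c (Y l) (Y k)) *
        gDivHMatrix c x Y j k =
      -((∏ i, h c (x (j.succAbove i)) (x j)) * ∏ k, g c (Y k) (x j)) := by
  have hdeg : (∏ i : Fin n, hPolySnd c (x (j.succAbove i))).natDegree <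
      (Finset.univ : Finset (Fin (n + 1))).card :=
    (natDegree_prod_le_card fun _ _ => natDegree_hPolySnd_le _ _).trans_lt (by simp)
  have hlagrange := eval_mul_prod_g c hY.injOn hdeg fun k _ => hxY k
  simp only [Polynomial.eval_prod, eval_hPolySnd] at hlagrange
  rw [hlagrange, ← Finset.sum_neg_distrib]
  refine Finset.sum_congr rfl fun k _ => ?_
  have hjk := hh k
  rw [Fin.prod_univ_succAbove _ j, g_swap c (Y k) (x j), gDivHMatrix, Matrix.of_apply]
  field_simp

theorem prod_mul_det_gDivHMatrix_succ {x Y : Fin (n + 1) → ℂ} (hY : Function.Injective Y)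
    (hxY : ∀ j k, Y k ≠ x j) (hh : ∀ j k, h c (x j) (Y k) ≠ 0) :
    (∏ i, h c (x i) (Y 0)) * (∏ k : Fin n, g c (Y k.succ) (Y 0)) * (gDivHMatrix c x Y).det =
      ∑ j : Fin (n + 1), (-1) ^ (j : ℕ) *
        -((∏ i, h c (x (j.succAbove i)) (x j)) * ∏ k, g c (Y k) (x j)) *
        (gDivHMatrix c (x ∘ j.succAbove) (Y ∘ Fin.succ)).det := by
  have hdet := Matrix.det_updateCol_sum (gDivHMatrix c x Y) 0 fun k =>
    (∏ i, h c (x i) (Y k)) * ∏ l ∈ Finset.univ.erase k, g c (Y l) (Y k)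
  simp only [smul_eq_mul, univ_erase_eq_map_succAboveEmb 0, Finset.prod_map, Fin.succAboveEmb_apply,
    Fin.zero_succAbove] at hdet
  rw [← hdet, Matrix.det_succ_column_zero]
  refine Finset.sum_congr rfl fun j _ => ?_
  rw [Matrix.updateCol_self, sum_prod_h_mul_prod_g_mul_g_div_h hY (hxY j) (hh j)]
  congr 2

theorem K_succ (hc : c ≠ 0) {x Y : Fin (n + 1) → ℂ} (hY : Function.Injective Y)
    (hxY : ∀ j k, Y k ≠ x j) (hh : ∀ j k, h c (x j) (Y k) ≠ 0) :
    K c x Y = ∑ j : Fin (n + 1), g c (x j) (Y 0) * (∏ i, f c (x (j.succAbove i)) (x j)) *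
      (∏ k : Fin n, f c (x j) (Y k.succ)) * K c (x ∘ j.succAbove) (Y ∘ Fin.succ) := by
  have hh_succ : ∏ i, ∏ k, h c (x i) (Y k) =
      (∏ i, h c (x i) (Y 0)) * ∏ i, ∏ k : Fin n, h c (x i) (Y k.succ) := by
    rw [← Finset.prod_mul_distrib]
    exact Finset.prod_congr rfl fun i _ => Fin.prod_univ_succ _
  have hK : K c x Y = gProd c x * gProd (-c) (Y ∘ Fin.succ) *
      (∏ i, ∏ k : Fin n, h c (x i) (Y k.succ)) * ((∏ i, h c (x i) (Y 0)) *
        (∏ k : Fin n, g c (Y k.succ) (Y 0)) * (gDivHMatrix c x Y).det) := by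
    rw [K_eq_gProd, hh_succ, gProd_succ (-c) Y]
    simp only [g_neg]
    ring
  rw [hK, prod_mul_det_gDivHMatrix_succ hY hxY hh, Finset.mul_sum]
  refine Finset.sum_congr rfl fun j _ => ?_
  have hswap : (∏ i, g c (x j) (x (j.succAbove i))) * ∏ k : Fin n, g c (Y k.succ) (x j) =
      (∏ i, g c (x (j.succAbove i)) (x j)) * ∏ k : Fin n, g c (x j) (Y k.succ) := by
    rw [← Finset.prod_mul_distrib, ← Finset.prod_mul_distrib]
    exact Finset.prod_congr rfl fun i _ => by
      rw [g_swap c (x j), g_swap c (Y i.succ), neg_mul_neg]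
  have hsign : ((-1 : ℂ) ^ (j : ℕ)) * (-1) ^ (j : ℕ) = 1 := by rw [← mul_pow]; simp
  rw [gProd_eq_succAbove c x j, K_eq_gProd, Fin.prod_univ_succ fun k => g c (Y k) (x j),
    Fin.prod_univ_succAbove _ j, g_swap c (Y 0)]
  simp only [f_eq_g_mul_h hc, Finset.prod_mul_distrib, Function.comp_apply]
  linear_combination (g c (x j) (Y 0) * (∏ i, h c (x (j.succAbove i)) (x j)) *
    (∏ k : Fin n, h c (x j) (Y k.succ)) * gProd c (x ∘ j.succAbove) * gProd (-c) (Y ∘ Fin.succ) *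
    (∏ i, ∏ k : Fin n, h c (x (j.succAbove i)) (Y k.succ)) *
    (gDivHMatrix c (x ∘ j.succAbove) (Y ∘ Fin.succ)).det) *
    ((∏ i, g c (x j) (x (j.succAbove i))) * (∏ k : Fin n, g c (Y k.succ) (x j)) * hsign + hswap)

end DomainWallPartitionFunction

section DomainWallPartitionFunctionOfSets

variable {D : Set ℂ} {c : ℂ} {n : ℕ} {β α : Finset D} {y : D}

/-- An arbitrary enumeration of a set of `n` variables. -/
def enum (S : Finset D) (hS : S.card = n) : Fin n ↪ D :=
  (S.equivFinOfCardEq hS).symm.toEmbedding.trans (Function.Embedding.subtype _)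

theorem map_enum {S : Finset D} (hS : S.card = n) : Finset.univ.map (enum S hS) = S := by
  rw [enum, ← Finset.map_map, Finset.map_univ_equiv, Finset.univ_eq_attach,
    Finset.attach_map_val]

/-- The domain wall partition function of two finite sets; it is `0` if their numbers of elements
differ. -/
def setK (c : ℂ) (β α : Finset D) : ℂ :=
  if hβα : α.card = β.card then
    K c (fun j => (enum β rfl j : ℂ)) (fun j => (enum α hβα j : ℂ))
  else 0

theorem setK_of_card_ne (c : ℂ) (hβα : α.card ≠ β.card) : setK c β α = 0 := dif_neg hβα

theorem exists_perm_comp_eq {ι κ : Type*} [Fintype ι] {x y : ι ↪ κ}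
    (hxy : Finset.univ.map x = Finset.univ.map y) : ∃ σ : Equiv.Perm ι, x ∘ σ = y := by
  have hrange : Set.range x = Set.range y := by simpa using congrArg ((↑) : Finset κ → Set κ) hxy
  exact ⟨(Equiv.ofInjective y y.injective).trans
    ((Equiv.setCongr hrange.symm).trans (Equiv.ofInjective x x.injective).symm),
    funext fun _ => by simp [Equiv.apply_ofInjective_symm]⟩

theorem setK_map (c : ℂ) (x y : Fin n ↪ D) :
    setK c (Finset.univ.map x) (Finset.univ.map y) =
      K c (fun j => (x j : ℂ)) (fun j => (y j : ℂ)) := by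
  generalize hβ : Finset.univ.map x = β
  generalize hα : Finset.univ.map y = α
  obtain rfl : β.card = n := by rw [← hβ, Finset.card_map, Finset.card_univ, Fintype.card_fin]
  have hcard : α.card = β.card := by
    rw [← hα, Finset.card_map, Finset.card_univ, Fintype.card_fin]
  obtain ⟨σ, hσ⟩ := exists_perm_comp_eq ((map_enum rfl).trans hβ.symm)
  obtain ⟨τ, hτ⟩ := exists_perm_comp_eq ((map_enum hcard).trans hα.symm)
  rw [setK, dif_pos hcard, ← hσ, ← hτ, ← K_comp_perm_left c _ _ σ, ← K_comp_perm_right c _ _ τ]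
  rfl

@[simp] theorem setK_empty (c : ℂ) : setK c (∅ : Finset D) ∅ = 1 := by
  simpa [K] using setK_map c (Function.Embedding.ofIsEmpty : Fin 0 ↪ D)
    (Function.Embedding.ofIsEmpty : Fin 0 ↪ D)

theorem map_univ_erase (x : Fin (n + 1) ↪ D) (j : Fin (n + 1)) :
    (Finset.univ.map x).erase (x j) = Finset.univ.map (j.succAboveEmb.trans x) := by
  rw [← Finset.map_erase, univ_erase_eq_map_succAboveEmb, Finset.map_map]

theorem map_univ_cons (x : Fin n ↪ D) (hy : y ∉ Set.range x) :
    Finset.univ.map (Fin.Embedding.cons x hy) = insert y (Finset.univ.map x) := by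
  ext d
  simp [Fin.exists_fin_succ, eq_comm]

theorem setK_insert_of_card_eq (hc : c ≠ 0) (hyα : y ∉ α) (hyβ : y ∉ β) (hβα : Disjoint β α)
    (hh : ∀ x ∈ β, ∀ z ∈ insert y α, h c x z ≠ 0) (hcard : β.card = α.card + 1) :
    setK c β (insert y α) = ∑ j ∈ β, g c j y * (∏ i ∈ β.erase j, f c i j) *
      (∏ s ∈ α, f c j s) * setK c (β.erase j) α := by
  obtain ⟨m, hm⟩ : ∃ m, α.card = m := ⟨_, rfl⟩
  obtain ⟨x, rfl⟩ : ∃ x : Fin (m + 1) ↪ D, Finset.univ.map x = β := ⟨_, map_enum (hm ▸ hcard)⟩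
  obtain ⟨z, rfl⟩ : ∃ z : Fin m ↪ D, Finset.univ.map z = α := ⟨_, map_enum hm⟩
  have hmem : ∀ {m} (w : Fin m ↪ D) j, w j ∈ Finset.univ.map w := fun w j =>
    Finset.mem_map_of_mem w (Finset.mem_univ j)
  have hy : y ∉ Set.range z := fun ⟨k, hk⟩ => hyα (hk ▸ hmem z k)
  have hdisj := Finset.disjoint_insert_left.2 ⟨hyβ, hβα.symm⟩
  rw [← map_univ_cons z hy] at hdisj hh ⊢
  rw [setK_map, K_succ hc (Y := fun k => (Fin.Embedding.cons z hy k : ℂ))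
    (Subtype.val_injective.comp (Fin.Embedding.cons z hy).injective)
    (fun j k => coe_ne_coe (hdisj.forall_ne_finset (hmem _ k) (hmem _ j)))
    (fun j k => hh _ (hmem _ j) _ (hmem _ k)), Finset.sum_map]
  refine Finset.sum_congr rfl fun j _ => ?_
  rw [map_univ_erase, setK_map, Finset.prod_map, Finset.prod_map]
  rfl

theorem setK_insert (hc : c ≠ 0) (hyα : y ∉ α) (hyβ : y ∉ β) (hβα : Disjoint β α)
    (hh : ∀ x ∈ β, ∀ z ∈ insert y α, h c x z ≠ 0) :
    setK c β (insert y α) = ∑ j ∈ β, g c j y * (∏ i ∈ β.erase j, f c i j) *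
      (∏ s ∈ α, f c j s) * setK c (β.erase j) α := by
  by_cases hcard : β.card = α.card + 1
  · exact setK_insert_of_card_eq hc hyα hyβ hβα hh hcard
  · rw [setK_of_card_ne c fun hne => hcard (by rw [← hne, Finset.card_insert_of_notMem hyα]),
      Finset.sum_eq_zero fun j hj => ?_]
    rw [setK_of_card_ne c fun hne => hcard ((card_erase_eq_iff hj).1 hne.symm), mul_zero]

end DomainWallPartitionFunctionOfSets

section Erase

variable {ι : Type*} [DecidableEq ι] {V β : Finset ι} {j x : ι}

theorem erase_sdiff_erase_of_notMem (hβ : β ⊆ V) (hj : j ∈ V \ β) (hx : x ∈ β) :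
    V.erase j \ β.erase x = insert x ((V \ β).erase j) := by
  have := hβ hx
  grind

theorem insert_erase_sdiff_erase (hβ : β ⊆ V) (hj : j ∈ V \ β) (hx : x ∈ β) :
    insert j ((V.erase j \ β.erase x).erase x) = V \ β := by
  have := hβ hx
  grind

end Erase

section ReversedOrdering

variable {D : Set ℂ} {A : Type*} [Ring A] [Algebra ℂ A]

/-- The weight of `𝕋₂₃(V∖β) 𝕋₁₃(β) T₁₂(U∖α) T₂₂(α)` in `revOp`. -/
def revCoeff (c : ℂ) (U V β α : Finset D) : ℂ :=
  setK c β α * dprod (f c) α (U \ α) * dprod (g c) β (V \ β) * dprod (f c) (V \ β) α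

/-- The ordered product `𝕋₂₃(S) 𝕋₁₃(β) T₁₂(R) T₂₂(α)`. -/
def revWord (c : ℂ) (T : Fin 3 → Fin 3 → D → A) (S β R α : Finset D) : A :=
  symProd (h c) (T 1 2) S * symProd (h c) (T 0 2) β * symProd 1 (T 0 1) R * symProd 1 (T 1 1) α

/-- The expansion of `X(U, V)` in products ordered as `T₂₃`, `T₁₃`, `T₁₂`, `T₂₂`. -/
def revOp (c : ℂ) (T : Fin 3 → Fin 3 → D → A) (U V : Finset D) : A :=
  ∑ α ∈ U.powerset, ∑ β ∈ V.powerset, revCoeff c U V β α • revWord c T (V \ β) β (U \ α) α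

/-- The coefficient with which `T₁₃(j)` passes through `𝕋₂₃(S)` and joins `𝕋₁₃(β)`. -/
def passCoeff (c : ℂ) (S β : Finset D) (j : D) : ℂ :=
  (-1) ^ S.card * (∏ y ∈ S, f c y j) * ∏ y ∈ β, h c y j

/-- The coefficient with which `T₁₃(j)` exchanges its argument with the factor `T₂₃(s)` of
`𝕋₂₃(S)` before it joins `𝕋₁₃(β)`. -/
def swapCoeff (c : ℂ) (S β : Finset D) (j s : D) : ℂ :=
  (-1) ^ S.card * (g c j s * ∏ y ∈ S.erase s, g c y s) * (∏ y ∈ S.erase s, h c y j) *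
    ∏ y ∈ β, h c y s

/-- The common factor of the summands, indexed by `x ∈ β`, of the expansions of `revCoeff`. -/
def revBase (c : ℂ) (U V β α : Finset D) (x : D) : ℂ :=
  dprod (f c) α (U \ α) * dprod (g c) β (V \ β) * dprod (f c) (V \ β) α *
    ((∏ i ∈ β.erase x, f c i x) * (∏ s ∈ α, f c x s) * setK c (β.erase x) α)

variable {c : ℂ} {T : Fin 3 → Fin 3 → D → A} {U V S R β α : Finset D} {q j s x : D}

theorem prod_g_swap (c : ℂ) (S : Finset D) (x : D) :
    ∏ y ∈ S, g c x y = (-1) ^ S.card * ∏ y ∈ S, g c y x := by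
  rw [← Finset.prod_neg]
  exact Finset.prod_congr rfl fun y _ => g_swap c x y

theorem revOp_empty : revOp c T ∅ V = symProd (h c) (T 1 2) V := by
  rw [revOp, Finset.powerset_empty, Finset.sum_singleton, Finset.sum_eq_single ∅]
  · simp [revCoeff, revWord]
  · intro β _ hβ
    rw [revCoeff, setK_of_card_ne c (by simpa [eq_comm] using hβ)]
    simp
  · exact fun hV => absurd (Finset.empty_mem_powerset V) hV

theorem revWord_mul_T12 (hT : IsMonodromy c T) (hqR : q ∉ R) (hqα : q ∉ α)
    (hRα : Disjoint R α) :
    revWord c T S β R α * T 0 1 q = (∏ y ∈ α, f c y q) • revWord c T S β (insert q R) α +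
      ∑ s ∈ α, (g c q s * ∏ y ∈ α.erase s, f c y s) •
        revWord c T S β (insert s R) (insert q (α.erase s)) := by
  have hT12 := hT.exchangeSymm_even (i := 0) (j := 1) rfl
  have hT22 := hT.exchangeSymm_even (i := 1) (j := 1) rfl
  rw [revWord, mul_assoc, symProd_one_mul hT22
    (fun _ _ => hT.col_exchange_even (i := 1) (k := 0) (l := 1) rfl rfl rfl) hqα, mul_add,
    Finset.mul_sum]
  refine congrArg₂ (· + ·) ?_ (Finset.sum_congr rfl fun s hs => ?_)
  · rw [revWord, hT12.symProd_one_insert_right hqR]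
    simp only [mul_smul_comm, mul_assoc]
  · rw [revWord, hT12.symProd_one_insert_right (Finset.disjoint_right.1 hRα hs),
      hT22.symProd_one_insert fun hmem => hqα (Finset.mem_of_mem_erase hmem)]
    simp only [mul_smul_comm, mul_assoc]

theorem revOp_mul_T12 (hT : IsMonodromy c T) (hq : q ∉ U) :
    revOp c T U V * T 0 1 q = (∑ α ∈ U.powerset, ∑ β ∈ V.powerset,
        (revCoeff c U V β α * ∏ y ∈ α, f c y q) •
          revWord c T (V \ β) β (insert q (U \ α)) α) +
      ∑ α ∈ U.powerset, ∑ β ∈ V.powerset,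
        (∑ s ∈ U \ α, revCoeff c U V β (insert s α) * (g c q s * ∏ y ∈ α, f c y s)) •
          revWord c T (V \ β) β (U \ α) (insert q α) := by
  have hreindex : ∑ α ∈ U.powerset, ∑ β ∈ V.powerset,
        (∑ s ∈ U \ α, revCoeff c U V β (insert s α) * (g c q s * ∏ y ∈ α, f c y s)) •
          revWord c T (V \ β) β (U \ α) (insert q α) =
      ∑ α ∈ U.powerset, ∑ β ∈ V.powerset, ∑ s ∈ α,
        (revCoeff c U V β α * (g c q s * ∏ y ∈ α.erase s, f c y s)) •
          revWord c T (V \ β) β (insert s (U \ α)) (insert q (α.erase s)) := by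
    rw [Finset.sum_comm, Finset.sum_comm (s := U.powerset)]
    refine Finset.sum_congr rfl fun β _ => ?_
    simp only [Finset.sum_smul]
    rw [sum_powerset_sdiff U fun s α => (revCoeff c U V β (insert s α) *
      (g c q s * ∏ y ∈ α, f c y s)) • revWord c T (V \ β) β (U \ α) (insert q α)]
    refine Finset.sum_congr rfl fun α hα => Finset.sum_congr rfl fun s hs => ?_
    rw [Finset.insert_erase hs, Finset.sdiff_erase (Finset.mem_powerset.1 hα hs)]
  rw [hreindex, ← Finset.sum_add_distrib, revOp, Finset.sum_mul]
  refine Finset.sum_congr rfl fun α hα => ?_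
  have hqα : q ∉ α := fun hmem => hq (Finset.mem_powerset.1 hα hmem)
  rw [← Finset.sum_add_distrib, Finset.sum_mul]
  refine Finset.sum_congr rfl fun β _ => ?_
  rw [smul_mul_assoc, revWord_mul_T12 hT (fun hmem => hq (Finset.mem_sdiff.1 hmem).1) hqα
    Finset.sdiff_disjoint, smul_add, smul_smul, Finset.smul_sum]
  simp only [smul_smul]

theorem T13_mul_symProd_T23_mul_symProd_T13 (hc : c ≠ 0) (hT : IsMonodromy c T) (hj : j ∉ S)
    (hjβ : j ∉ β) (hSβ : Disjoint S β) (hφ : NonvanishingOn (h c) (insert j (S ∪ β))) :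
    T 0 2 j * (symProd (h c) (T 1 2) S * symProd (h c) (T 0 2) β) =
      passCoeff c S β j • (symProd (h c) (T 1 2) S * symProd (h c) (T 0 2) (insert j β)) +
        ∑ s ∈ S, swapCoeff c S β j s • (symProd (h c) (T 1 2) (insert j (S.erase s)) *
          symProd (h c) (T 0 2) (insert s β)) := by
  have hT13 := hT.exchangeSymm_odd hc (i := 0) (j := 2) rfl rfl
  have hT23 := hT.exchangeSymm_odd hc (i := 1) (j := 2) rfl rfl
  have hS : S ⊆ insert j (S ∪ β) := Finset.subset_union_left.trans (Finset.subset_insert _ _)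
  have hjβ_sub : insert j β ⊆ insert j (S ∪ β) :=
    Finset.insert_subset_insert _ Finset.subset_union_right
  rw [← mul_assoc, mul_symProd_h hc (a := T 0 2) (b := T 1 2) (ε := -1) hT23
    (fun x y hxy => by
      rw [neg_one_smul]; exact hT.col_exchange_odd (i := 0) (k := 1) (l := 2) rfl rfl rfl hxy)
    (hφ.mono hS) hj, smul_mul_assoc, add_mul, smul_add, smul_mul_assoc, mul_assoc,
    hT13.mul_symProd hjβ (hφ.mono hjβ_sub), Finset.sum_mul, Finset.smul_sum]
  refine congrArg₂ (· + ·) ?_ (Finset.sum_congr rfl fun s hs => ?_)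
  · rw [passCoeff, mul_smul_comm, smul_smul, smul_smul]
  · have hjS : insert j (S.erase s) ⊆ insert j (S ∪ β) := Finset.insert_subset_insert _
      ((Finset.erase_subset _ _).trans Finset.subset_union_left)
    have hsβ : insert s β ⊆ insert j (S ∪ β) :=
      Finset.insert_subset (hS hs) ((Finset.subset_insert _ _).trans hjβ_sub)
    rw [hT23.mul_symProd (fun hmem => hj (Finset.mem_of_mem_erase hmem)) (hφ.mono hjS),
      smul_mul_assoc, mul_assoc, smul_mul_assoc, smul_smul,
      hT13.mul_symProd (Finset.disjoint_left.1 hSβ hs) (hφ.mono hsβ), mul_smul_comm, smul_smul,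
      smul_smul, swapCoeff]

theorem T13_mul_revWord_mul_T22 (hc : c ≠ 0) (hT : IsMonodromy c T) (hj : j ∉ S)
    (hjβ : j ∉ β) (hSβ : Disjoint S β) (hφ : NonvanishingOn (h c) (insert j (S ∪ β)))
    (hqα : q ∉ α) :
    T 0 2 j * revWord c T S β R α * T 1 1 q =
      passCoeff c S β j • revWord c T S (insert j β) R (insert q α) +
        ∑ s ∈ S, swapCoeff c S β j s •
          revWord c T (insert j (S.erase s)) (insert s β) R (insert q α) := by
  have hT22 := hT.exchangeSymm_even (i := 1) (j := 1) rfl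
  have hexch := congrArg (· * (symProd 1 (T 0 1) R * symProd 1 (T 1 1) (insert q α)))
    (T13_mul_symProd_T23_mul_symProd_T13 hc hT hj hjβ hSβ hφ)
  simp only [add_mul, Finset.sum_mul, smul_mul_assoc] at hexch
  simp only [revWord, hT22.symProd_one_insert_right hqα, mul_assoc] at hexch ⊢
  exact hexch

theorem sum_recCoeff_T13_mul_revOp_mul_T22 (hc : c ≠ 0) (hT : IsMonodromy c T) (hq : q ∉ U)
    (hφ : NonvanishingOn (h c) V) :
    ∑ j ∈ V, recCoeff c q U V j • (T 0 2 j * revOp c T U (V.erase j) * T 1 1 q) =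
      ∑ α ∈ U.powerset, ∑ β ∈ V.powerset,
        ((∑ j ∈ β, recCoeff c q U V j * revCoeff c U (V.erase j) (β.erase j) α *
          passCoeff c (V \ β) (β.erase j) j) +
        ∑ j ∈ V \ β, ∑ x ∈ β, recCoeff c q U V j * revCoeff c U (V.erase j) (β.erase x) α *
          swapCoeff c (V.erase j \ β.erase x) (β.erase x) j x) •
            revWord c T (V \ β) β (U \ α) (insert q α) := by
  have hword : ∀ α ∈ U.powerset, ∀ j ∈ V, ∀ β ∈ (V.erase j).powerset,
      T 0 2 j * revWord c T (V.erase j \ β) β (U \ α) α * T 1 1 q =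
        passCoeff c (V.erase j \ β) β j •
            revWord c T (V.erase j \ β) (insert j β) (U \ α) (insert q α) +
          ∑ s ∈ V.erase j \ β, swapCoeff c (V.erase j \ β) β j s •
            revWord c T (insert j ((V.erase j \ β).erase s)) (insert s β) (U \ α) (insert q α) :=
    fun α hα j hj β hβ => by
      have hjβ : j ∉ β := fun hmem => Finset.notMem_erase _ _ (Finset.mem_powerset.1 hβ hmem)
      refine T13_mul_revWord_mul_T22 hc hT
        (fun hmem => Finset.notMem_erase _ _ (Finset.mem_sdiff.1 hmem).1) hjβ
        Finset.sdiff_disjoint ?_ fun hmem => hq (Finset.mem_powerset.1 hα hmem)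
      rwa [Finset.sdiff_union_of_subset (Finset.mem_powerset.1 hβ), Finset.insert_erase hj]
  simp only [revOp, Finset.mul_sum, Finset.sum_mul, Finset.smul_sum]
  rw [Finset.sum_comm]
  refine Finset.sum_congr rfl fun α hα => ?_
  simp only [mul_smul_comm, smul_mul_assoc, smul_smul]
  rw [Finset.sum_congr rfl fun j hj => Finset.sum_congr rfl fun β hβ => by
    rw [hword α hα j hj β hβ]]
  simp only [smul_add, Finset.smul_sum, smul_smul, Finset.sum_add_distrib, add_smul,
    Finset.sum_smul]
  refine congrArg₂ (· + ·) ?_ ?_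
  · rw [sum_sum_powerset_erase, sum_powerset_sdiff]
    refine Finset.sum_congr rfl fun β _ => Finset.sum_congr rfl fun j hj => ?_
    rw [erase_sdiff_erase_of_mem V hj, Finset.insert_erase hj]
  · rw [Finset.sum_congr rfl fun j _ => sum_powerset_sdiff (V.erase j) _, sum_sum_powerset_erase]
    refine Finset.sum_congr rfl fun β hβ => Finset.sum_congr rfl fun j hj =>
      Finset.sum_congr rfl fun x hx => ?_
    rw [Finset.insert_erase hx, insert_erase_sdiff_erase (Finset.mem_powerset.1 hβ) hj hx]

theorem revCoeff_insert_insert_eq_sum (hc : c ≠ 0) (hq : q ∉ U) (hqV : q ∉ V) (hUV : Disjoint U V)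
    (hα : α ⊆ U) (hβ : β ⊆ V) (hh : ∀ x ∈ V, ∀ z ∈ insert q U, h c x z ≠ 0) :
    revCoeff c (insert q U) V β (insert q α) = ∑ x ∈ β, revBase c U V β α x *
      (g c x q * (∏ s ∈ U \ α, f c q s) * ∏ z ∈ V \ β, f c z q) := by
  have hqα : q ∉ α := fun hmem => hq (hα hmem)
  rw [revCoeff, setK_insert hc hqα (fun hmem => hqV (hβ hmem)) (hUV.symm.mono hβ hα)
      fun x hx z hz => hh x (hβ hx) z (Finset.insert_subset_insert _ hα hz),
    Finset.insert_sdiff_insert, Finset.sdiff_insert_of_notMem hq, dprod_insert_left _ hqα,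
    dprod_insert_right _ _ hqα, Finset.sum_mul, Finset.sum_mul, Finset.sum_mul]
  refine Finset.sum_congr rfl fun x _ => ?_
  rw [revBase]
  ring

theorem revCoeff_insert_mul_prod_f (hc : c ≠ 0) (hUV : Disjoint U V) (hα : α ⊆ U) (hβ : β ⊆ V)
    (hh : ∀ x ∈ V, ∀ z ∈ U, h c x z ≠ 0) (hs : s ∈ U \ α) :
    revCoeff c U V β (insert s α) * ∏ y ∈ α, f c y s = ∑ x ∈ β, revBase c U V β α x *
      ((∏ s' ∈ (U \ α).erase s, f c s s') * (∏ z ∈ V \ β, f c z s) * g c x s) := by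
  obtain ⟨hsU, hsα⟩ := Finset.mem_sdiff.1 hs
  have hαU : dprod (f c) α (U \ α) =
      (∏ y ∈ α, f c y s) * dprod (f c) α ((U \ α).erase s) := by
    rw [← dprod_insert_right _ _ (Finset.notMem_erase _ _), Finset.insert_erase hs]
  rw [revCoeff, setK_insert hc hsα (fun hmem => Finset.disjoint_left.1 hUV hsU (hβ hmem))
      (hUV.symm.mono hβ hα) fun x hx z hz => hh x (hβ hx) z (Finset.insert_subset hsU hα hz),
    Finset.sdiff_insert, dprod_insert_left _ hsα, dprod_insert_right _ _ hsα]
  simp only [Finset.sum_mul, revBase, hαU]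
  exact Finset.sum_congr rfl fun x _ => by ring

theorem recCoeff_mul_revCoeff_mul_passCoeff (hc : c ≠ 0) (hα : α ⊆ U) (hβ : β ⊆ V) (hj : j ∈ β) :
    recCoeff c q U V j * revCoeff c U (V.erase j) (β.erase j) α *
        passCoeff c (V \ β) (β.erase j) j =
      revBase c U V β α j *
        (g c j q * ((∏ s ∈ U \ α, f c j s) * ∏ z ∈ V \ β, f c z j)) := by
  have hdiff := erase_sdiff_erase_of_mem V hj
  have hV : ∏ i ∈ V.erase j, g c i j = (∏ i ∈ V \ β, g c i j) * ∏ i ∈ β.erase j, g c i j := by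
    rw [← hdiff, Finset.prod_sdiff (Finset.erase_subset_erase j hβ)]
  have hβV : dprod (g c) β (V \ β) = ((-1) ^ (V \ β).card * ∏ y ∈ V \ β, g c y j) *
      dprod (g c) (β.erase j) (V \ β) := by
    rw [← prod_g_swap, ← dprod_insert_left _ (Finset.notMem_erase _ _), Finset.insert_erase hj]
  have hf : ∏ i ∈ β.erase j, f c i j =
      (∏ i ∈ β.erase j, g c i j) * ∏ i ∈ β.erase j, h c i j := by
    simp only [f_eq_g_mul_h hc, Finset.prod_mul_distrib]
  rw [recCoeff, revCoeff, passCoeff, revBase, hdiff, hV, hβV, hf, ← Finset.prod_sdiff hα]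
  ring

theorem recCoeff_mul_revCoeff_mul_swapCoeff (hc : c ≠ 0) (hα : α ⊆ U) (hβ : β ⊆ V)
    (hj : j ∈ V \ β) (hx : x ∈ β) :
    recCoeff c q U V j * revCoeff c U (V.erase j) (β.erase x) α *
        swapCoeff c (V.erase j \ β.erase x) (β.erase x) j x =
      revBase c U V β α x * (g c j q *
        ((∏ s ∈ U \ α, f c j s) * (∏ z ∈ (V \ β).erase j, f c z j) * g c x j)) := by
  have hxS : x ∉ (V \ β).erase j := fun hmem =>
    (Finset.mem_sdiff.1 (Finset.mem_of_mem_erase hmem)).2 hx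
  have hdiff := erase_sdiff_erase_of_notMem hβ hj hx
  have hV : ∏ i ∈ V.erase j, g c i j = g c x j * (∏ i ∈ (V \ β).erase j, g c i j) *
      ∏ i ∈ β.erase x, g c i j := by
    have hsub : β.erase x ⊆ V.erase j := by grind
    rw [← Finset.prod_sdiff hsub, hdiff, Finset.prod_insert hxS]
  have hβV : dprod (g c) β (V \ β) = g c x j * ((-1) ^ ((V \ β).erase j).card *
      ∏ y ∈ (V \ β).erase j, g c y x) * ((∏ i ∈ β.erase x, g c i j) *
        dprod (g c) (β.erase x) ((V \ β).erase j)) := by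
    rw [← prod_g_swap, Finset.mul_prod_erase _ (fun y : D => g c x y) hj,
      ← dprod_insert_right _ _ (Finset.notMem_erase _ _), Finset.insert_erase hj,
      ← dprod_insert_left _ (Finset.notMem_erase _ _), Finset.insert_erase hx]
  have hVα : dprod (f c) (V \ β) α =
      (∏ s ∈ α, f c j s) * dprod (f c) ((V \ β).erase j) α := by
    rw [← dprod_insert_left _ (Finset.notMem_erase _ _), Finset.insert_erase hj]
  rw [recCoeff, revCoeff, swapCoeff, revBase, hdiff, Finset.erase_insert hxS, hV, hβV, hVα,
    dprod_insert_right _ _ hxS, dprod_insert_left _ hxS, Finset.card_insert_of_notMem hxS,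
    pow_succ, g_swap c j x, ← Finset.prod_sdiff hα]
  simp only [f_eq_g_mul_h hc, Finset.prod_mul_distrib]
  ring

theorem revCoeff_insert_insert (hc : c ≠ 0) (hq : q ∉ U) (hqV : q ∉ V) (hUV : Disjoint U V)
    (hα : α ⊆ U) (hβ : β ⊆ V) (hh : ∀ x ∈ V, ∀ z ∈ insert q U, h c x z ≠ 0) :
    revCoeff c (insert q U) V β (insert q α) =
      (∑ s ∈ U \ α, revCoeff c U V β (insert s α) * (g c q s * ∏ y ∈ α, f c y s)) +
      ((∑ j ∈ β, recCoeff c q U V j * revCoeff c U (V.erase j) (β.erase j) α *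
        passCoeff c (V \ β) (β.erase j) j) +
      ∑ j ∈ V \ β, ∑ x ∈ β, recCoeff c q U V j * revCoeff c U (V.erase j) (β.erase x) α *
        swapCoeff c (V.erase j \ β.erase x) (β.erase x) j x) := by
  have hh' : ∀ x ∈ V, ∀ z ∈ U, h c x z ≠ 0 := fun x hx z hz =>
    hh x hx z (Finset.mem_insert_of_mem hz)
  have hinsert : ∀ s ∈ U \ α, revCoeff c U V β (insert s α) * (g c q s * ∏ y ∈ α, f c y s) =
      ∑ x ∈ β, revBase c U V β α x * (g c q s * ((∏ s' ∈ (U \ α).erase s, f c s s') *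
        (∏ z ∈ V \ β, f c z s) * g c x s)) := fun s hs => by
    rw [mul_left_comm, revCoeff_insert_mul_prod_f hc hUV hα hβ hh' hs, Finset.mul_sum]
    exact Finset.sum_congr rfl fun x _ => mul_left_comm _ _ _
  rw [revCoeff_insert_insert_eq_sum hc hq hqV hUV hα hβ hh, Finset.sum_congr rfl hinsert,
    Finset.sum_congr rfl fun j hj => recCoeff_mul_revCoeff_mul_passCoeff hc hα hβ hj,
    Finset.sum_congr rfl fun j hj => Finset.sum_congr rfl fun x hx =>
      recCoeff_mul_revCoeff_mul_swapCoeff hc hα hβ hj hx,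
    Finset.sum_comm (s := U \ α), Finset.sum_comm (s := V \ β), ← Finset.sum_add_distrib,
    ← Finset.sum_add_distrib]
  refine Finset.sum_congr rfl fun x hx => ?_
  have hxU : x ∉ U := fun hmem => Finset.disjoint_left.1 hUV hmem (hβ hx)
  rw [g_mul_prod_f_mul_prod_f hc (hUV.mono Finset.sdiff_subset Finset.sdiff_subset)
    (fun hmem => hq (Finset.mem_sdiff.1 hmem).1) (fun hmem => hqV (Finset.mem_sdiff.1 hmem).1)
    (fun hmem => hxU (Finset.mem_sdiff.1 hmem).1) (fun hmem => (Finset.mem_sdiff.1 hmem).2 hx)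
    (ne_of_mem_of_not_mem (hβ hx) hqV), ← Finset.mul_sum, ← Finset.mul_sum]
  ring

theorem revCoeff_insert_of_subset (hq : q ∉ U) (hα : α ⊆ U) :
    revCoeff c (insert q U) V β α = revCoeff c U V β α * ∏ y ∈ α, f c y q := by
  rw [revCoeff, revCoeff, Finset.insert_sdiff_of_notMem _ fun hmem => hq (hα hmem),
    dprod_insert_right _ _ fun hmem => hq (Finset.mem_sdiff.1 hmem).1]
  ring

theorem revOp_insert (hc : c ≠ 0) (hT : IsMonodromy c T) (hq : q ∉ U) (hqV : q ∉ V)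
    (hUV : Disjoint U V) (hφ : NonvanishingOn (h c) V)
    (hh : ∀ x ∈ V, ∀ z ∈ insert q U, h c x z ≠ 0) :
    revOp c T (insert q U) V = recR c T U (revOp c T U) q V := by
  rw [recR, revOp_mul_T12 hT hq, sum_recCoeff_T13_mul_revOp_mul_T22 hc hT hq hφ, add_assoc, revOp,
    Finset.sum_powerset_insert hq]
  simp only [← Finset.sum_add_distrib, ← add_smul]
  refine Finset.sum_congr rfl fun α hα => Finset.sum_congr rfl fun β hβ => ?_
  have hα := Finset.mem_powerset.1 hα
  rw [revCoeff_insert_of_subset hq hα, Finset.insert_sdiff_of_notMem _ fun hmem => hq (hα hmem),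
    revCoeff_insert_insert hc hq hqV hUV hα (Finset.mem_powerset.1 hβ) hh,
    Finset.insert_sdiff_insert, Finset.sdiff_insert_of_notMem hq]

theorem xOp_eq_revOp (hc : c ≠ 0) (hT : IsMonodromy c T) (hU : NonvanishingOn (h c) U)
    (hV : NonvanishingOn (h c) V) (hUV : Disjoint U V) (hVU : ∀ x ∈ V, ∀ z ∈ U, h c x z ≠ 0) :
    xOp c T U V = revOp c T U V := by
  induction U using Finset.induction_on generalizing V with
  | empty => rw [xOp_empty, revOp_empty]
  | insert u U hu ih =>
    obtain ⟨huV, hUV⟩ := Finset.disjoint_insert_left.1 hUV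
    have hU' := hU.mono (Finset.subset_insert u U)
    rw [xOp_insert hc hT hu huV hUV hU, recL_xOp_eq_recR_xOp hc hT hU' hV hUV hu huV,
      revOp_insert hc hT hu huV hUV hV hVU]
    exact recR_congr fun W hW => ih hU' (hV.mono hW) (hUV.mono_right hW)
      fun x hx z hz => hVU x (hW hx) z (Finset.mem_insert_of_mem hz)

end ReversedOrdering

section IndexSets

variable {D : Set ℂ} {A : Type*} [Ring A] [Algebra ℂ A] {φ : ℂ → ℂ → ℂ} {c : ℂ} {t : D → A}
  {a b n : ℕ}

theorem pairProd_map (φ : ℂ → ℂ → ℂ) (x : Fin n → D) {l : List (Fin n)}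
    (hl : l.Pairwise (· < ·)) : pairProd φ (l.map x) =
      ∏ i ∈ l.toFinset, ∏ m ∈ l.toFinset with m < i, φ (x i) (x m) := by
  induction l with
  | nil => simp [pairProd]
  | cons k l ih =>
    obtain ⟨hk, hl⟩ := List.pairwise_cons.1 hl
    replace hk : ∀ i ∈ l.toFinset, k < i := fun i hi => hk i (List.mem_toFinset.1 hi)
    have hkl : k ∉ l.toFinset := fun hmem => lt_irrefl k (hk k hmem)
    have hmin : (insert k l.toFinset).filter (· < k) = ∅ :=
      Finset.filter_eq_empty_iff.2 <| Finset.forall_mem_insert _ _ _ |>.2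
        ⟨lt_irrefl k, fun i hi => (hk i hi).asymm⟩
    have hfilter : ∀ i ∈ l.toFinset, (insert k l.toFinset).filter (· < i) =
        insert k (l.toFinset.filter (· < i)) := fun i hi => by
      rw [Finset.filter_insert, if_pos (hk i hi)]
    rw [List.map_cons, pairProd, ih hl, List.toFinset_cons, Finset.prod_insert hkl, hmin,
      Finset.prod_empty, one_mul, List.map_map, ← List.prod_toFinset _ (hl.imp ne_of_lt),
      ← Finset.prod_mul_distrib]
    refine Finset.prod_congr rfl fun i hi => ?_
    rw [hfilter i hi, Finset.prod_insert fun hmem => hkl (Finset.mem_filter.1 hmem).1]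
    rfl

theorem listProd_map_sort (φ : ℂ → ℂ → ℂ) (t : D → A) (x : Fin n → D) (S : Finset (Fin n)) :
    listProd φ t ((S.sort (· ≤ ·)).map x) =
      (∏ l ∈ S, ∏ m ∈ S with m < l, φ (x l) (x m))⁻¹ • opProd t x S := by
  rw [listProd, pairProd_map _ _ (Finset.sortedLT_sort S).pairwise, Finset.sort_toFinset, opProd,
    List.map_map]
  rfl

theorem opProdCol_eq_listProd (c : ℂ) (t : D → A) (x : Fin n → D) (S : Finset (Fin n)) :
    opProdCol c t x S = listProd (h c) t ((S.sort (· ≤ ·)).map x) := by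
  rw [listProd_map_sort, opProdCol]

theorem opProdRow_eq_listProd (c : ℂ) (t : D → A) (x : Fin n → D) (S : Finset (Fin n)) :
    opProdRow c t x S = listProd (fun y z => h c z y) t ((S.sort (· ≤ ·)).map x) := by
  rw [listProd_map_sort, opProdRow]

theorem opProd_eq_listProd (t : D → A) (x : Fin n → D) (S : Finset (Fin n)) :
    opProd t x S = listProd 1 t ((S.sort (· ≤ ·)).map x) := by
  simp [listProd_map_sort]

theorem toList_map_perm (x : Fin n ↪ D) (S : Finset (Fin n)) :
    (S.map x).toList.Perm ((S.sort (· ≤ ·)).map x) := by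
  rw [← Multiset.coe_eq_coe, Finset.coe_toList, Finset.map_val, ← Multiset.map_coe,
    Finset.sort_eq]

theorem nonvanishingOn_map {x : Fin n ↪ D} (hx : ∀ j k, j ≠ k → φ (x j) (x k) ≠ 0)
    (S : Finset (Fin n)) : NonvanishingOn φ (S.map x) := by
  simp only [NonvanishingOn, Finset.forall_mem_map]
  exact fun j _ k _ hjk => hx j k fun hjk' => hjk (congrArg x hjk')

theorem opProdCol_eq_symProd (ht : ExchangeSymm (h c) t) {x : Fin n ↪ D}
    (hx : ∀ j k, j ≠ k → h c (x j) (x k) ≠ 0) (S : Finset (Fin n)) :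
    opProdCol c t x S = symProd (h c) t (S.map x) := by
  rw [opProdCol_eq_listProd,
    ht.symProd_eq_listProd (toList_map_perm x S) (nonvanishingOn_map hx S)]

theorem opProd_eq_symProd (ht : ExchangeSymm 1 t) (x : Fin n ↪ D) (S : Finset (Fin n)) :
    opProd t x S = symProd 1 t (S.map x) := by
  rw [opProd_eq_listProd, ht.symProd_eq_listProd (toList_map_perm x S) (nonvanishingOn_one _)]

theorem fprod_eq_dprod (φ : ℂ → ℂ → ℂ) (x : Fin a ↪ D) (S : Finset (Fin a)) (y : Fin b ↪ D)
    (R : Finset (Fin b)) : fprod φ x S y R = dprod φ (S.map x) (R.map y) := by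
  simp only [fprod, dprod, Finset.prod_map]

theorem map_compl (x : Fin n ↪ D) (S : Finset (Fin n)) :
    Sᶜ.map x = Finset.univ.map x \ S.map x := by
  rw [Finset.compl_eq_univ_sdiff, Finset.map_sdiff]

theorem Kpart_eq_setK (c : ℂ) (u : Fin a ↪ D) (v : Fin b ↪ D) (p : Part a b) :
    Kpart c u v p = setK c (p.V.map v) (p.U.map u) := by
  have hV : p.V.map v = Finset.univ.map ((p.V.orderEmbOfFin p.2).toEmbedding.trans v) := by
    rw [← Finset.map_map, Finset.map_orderEmbOfFin_univ]
  have hU : p.U.map u = Finset.univ.map ((p.U.orderEmbOfFin rfl).toEmbedding.trans u) := by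
    rw [← Finset.map_map, Finset.map_orderEmbOfFin_univ]
  rw [hV, hU, setK_map]
  rfl

theorem sum_powerset_map_univ {M : Type*} [AddCommMonoid M] (x : Fin n ↪ D) (F : Finset D → M) :
    ∑ α ∈ (Finset.univ.map x).powerset, F α = ∑ S : Finset (Fin n), F (S.map x) := by
  symm
  refine Finset.sum_nbij (fun S => S.map x)
    (fun S _ => Finset.mem_powerset.2 (Finset.map_subset_map.2 (Finset.subset_univ S)))
    (Finset.map_injective x).injOn (fun α hα => ?_) fun _ _ => rfl
  obtain ⟨S, _, rfl⟩ := Finset.subset_map_iff.1 (Finset.mem_powerset.1 hα)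
  exact ⟨S, Finset.mem_coe.2 (Finset.mem_univ S), rfl⟩

theorem sum_powerset_map_eq_sum_part {M : Type*} [AddCommMonoid M] (u : Fin a ↪ D)
    (v : Fin b ↪ D) {F : Finset D → Finset D → M} (hF : ∀ α β, β.card ≠ α.card → F α β = 0) :
    ∑ α ∈ (Finset.univ.map u).powerset, ∑ β ∈ (Finset.univ.map v).powerset, F α β =
      ∑ p : Part a b, F (p.U.map u) (p.V.map v) := by
  rw [sum_powerset_map_univ, Finset.sum_congr rfl fun S _ => sum_powerset_map_univ v (F (S.map u)),
    ← Fintype.sum_prod_type fun q : Finset (Fin a) × Finset (Fin b) =>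
      F (q.1.map u) (q.2.map v),
    ← Finset.sum_filter_of_ne (p := fun q => q.2.card = q.1.card) fun q _ hq => by
      by_contra hne
      exact hq (hF _ _ (by simpa only [Finset.card_map] using hne))]
  exact Finset.sum_subtype _ (fun q => by simp only [Finset.mem_filter_univ]) _

end IndexSets

section OrderingsOfX

variable {D : Set ℂ} {A : Type*} [Ring A] [Algebra ℂ A] {c : ℂ} {T : Fin 3 → Fin 3 → D → A}
  {a b : ℕ} {u : Fin a ↪ D} {v : Fin b ↪ D}

theorem xOp_eq_sum_coeffT13T12 (c : ℂ) (T : Fin 3 → Fin 3 → D → A) (U V : Finset D) :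
    xOp c T U V = ∑ α ∈ U.powerset, ∑ β ∈ V.powerset,
      (coeffT13T12 c U β α * dprod (g c) (V \ β) β) • (symProd (h c) (T 0 2) α *
        symProd 1 (T 0 1) (U \ α) * symProd (h c) (T 1 2) (V \ β) * symProd 1 (T 1 1) β) := by
  rw [Finset.sum_comm, xOp]
  refine Finset.sum_congr rfl fun β _ => ?_
  rw [rowT13T12, Finset.sum_mul, Finset.sum_mul, Finset.smul_sum]
  refine Finset.sum_congr rfl fun α _ => ?_
  rw [smul_mul_assoc, smul_mul_assoc, smul_smul, mul_comm (dprod _ _ _)]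

theorem xOp_eq_sum_coeffT12T13 (hc : c ≠ 0) (hT : IsMonodromy c T) {U V : Finset D}
    (hU : NonvanishingOn (h c) U) (hUV : Disjoint U V) :
    xOp c T U V = ∑ α ∈ U.powerset, ∑ β ∈ V.powerset,
      (coeffT12T13 c U β α * dprod (g c) (V \ β) β) • (symProd 1 (T 0 1) (U \ α) *
        symProd (h c) (T 0 2) α * symProd (h c) (T 1 2) (V \ β) * symProd 1 (T 1 1) β) := by
  rw [Finset.sum_comm, xOp]
  refine Finset.sum_congr rfl fun β hβ => ?_
  rw [rowT13T12_eq_rowT12T13 hc hT hU (hUV.mono_right (Finset.mem_powerset.1 hβ)), rowT12T13,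
    Finset.sum_mul, Finset.sum_mul, Finset.smul_sum]
  refine Finset.sum_congr rfl fun α _ => ?_
  rw [smul_mul_assoc, smul_mul_assoc, smul_smul, mul_comm (dprod _ _ _)]

theorem X_eq_xOp (hc : c ≠ 0) (hT : IsMonodromy c T)
    (hu : ∀ j k, j ≠ k → h c (u j) (u k) ≠ 0) (hv : ∀ j k, j ≠ k → h c (v j) (v k) ≠ 0) :
    X c T u v = xOp c T (Finset.univ.map u) (Finset.univ.map v) := by
  rw [xOp_eq_sum_coeffT13T12, sum_powerset_map_eq_sum_part, X]
  · refine Finset.sum_congr rfl fun p _ => ?_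
    rw [coeffT13T12, if_pos (by simpa only [Finset.card_map] using p.2), weightT13T12,
      opProdCol_eq_symProd (hT.exchangeSymm_odd hc rfl rfl) hu,
      opProdCol_eq_symProd (hT.exchangeSymm_odd hc rfl rfl) hv,
      opProd_eq_symProd (hT.exchangeSymm_even (i := 0) (j := 1) rfl),
      opProd_eq_symProd (hT.exchangeSymm_even (i := 1) (j := 1) rfl)]
    simp only [fprod_eq_dprod, map_compl, mul_right_comm]
  · intro α β hcard
    rw [coeffT13T12, if_neg hcard, zero_mul, zero_smul]

theorem disjoint_map_univ (huv : ∀ j k, u j ≠ v k) :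
    Disjoint (Finset.univ.map u) (Finset.univ.map v) := by
  simp only [Finset.disjoint_left, Finset.mem_map, Finset.mem_univ, true_and]
  rintro _ ⟨j, rfl⟩ ⟨k, hk⟩
  exact huv j k hk.symm

theorem X_eq_sum_T12_T13_T23 (hc : c ≠ 0) (hT : IsMonodromy c T) (huv : ∀ j k, u j ≠ v k)
    (hu : ∀ j k, j ≠ k → h c (u j) (u k) ≠ 0) (hv : ∀ j k, j ≠ k → h c (v j) (v k) ≠ 0) :
    X c T u v = ∑ p : Part a b,
      (fprod (g c) v p.V u p.U * fprod (f c) u p.Uᶜ u p.U * fprod (g c) v p.Vᶜ v p.V *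
          fprod (f c) v p.V u p.Uᶜ * fprod (h c) u p.U u p.U) •
        (opProd (T 0 1) u p.Uᶜ * opProdCol c (T 0 2) u p.U * opProdCol c (T 1 2) v p.Vᶜ *
          opProd (T 1 1) v p.V) := by
  rw [X_eq_xOp hc hT hu hv, xOp_eq_sum_coeffT12T13 hc hT (nonvanishingOn_map hu _)
    (disjoint_map_univ huv), sum_powerset_map_eq_sum_part]
  · refine Finset.sum_congr rfl fun p _ => ?_
    rw [coeffT12T13, if_pos (by simpa only [Finset.card_map] using p.2), weightT12T13,
      opProdCol_eq_symProd (hT.exchangeSymm_odd hc rfl rfl) hu,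
      opProdCol_eq_symProd (hT.exchangeSymm_odd hc rfl rfl) hv,
      opProd_eq_symProd (hT.exchangeSymm_even (i := 0) (j := 1) rfl),
      opProd_eq_symProd (hT.exchangeSymm_even (i := 1) (j := 1) rfl)]
    simp only [fprod_eq_dprod, map_compl, mul_right_comm]
  · intro α β hcard
    rw [coeffT12T13, if_neg hcard, zero_mul, zero_smul]

theorem X_eq_sum_T23_T13_T12 (hc : c ≠ 0) (hT : IsMonodromy c T) (huv : ∀ j k, u j ≠ v k)
    (hu : ∀ j k, j ≠ k → h c (u j) (u k) ≠ 0) (hv : ∀ j k, j ≠ k → h c (v j) (v k) ≠ 0)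
    (hvu : ∀ j k, h c (v j) (u k) ≠ 0) :
    X c T u v = ∑ p : Part a b,
      (Kpart c u v p * fprod (f c) u p.U u p.Uᶜ * fprod (g c) v p.V v p.Vᶜ *
          fprod (f c) v p.Vᶜ u p.U) •
        (opProdCol c (T 1 2) v p.Vᶜ * opProdCol c (T 0 2) v p.V * opProd (T 0 1) u p.Uᶜ *
          opProd (T 1 1) u p.U) := by
  have hVU : ∀ x ∈ Finset.univ.map v, ∀ z ∈ Finset.univ.map u, h c x z ≠ 0 := by
    simpa only [Finset.forall_mem_map, Finset.mem_univ, true_imp_iff] using hvu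
  rw [X_eq_xOp hc hT hu hv, xOp_eq_revOp hc hT (nonvanishingOn_map hu _) (nonvanishingOn_map hv _)
    (disjoint_map_univ huv) hVU, revOp, sum_powerset_map_eq_sum_part]
  · refine Finset.sum_congr rfl fun p _ => ?_
    rw [revCoeff, revWord, opProdCol_eq_symProd (hT.exchangeSymm_odd hc rfl rfl) hv,
      opProdCol_eq_symProd (hT.exchangeSymm_odd hc rfl rfl) hv,
      opProd_eq_symProd (hT.exchangeSymm_even (i := 0) (j := 1) rfl),
      opProd_eq_symProd (hT.exchangeSymm_even (i := 1) (j := 1) rfl)]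
    simp only [fprod_eq_dprod, map_compl, Kpart_eq_setK]
  · intro α β hcard
    rw [revCoeff, setK_of_card_ne c hcard.symm]
    simp only [zero_mul, zero_smul]

end OrderingsOfX

section BetheVectors

variable {D : Set ℂ} {H : Type*} [AddCommGroup H] [Module ℂ H] {c : ℂ}
  {T : Fin 3 → Fin 3 → D → Module.End ℂ H} {lam : Fin 3 → D → ℂ} {Ω : H}
  {a b : ℕ} {u : Fin a ↪ D} {v : Fin b ↪ D}

theorem IsVacuum.opProd_apply (hΩ : IsVacuum T lam Ω) (i : Fin 3) {n : ℕ} (x : Fin n → D)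
    (S : Finset (Fin n)) : opProd (T i i) x S Ω = (∏ k ∈ S, lam i (x k)) • Ω := by
  have hlist : ∀ l : List (Fin n), (l.map fun k => T i i (x k)).prod Ω =
      (l.map fun k => lam i (x k)).prod • Ω := fun l => by
    induction l with
    | nil => simp
    | cons k l ih =>
      rw [List.map_cons, List.prod_cons, Module.End.mul_apply, ih, map_smul, hΩ.diag, smul_smul,
        List.map_cons, List.prod_cons, mul_comm]
  rw [opProd, hlist, ← List.prod_toFinset _ (Finset.sort_nodup S _), Finset.sort_toFinset]

theorem bethe_eq_sum_T12_T13_T23 (hc : c ≠ 0) (hT : IsMonodromy c T) (hΩ : IsVacuum T lam Ω)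
    (huv : ∀ j k, u j ≠ v k) (hu : ∀ j k, j ≠ k → h c (u j) (u k) ≠ 0)
    (hv : ∀ j k, j ≠ k → h c (v j) (v k) ≠ 0) :
    bethe c T Ω u v = ∑ p : Part a b,
      (fprod (g c) v p.V u p.U * fprod (f c) u p.Uᶜ u p.U * fprod (g c) v p.Vᶜ v p.V *
          fprod (f c) v p.V u p.Uᶜ * fprod (h c) u p.U u p.U * ∏ k ∈ p.V, lam 1 (v k)) •
        (opProd (T 0 1) u p.Uᶜ * opProdCol c (T 0 2) u p.U * opProdCol c (T 1 2) v p.Vᶜ) Ω := by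
  rw [bethe, X_eq_sum_T12_T13_T23 hc hT huv hu hv, LinearMap.sum_apply]
  refine Finset.sum_congr rfl fun p _ => ?_
  rw [LinearMap.smul_apply, Module.End.mul_apply, hΩ.opProd_apply, map_smul, smul_smul]

theorem bethe_eq_sum_T23_T13_T12 (hc : c ≠ 0) (hT : IsMonodromy c T) (hΩ : IsVacuum T lam Ω)
    (huv : ∀ j k, u j ≠ v k) (hu : ∀ j k, j ≠ k → h c (u j) (u k) ≠ 0)
    (hv : ∀ j k, j ≠ k → h c (v j) (v k) ≠ 0) (hvu : ∀ j k, h c (v j) (u k) ≠ 0) :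
    bethe c T Ω u v = ∑ p : Part a b,
      (Kpart c u v p * fprod (f c) u p.U u p.Uᶜ * fprod (g c) v p.V v p.Vᶜ *
          fprod (f c) v p.Vᶜ u p.U * ∏ k ∈ p.U, lam 1 (u k)) •
        (opProdCol c (T 1 2) v p.Vᶜ * opProdCol c (T 0 2) v p.V * opProd (T 0 1) u p.Uᶜ) Ω := by
  rw [bethe, X_eq_sum_T23_T13_T12 hc hT huv hu hv hvu, LinearMap.sum_apply]
  refine Finset.sum_congr rfl fun p _ => ?_
  rw [LinearMap.smul_apply, Module.End.mul_apply, hΩ.opProd_apply, map_smul, smul_smul]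

end BetheVectors

section Functoriality

variable {D : Set ℂ} {A B : Type*} [Ring A] [Algebra ℂ A] [Ring B] [Algebra ℂ B] {n a b : ℕ}

theorem IsMonodromy.map {c : ℂ} {T : Fin 3 → Fin 3 → D → A} (hT : IsMonodromy c T)
    (F : A →ₐ[ℂ] B) : IsMonodromy c fun i j u => F (T i j u) := fun i j k l u v huv => by
  simpa only [map_sub, map_mul, map_smul] using congrArg F (hT i j k l u v huv)

theorem map_opProd (F : A →ₐ[ℂ] B) (t : D → A) (x : Fin n → D) (S : Finset (Fin n)) :
    F (opProd t x S) = opProd (fun d => F (t d)) x S := by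
  rw [opProd, opProd, map_list_prod, List.map_map]
  rfl

theorem map_opProdCol (F : A →ₐ[ℂ] B) (c : ℂ) (t : D → A) (x : Fin n → D) (S : Finset (Fin n)) :
    F (opProdCol c t x S) = opProdCol c (fun d => F (t d)) x S := by
  rw [opProdCol, opProdCol, map_smul, map_opProd]

theorem map_X (F : A →ₐ[ℂ] B) (c : ℂ) (T : Fin 3 → Fin 3 → D → A) (u : Fin a → D)
    (v : Fin b → D) : F (X c T u v) = X c (fun i j d => F (T i j d)) u v := by
  simp only [X, map_sum, map_smul, map_mul, map_opProd, map_opProdCol]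

end Functoriality

section Parity

variable {D : Set ℂ} {A : Type*} [Ring A] [Algebra ℂ A] {n a b : ℕ}

theorem opProd_smul (κ : ℂ) (t : D → A) (x : Fin n → D) (S : Finset (Fin n)) :
    opProd (fun d => κ • t d) x S = κ ^ S.card • opProd t x S := by
  rw [opProd, opProd]
  simpa only [List.map_map, Function.comp_def, List.length_map, Finset.length_sort] using
    (List.smul_prod ((S.sort (· ≤ ·)).map fun k => t (x k)) κ).symm

theorem opProdCol_smul (c κ : ℂ) (t : D → A) (x : Fin n → D) (S : Finset (Fin n)) :
    opProdCol c (fun d => κ • t d) x S = κ ^ S.card • opProdCol c t x S := by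
  rw [opProdCol, opProd_smul, smul_comm, opProdCol]

theorem card_add_card_compl (p : Part a b) : p.U.card + p.Vᶜ.card = b := by
  rw [← p.2, Finset.card_add_card_compl, Fintype.card_fin]

theorem parityAut_X (c : ℂ) (u : Fin a → D) (v : Fin b → D) :
    parityAut c D (X c (gen c D) u v) = (-1 : ℂ) ^ b • X c (gen c D) u v := by
  rw [map_X, X, X, Finset.smul_sum]
  refine Finset.sum_congr rfl fun p _ => ?_
  simp only [parityAut_gen, opProd_smul, opProdCol_smul, smul_mul_smul_comm]
  rw [(congrArg ((-1 : ℂ) ^ ·) (card_add_card_compl p)).symm]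
  simp [par, pow_add, smul_smul, mul_comm]

theorem psi_X (c : ℂ) (u : Fin a → D) (v : Fin b → D) :
    psi c D (X c (gen c D) u v) =
      (-Complex.I) ^ (b % 2) • (antiHom c D (X c (gen c D) u v)).unop :=
  psi_of_parity c D (Nat.mod_lt _ two_pos) (by rw [parityAut_X, neg_one_pow_eq_pow_mod_two])

end Parity

section Transposition

variable {D : Set ℂ} {H : Type*} [AddCommGroup H] [Module ℂ H] {c : ℂ}
  {T : Fin 3 → Fin 3 → D → Module.End ℂ H} {lam : Fin 3 → D → ℂ} {Ω' : Module.Dual ℂ H}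
  {n a b : ℕ}

/-- The transposed monodromy matrix, acting on the dual space. The factors are those of `antiHom`,
which make it a monodromy matrix again. -/
def dualT (T : Fin 3 → Fin 3 → D → Module.End ℂ H) (i j : Fin 3) (u : D) :
    Module.End ℂ (Module.Dual ℂ H) :=
  kap i j • (T j i u).dualMap

/-- Transposition of operators, as an algebra homomorphism on the opposite algebra. -/
def dualMapHom (H : Type*) [AddCommGroup H] [Module ℂ H] :
    (Module.End ℂ H)ᵐᵒᵖ →ₐ[ℂ] Module.End ℂ (Module.Dual ℂ H) :=
  AlgHom.ofLinearMap (Module.Dual.transpose ∘ₗ (MulOpposite.opLinearEquiv ℂ).symm.toLinearMap)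
    rfl fun _ _ => rfl

/-- The action on the dual space, by transposition, of the algebra of monodromy matrix entries
composed with its antimorphism `antiHom`. -/
def dualRep (c : ℂ) (T : Fin 3 → Fin 3 → D → Module.End ℂ H) (hT : IsMonodromy c T) :
    RTTAlgebra c D →ₐ[ℂ] Module.End ℂ (Module.Dual ℂ H) :=
  ((dualMapHom H).comp (AlgHom.op (lift c T hT))).comp (antiHom c D)

theorem dualRep_apply (hT : IsMonodromy c T) (x : RTTAlgebra c D) :
    dualRep c T hT x = (lift c T hT (antiHom c D x).unop).dualMap := rfl

theorem dualMap_smul (κ : ℂ) (t : Module.End ℂ H) : (κ • t).dualMap = κ • t.dualMap :=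
  map_smul (Module.Dual.transpose (R := ℂ) (M := H) (M' := H)) κ t

theorem antiHom_gen (c : ℂ) (i j : Fin 3) (u : D) :
    antiHom c D (gen c D i j u) = MulOpposite.op (kap i j • gen c D j i u) :=
  lift_gen c _ _ i j u

theorem dualRep_gen (hT : IsMonodromy c T) (i j : Fin 3) (u : D) :
    dualRep c T hT (gen c D i j u) = dualT T i j u := by
  rw [dualRep_apply, antiHom_gen, MulOpposite.unop_op, map_smul, lift_gen, dualMap_smul, dualT]

theorem isMonodromy_dualT (hT : IsMonodromy c T) : IsMonodromy c (dualT T) := by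
  simpa only [dualRep_gen] using (isMonodromy_gen c D).map (dualRep c T hT)

theorem kap_self (i : Fin 3) : kap i i = 1 := by
  fin_cases i <;> simp [kap, par]

theorem IsDualVacuum.isVacuum_dualT (hΩ' : IsDualVacuum T lam Ω') :
    IsVacuum (dualT T) lam Ω' where
  diag i u := by
    rw [dualT, kap_self, one_smul]
    exact hΩ'.diag i u
  lower i j u hij := by
    rw [dualT, LinearMap.smul_apply, LinearMap.dualMap_apply', hΩ'.upper j i u hij, smul_zero]

theorem dualBethe_eq_bethe_dualT (hT : IsMonodromy c T) (Ω' : Module.Dual ℂ H) (u : Fin a → D)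
    (v : Fin b → D) :
    dualBethe c T hT Ω' u v = (-Complex.I) ^ (b % 2) • bethe c (dualT T) Ω' u v := by
  have hX : X c (dualT T) u v = dualRep c T hT (X c (gen c D) u v) := by
    simp only [map_X, dualRep_gen]
  rw [dualBethe, psi_X, map_smul, LinearMap.comp_smul, bethe, hX, dualRep_apply,
    LinearMap.dualMap_apply']

theorem pairProd_append_singleton (φ : ℂ → ℂ → ℂ) (l : List D) (x : D) :
    pairProd φ (l ++ [x]) = (l.map fun y : D => φ x y).prod * pairProd φ l := by
  induction l with
  | nil => simp [pairProd]
  | cons y l ih =>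
    rw [List.cons_append, pairProd, ih, pairProd, List.map_append, List.prod_append,
      List.map_singleton, List.prod_singleton, List.map_cons, List.prod_cons]
    ring

theorem pairProd_reverse (φ : ℂ → ℂ → ℂ) (l : List D) :
    pairProd φ l.reverse = pairProd (fun y z => φ z y) l := by
  induction l with
  | nil => rfl
  | cons x l ih =>
    rw [List.reverse_cons, pairProd_append_singleton, ih, pairProd, List.map_reverse,
      List.prod_reverse]

theorem prod_map_reverse_dualMap (t : D → Module.End ℂ H) (l : List D) :
    (l.reverse.map fun d => (t d).dualMap).prod = (l.map t).prod.dualMap := by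
  change _ = dualMapHom H (MulOpposite.op (l.map t).prod)
  rw [MulOpposite.op_list_prod, map_list_prod, List.map_reverse, List.map_reverse, List.map_map,
    List.map_map]
  rfl

theorem listProd_smul_dualMap {φ : ℂ → ℂ → ℂ} {κ : ℂ} {t : D → Module.End ℂ H}
    (ht : ExchangeSymm φ fun d => κ • (t d).dualMap) {l : List D} (hnodup : l.Nodup)
    (hφ : ∀ x ∈ l, ∀ y ∈ l, x ≠ y → φ x y ≠ 0) :
    listProd φ (fun d => κ • (t d).dualMap) l =
      κ ^ l.length • (listProd (fun y z => φ z y) t l).dualMap := by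
  rw [ht.listProd_eq_of_perm l.reverse_perm.symm hnodup hφ, listProd, listProd, pairProd_reverse,
    dualMap_smul, ← prod_map_reverse_dualMap, smul_comm, ← List.length_reverse, ← List.length_map,
    List.smul_prod, List.map_map]
  rfl

theorem listProd_dualT {φ : ℂ → ℂ → ℂ} {i j : Fin 3} (hT : ExchangeSymm φ (dualT T i j))
    {x : Fin n ↪ D} (hx : ∀ j k, j ≠ k → φ (x j) (x k) ≠ 0) (S : Finset (Fin n)) :
    listProd φ (dualT T i j) ((S.sort (· ≤ ·)).map x) = kap i j ^ S.card •
      (listProd (fun y z => φ z y) (T j i) ((S.sort (· ≤ ·)).map x)).dualMap := by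
  have hφ : ∀ y ∈ (S.sort (· ≤ ·)).map x, ∀ z ∈ (S.sort (· ≤ ·)).map x, y ≠ z → φ y z ≠ 0 := by
    simp only [List.forall_mem_map]
    exact fun j _ k _ hjk => hx j k fun hjk' => hjk (congrArg x hjk')
  have hprod := listProd_smul_dualMap hT ((Finset.sort_nodup S _).map x.injective) hφ
  rwa [List.length_map, Finset.length_sort] at hprod

theorem opProd_dualT (hT : IsMonodromy c T) {i j : Fin 3} (hij : par i = par j) (x : Fin n ↪ D)
    (S : Finset (Fin n)) :
    opProd (dualT T i j) x S = kap i j ^ S.card • (opProd (T j i) x S).dualMap := by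
  rw [opProd_eq_listProd, opProd_eq_listProd]
  exact listProd_dualT ((isMonodromy_dualT hT).exchangeSymm_even hij) (fun _ _ _ => one_ne_zero) S

theorem opProdCol_dualT (hc : c ≠ 0) (hT : IsMonodromy c T) {i j : Fin 3} (hi : par i = 0)
    (hj : par j = 1) {x : Fin n ↪ D} (hx : ∀ j k, j ≠ k → h c (x j) (x k) ≠ 0)
    (S : Finset (Fin n)) : opProdCol c (dualT T i j) x S =
      kap i j ^ S.card • (opProdRow c (T j i) x S).dualMap := by
  rw [opProdCol_eq_listProd, opProdRow_eq_listProd,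
    listProd_dualT ((isMonodromy_dualT hT).exchangeSymm_odd hc hi hj) hx]

end Transposition

section DualBetheVectors

variable {D : Set ℂ} {H : Type*} [AddCommGroup H] [Module ℂ H] {c : ℂ}
  {T : Fin 3 → Fin 3 → D → Module.End ℂ H} {lam : Fin 3 → D → ℂ} {Ω' : Module.Dual ℂ H}
  {a b : ℕ} {u : Fin a ↪ D} {v : Fin b ↪ D}

theorem neg_I_pow_mod_two_mul_I_pow (b : ℕ) :
    (-Complex.I) ^ (b % 2) * Complex.I ^ b = (-1) ^ (b * (b - 1) / 2) := by
  rw [← Nat.choose_two_right]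
  induction b using Nat.twoStepInduction with
  | zero => simp
  | one => simp
  | more b ih _ =>
    have hchoose : (b + 2).choose 2 = b.choose 2 + 2 * b + 1 := by
      simp only [Nat.choose_succ_succ', Nat.choose_zero_right, zero_add, Nat.choose_one_right]
      ring
    rw [Nat.add_mod_right, pow_add, Complex.I_sq, ← mul_assoc, ih, hchoose, pow_add, pow_add,
      pow_mul, neg_one_sq, one_pow, pow_one, mul_one]

theorem kap_zero_one : kap 0 1 = 1 := by simp [kap, par]

theorem kap_zero_two : kap 0 2 = Complex.I := by simp [kap, par]

theorem kap_one_two : kap 1 2 = Complex.I := by simp [kap, par]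

theorem dualBethe_eq_sum_T32_T31_T21 (hc : c ≠ 0) (hT : IsMonodromy c T)
    (hΩ' : IsDualVacuum T lam Ω') (huv : ∀ j k, u j ≠ v k)
    (hu : ∀ j k, j ≠ k → h c (u j) (u k) ≠ 0) (hv : ∀ j k, j ≠ k → h c (v j) (v k) ≠ 0) :
    dualBethe c T hT Ω' u v = (-1 : ℂ) ^ (b * (b - 1) / 2) • ∑ p : Part a b,
      (fprod (g c) v p.V u p.U * fprod (f c) u p.Uᶜ u p.U * fprod (g c) v p.Vᶜ v p.V *
          fprod (f c) v p.V u p.Uᶜ * fprod (h c) u p.U u p.U * ∏ k ∈ p.V, lam 1 (v k)) •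
        (Ω' ∘ₗ (opProdRow c (T 2 1) v p.Vᶜ * opProdRow c (T 2 0) u p.U *
          opProd (T 1 0) u p.Uᶜ)) := by
  rw [dualBethe_eq_bethe_dualT,
    bethe_eq_sum_T12_T13_T23 hc (isMonodromy_dualT hT) hΩ'.isVacuum_dualT huv hu hv,
    ← neg_I_pow_mod_two_mul_I_pow, mul_smul]
  congr 1
  rw [Finset.smul_sum]
  refine Finset.sum_congr rfl fun p _ => ?_
  rw [opProd_dualT hT (i := 0) (j := 1) rfl, opProdCol_dualT hc hT rfl rfl hu,
    opProdCol_dualT hc hT rfl rfl hv, kap_zero_one, kap_zero_two, kap_one_two, one_pow, one_smul,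
    mul_smul_comm, mul_smul_comm, smul_mul_assoc, smul_smul, ← pow_add, add_comm p.Vᶜ.card,
    card_add_card_compl, LinearMap.smul_apply, smul_comm]
  rfl

theorem dualBethe_eq_sum_T21_T31_T32 (hc : c ≠ 0) (hT : IsMonodromy c T)
    (hΩ' : IsDualVacuum T lam Ω') (huv : ∀ j k, u j ≠ v k)
    (hu : ∀ j k, j ≠ k → h c (u j) (u k) ≠ 0) (hv : ∀ j k, j ≠ k → h c (v j) (v k) ≠ 0)
    (hvu : ∀ j k, h c (v j) (u k) ≠ 0) :
    dualBethe c T hT Ω' u v = (-1 : ℂ) ^ (b * (b - 1) / 2) • ∑ p : Part a b,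
      (Kpart c u v p * fprod (f c) u p.U u p.Uᶜ * fprod (g c) v p.V v p.Vᶜ *
          fprod (f c) v p.Vᶜ u p.U * ∏ k ∈ p.U, lam 1 (u k)) •
        (Ω' ∘ₗ (opProd (T 1 0) u p.Uᶜ * opProdRow c (T 2 0) v p.V *
          opProdRow c (T 2 1) v p.Vᶜ)) := by
  rw [dualBethe_eq_bethe_dualT,
    bethe_eq_sum_T23_T13_T12 hc (isMonodromy_dualT hT) hΩ'.isVacuum_dualT huv hu hv hvu,
    ← neg_I_pow_mod_two_mul_I_pow, mul_smul]
  congr 1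
  rw [Finset.smul_sum]
  refine Finset.sum_congr rfl fun p _ => ?_
  rw [opProd_dualT hT (i := 0) (j := 1) rfl, opProdCol_dualT hc hT rfl rfl hv,
    opProdCol_dualT hc hT rfl rfl hv, kap_zero_one, kap_zero_two, kap_one_two, one_pow, one_smul,
    smul_mul_smul_comm, smul_mul_assoc, ← pow_add, Finset.card_compl_add_card, Fintype.card_fin,
    LinearMap.smul_apply, smul_comm]
  rfl

end DualBetheVectors

end

end GL21

theorem mainTheorem4 (c : ℂ) (hc : c ≠ 0) (D : Set ℂ)
    {H : Type*} [AddCommGroup H] [Module ℂ H]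
    (T : Fin 3 → Fin 3 → D → Module.End ℂ H) (hT : GL21.IsMonodromy c T)
    (lam : Fin 3 → D → ℂ)
    (Ω : H) (hΩ : GL21.IsVacuum T lam Ω)
    (Ω' : Module.Dual ℂ H) (hΩ' : GL21.IsDualVacuum T lam Ω')
    (a b : ℕ) (u : Fin a → D) (v : Fin b → D)
    (hu : Function.Injective u) (hv : Function.Injective v) (huv : ∀ j k, u j ≠ v k)
    (hhu : ∀ j k, j ≠ k → GL21.h c (u j) (u k) ≠ 0)
    (hhv : ∀ j k, j ≠ k → GL21.h c (v j) (v k) ≠ 0)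
    (hhvu : ∀ j k, GL21.h c (v j) (u k) ≠ 0) :
    GL21.bethe c T Ω u v =
        ∑ p : GL21.Part a b,
          (GL21.fprod (GL21.g c) v p.V u p.U * GL21.fprod (GL21.f c) u p.Uᶜ u p.U *
            GL21.fprod (GL21.g c) v p.Vᶜ v p.V * GL21.fprod (GL21.f c) v p.V u p.Uᶜ *
            GL21.fprod (GL21.h c) u p.U u p.U * ∏ k ∈ p.V, lam 1 (v k)) •
          (GL21.opProd (T 0 1) u p.Uᶜ * GL21.opProdCol c (T 0 2) u p.U *
            GL21.opProdCol c (T 1 2) v p.Vᶜ) Ω ∧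
      GL21.bethe c T Ω u v =
        ∑ p : GL21.Part a b,
          (GL21.Kpart c u v p * GL21.fprod (GL21.f c) u p.U u p.Uᶜ *
            GL21.fprod (GL21.g c) v p.V v p.Vᶜ * GL21.fprod (GL21.f c) v p.Vᶜ u p.U *
            ∏ k ∈ p.U, lam 1 (u k)) •
          (GL21.opProdCol c (T 1 2) v p.Vᶜ * GL21.opProdCol c (T 0 2) v p.V *
            GL21.opProd (T 0 1) u p.Uᶜ) Ω ∧
      GL21.dualBethe c T hT Ω' u v =
        (-1 : ℂ) ^ (b * (b - 1) / 2) • ∑ p : GL21.Part a b,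
          (GL21.fprod (GL21.g c) v p.V u p.U * GL21.fprod (GL21.f c) u p.Uᶜ u p.U *
            GL21.fprod (GL21.g c) v p.Vᶜ v p.V * GL21.fprod (GL21.f c) v p.V u p.Uᶜ *
            GL21.fprod (GL21.h c) u p.U u p.U * ∏ k ∈ p.V, lam 1 (v k)) •
          (Ω' ∘ₗ (GL21.opProdRow c (T 2 1) v p.Vᶜ * GL21.opProdRow c (T 2 0) u p.U *
            GL21.opProd (T 1 0) u p.Uᶜ)) ∧
      GL21.dualBethe c T hT Ω' u v =
        (-1 : ℂ) ^ (b * (b - 1) / 2) • ∑ p : GL21.Part a b,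
          (GL21.Kpart c u v p * GL21.fprod (GL21.f c) u p.U u p.Uᶜ *
            GL21.fprod (GL21.g c) v p.V v p.Vᶜ * GL21.fprod (GL21.f c) v p.Vᶜ u p.U *
            ∏ k ∈ p.U, lam 1 (u k)) •
          (Ω' ∘ₗ (GL21.opProd (T 1 0) u p.Uᶜ * GL21.opProdRow c (T 2 0) v p.V *
            GL21.opProdRow c (T 2 1) v p.Vᶜ)) := by
  lift u to Fin a ↪ D using hu
  lift v to Fin b ↪ D using hv
  exact ⟨GL21.bethe_eq_sum_T12_T13_T23 hc hT hΩ huv hhu hhv,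
    GL21.bethe_eq_sum_T23_T13_T12 hc hT hΩ huv hhu hhv hhvu,
    GL21.dualBethe_eq_sum_T32_T31_T21 hc hT hΩ' huv hhu hhv,
    GL21.dualBethe_eq_sum_T21_T31_T32 hc hT hΩ' huv hhu hhv hhvu⟩
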